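/- Fix $\lambda>0$ and write $\Lambda=\lambda+\tilde\Lambda$, $\Psi=(\tilde\Lambda,\phi)$. Consider, for real-valued functions of $(t,x)$, $t\ge 0$, $x\in\mathbb R$, the initial value problem $$-\partial_t^2\Psi+\partial_x^2\Psi=F(\Psi,\partial\Psi)=(F_1,F_2),\qquad (\Psi,\partial_t\Psi)|_{t=0}=(\Psi_0,\Psi_1)\in\mathcal H:=H^1(\mathbb R)\times H^1(\mathbb R)\times L^2(\mathbb R)\times L^2(\mathbb R),\tag{IVP}$$ $$F_1=2\sinh(2\lambda+2\tilde\Lambda)\big((\partial_x\phi)^2-(\partial_t\phi)^2\big),\qquad F_2=\frac{\sinh(2\lambda+2\tilde\Lambda)}{\sinh^2(\lambda+\tilde\Lambda)}\big(\partial_t\phi\,\partial_t\tilde\Lambda-\partial_x\phi\,\partial_x\tilde\Lambda\big).$$ Let $\|(\Psi_0,\Psi_1)\|_{\mathcal H}=\|\Psi_0\|_{H^1\times H^1}+\|\Psi_1\|_{L^2\times L^2}$ (Euclidean norms on each of the two products) and $\|(\Psi,\partial_t\Psi)\|_{L^\infty([0,T];\mathcal H)}=\sup_{t\in[0,T]}\|(\Psi(t),\partial_t\Psi(t))\|_{\mathcal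 H}$. A solution on $[0,T]$ is a jointly measurable curve $t\mapsto(\Psi(t),\partial_t\Psi(t))\in\mathcal H$, $t\in[0,T]$, that has the value $(\Psi_0,\Psi_1)$ at $t=0$, for which for every $t$ one has $\lambda+\tilde\Lambda(t,x)\neq0$ for a.e. $x$, for which $F_1,F_2$ are locally integrable on $[0,T]\times\mathbb R$, and which satisfies the equation in the sense of distributions: for all $\eta\in C_c^\infty(\mathbb R)$ and $t\in[0,T]$, $$\langle\Psi(t),\eta\rangle=\langle\Psi(0),\eta\rangle+\int_0^t\langle\partial_t\Psi(s),\eta\rangle\,ds,\qquad \langle\partial_t\Psi(t),\eta\rangle=\langle\partial_t\Psi(0),\eta\rangle+\int_0^t\big(\langle\Psi(s),\eta''\rangle-\langle F(s),\eta\rangle\big)\,ds .$$ **Proposition.** There are a constant $D\ge1$ and a function $T=T(a,b,\lambda)>0$ such that for every $\lambda>0$ and all data with $\|(\Psi_0,\Psi_1)\|_{\mathcal H}\le\frac{\lambda}{2D}$ the following hold with $T=T\big(\|\Psi_0\|_{H^1\times H^1},\|\Psi_1\|_{L^2\times L^2},\lambda\big)$. 1. (Existence and uniqueness.) (IVP)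 has a solution on $[0,T]$ with $(\Psi,\partial_t\Psi)\in L^\infty([0,T];\mathcal H)$, and $\lambda+\tilde\Lambda$ is bounded below on $[0,T]\times\mathbb R$ by a positive constant. If $\Psi_0\in C^2\times C^2$ and $\Psi_1\in C^1\times C^1$, this solution is classical: $\Psi\in C^2([0,T]\times\mathbb R)$ and (IVP) holds pointwise. Every solution on $[0,T]$ with the same data and with $(\Psi,\partial_t\Psi)\in L^\infty([0,T];\mathcal H)$ coincides with it. 2. (Continuous dependence.) Let $(\Psi_0^{(i)},\Psi_1^{(i)})\in\mathcal H$ with $\Psi_0^{(i)}\to\Psi_0$ in $H^1\times H^1$ and $\Psi_1^{(i)}\to\Psi_1$ in $L^2\times L^2$. Then for all large $i$ there is a solution $\Psi^{(i)}$ on $[0,T]$ with data $(\Psi_0^{(i)},\Psi_1^{(i)})$ and $(\Psi^{(i)},\partial_t\Psi^{(i)})\in L^\infty([0,T];\mathcal H)$, and for any such solutions $$\big\|(\Psi^{(i)}-\Psi,\ \partial_t(\Psi^{(i)}-\Psi))\big\|_{L^\infty([0,T];\mathcal H)}\longrightarrow0 .$$ -/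

import Mathlib

open Set Filter Topology MeasureTheory
open scoped ContDiff ENNReal

noncomputable section

namespace PCF

/-! Everything below is real valued; `lam` is the positive constant in `Λ = lam + Λ̃`, and the
unknown is `Ψ = (Λ̃, φ)`. -/

/-- `g` is the weak (distributional) derivative of `f` on the real line. -/
def HasWeakDeriv (f g : ℝ → ℝ) : Prop :=
  ∀ η : ℝ → ℝ, ContDiff ℝ ∞ η → HasCompactSupport η →
    ∫ x, f x * deriv η x = -∫ x, g x * η x

/-- The `L²(ℝ)` norm (used only for functions that are in `L²`). -/
def l2norm (f : ℝ → ℝ) : ℝ := (eLpNorm f 2 volume).toReal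

/-- An element of `H¹(ℝ)`: a square integrable function together with its (a.e. unique) square
integrable weak derivative. -/
structure H1 where
  /-- the function -/
  toFun : ℝ → ℝ
  /-- its weak derivative -/
  dx : ℝ → ℝ
  memLp_toFun : MemLp toFun 2 volume
  memLp_dx : MemLp dx 2 volume
  hasWeakDeriv : HasWeakDeriv toFun dx

/-- An element of `L²(ℝ)`, as a function. -/
structure L2 where
  /-- the function -/
  toFun : ℝ → ℝ
  memLp_toFun : MemLp toFun 2 volume

theorem integrable_mul_test {f η : ℝ → ℝ} (hf : MemLp f 2 volume) (hη : Continuous η)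
    (hc : HasCompactSupport η) : Integrable (fun x => f x * η x) volume :=
  hf.integrable_mul (p := 2) (q := 2) (hη.memLp_of_hasCompactSupport hc)

instance : Sub H1 where
  sub f g :=
    { toFun := fun x => f.toFun x - g.toFun x
      dx := fun x => f.dx x - g.dx x
      memLp_toFun := f.memLp_toFun.sub g.memLp_toFun
      memLp_dx := f.memLp_dx.sub g.memLp_dx
      hasWeakDeriv := by
        intro η hη hc
        have hη' : Continuous (deriv η) := hη.continuous_deriv (by simp)
        simp only [sub_mul]
        rw [integral_sub (integrable_mul_test f.memLp_toFun hη' hc.deriv)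
            (integrable_mul_test g.memLp_toFun hη' hc.deriv),
          integral_sub (integrable_mul_test f.memLp_dx hη.continuous hc)
            (integrable_mul_test g.memLp_dx hη.continuous hc),
          f.hasWeakDeriv η hη hc, g.hasWeakDeriv η hη hc]
        ring }

instance : Sub L2 where
  sub f g :=
    { toFun := fun x => f.toFun x - g.toFun x
      memLp_toFun := f.memLp_toFun.sub g.memLp_toFun }

/-- The energy space `H¹(ℝ) × H¹(ℝ) × L²(ℝ) × L²(ℝ)`: an element is a pair
`(Ψ, Ψₜ) = ((Λ̃, φ), (Λ̃ₜ, φₜ))`. -/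
structure EnergySpace where
  /-- the component `Λ̃` -/
  Lam : H1
  /-- the component `φ` -/
  phi : H1
  /-- the velocity component of `Λ̃` -/
  Lamt : L2
  /-- the velocity component of `φ` -/
  phit : L2

namespace EnergySpace

instance : Sub EnergySpace where
  sub u v := ⟨u.Lam - v.Lam, u.phi - v.phi, u.Lamt - v.Lamt, u.phit - v.phit⟩

/-- The norm of `Ψ` in `H¹(ℝ) × H¹(ℝ)`. -/
def posNorm (u : EnergySpace) : ℝ :=
  √(l2norm u.Lam.toFun ^ 2 + l2norm u.Lam.dx ^ 2 + l2norm u.phi.toFun ^ 2 + l2norm u.phi.dx ^ 2)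

/-- The norm of `Ψₜ` in `L²(ℝ) × L²(ℝ)`. -/
def velNorm (u : EnergySpace) : ℝ :=
  √(l2norm u.Lamt.toFun ^ 2 + l2norm u.phit.toFun ^ 2)

/-- The norm of the energy space. -/
def norm (u : EnergySpace) : ℝ := u.posNorm + u.velNorm

/-- Two elements of the energy space are the same class of functions. -/
def AEEq (u v : EnergySpace) : Prop :=
  u.Lam.toFun =ᵐ[volume] v.Lam.toFun ∧ u.phi.toFun =ᵐ[volume] v.phi.toFun ∧
    u.Lamt.toFun =ᵐ[volume] v.Lamt.toFun ∧ u.phit.toFun =ᵐ[volume] v.phit.toFun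

end EnergySpace

/-- The first nonlinearity, as a function of `Λ̃`, `φₜ`, `φₓ`. -/
def F1 (lam L pt px : ℝ) : ℝ :=
  2 * Real.sinh (2 * lam + 2 * L) * (px ^ 2 - pt ^ 2)

/-- The second nonlinearity, as a function of `Λ̃`, `Λ̃ₜ`, `Λ̃ₓ`, `φₜ`, `φₓ`
(meaningful for `lam + Λ̃ ≠ 0`). -/
def F2 (lam L Lt Lx pt px : ℝ) : ℝ :=
  Real.sinh (2 * lam + 2 * L) / Real.sinh (lam + L) ^ 2 * (pt * Lt - px * Lx)

/-- `F₁(Ψ, ∂Ψ)` along a curve `t ↦ (Ψ(t), ∂ₜΨ(t))` in the energy space. -/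
def N1 (lam : ℝ) (U : ℝ → EnergySpace) (t x : ℝ) : ℝ :=
  F1 lam ((U t).Lam.toFun x) ((U t).phit.toFun x) ((U t).phi.dx x)

/-- `F₂(Ψ, ∂Ψ)` along a curve `t ↦ (Ψ(t), ∂ₜΨ(t))` in the energy space. -/
def N2 (lam : ℝ) (U : ℝ → EnergySpace) (t x : ℝ) : ℝ :=
  F2 lam ((U t).Lam.toFun x) ((U t).Lamt.toFun x) ((U t).Lam.dx x)
    ((U t).phit.toFun x) ((U t).phi.dx x)

/-- The norm of `L^∞([0,T]; 𝓗)`: the supremum over `t ∈ [0,T]` of the energy space norm. -/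
def linfNorm (T : ℝ) (U : ℝ → EnergySpace) : ℝ≥0∞ :=
  ⨆ t ∈ Icc (0 : ℝ) T, ENNReal.ofReal (U t).norm

/-- Membership in `L^∞([0,T]; 𝓗)`; the values of the curve outside `[0,T]` play no role. -/
structure MemLinf (T : ℝ) (U : ℝ → EnergySpace) : Prop where
  meas_Lam : AEStronglyMeasurable (fun z : ℝ × ℝ => (U z.1).Lam.toFun z.2)
    (volume.restrict (Icc 0 T ×ˢ univ))
  meas_Lamx : AEStronglyMeasurable (fun z : ℝ × ℝ => (U z.1).Lam.dx z.2)
    (volume.restrict (Icc 0 T ×ˢ univ))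
  meas_phi : AEStronglyMeasurable (fun z : ℝ × ℝ => (U z.1).phi.toFun z.2)
    (volume.restrict (Icc 0 T ×ˢ univ))
  meas_phix : AEStronglyMeasurable (fun z : ℝ × ℝ => (U z.1).phi.dx z.2)
    (volume.restrict (Icc 0 T ×ˢ univ))
  meas_Lamt : AEStronglyMeasurable (fun z : ℝ × ℝ => (U z.1).Lamt.toFun z.2)
    (volume.restrict (Icc 0 T ×ˢ univ))
  meas_phit : AEStronglyMeasurable (fun z : ℝ × ℝ => (U z.1).phit.toFun z.2)
    (volume.restrict (Icc 0 T ×ˢ univ))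
  norm_lt_top : linfNorm T U < ⊤

/-- Distributional form of `∂ₜψ = v`, `-∂ₜv + ∂ₓ²ψ = N` on `[0,T] × ℝ`, for curves of functions
`ψ(t), v(t), N(t)`: tested against every smooth compactly supported `η(x)` and integrated in time
from `0` to an arbitrary `t ∈ [0,T]`. -/
def IsWeakWave (T : ℝ) (ψ v N : ℝ → ℝ → ℝ) : Prop :=
  ∀ η : ℝ → ℝ, ContDiff ℝ ∞ η → HasCompactSupport η → ∀ t ∈ Icc (0 : ℝ) T,
    (∫ x, ψ t x * η x = (∫ x, ψ 0 x * η x) + ∫ s in (0 : ℝ)..t, ∫ x, v s x * η x) ∧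
    (∫ x, v t x * η x = (∫ x, v 0 x * η x) +
      ∫ s in (0 : ℝ)..t, ((∫ x, ψ s x * iteratedDeriv 2 η x) - ∫ x, N s x * η x))

/-- `U : t ↦ (Ψ(t), ∂ₜΨ(t))` is a solution on `[0,T]` of the initial value problem
`-∂ₜ²Ψ + ∂ₓ²Ψ = F(Ψ, ∂Ψ)`, `(Ψ, ∂ₜΨ)(0) = u₀`, in the sense of distributions. The nonlinearity
has to make sense: `lam + Λ̃` is nonzero almost everywhere and `F(Ψ, ∂Ψ)` is locally
integrable. -/
structure IsSolution (lam T : ℝ) (u₀ : EnergySpace) (U : ℝ → EnergySpace) : Prop where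
  initial : (U 0).AEEq u₀
  ne_zero : ∀ t ∈ Icc (0 : ℝ) T, ∀ᵐ x, lam + (U t).Lam.toFun x ≠ 0
  integrable_N1 : ∀ R : ℝ,
    IntegrableOn (fun z : ℝ × ℝ => N1 lam U z.1 z.2) (Icc 0 T ×ˢ Icc (-R) R) volume
  integrable_N2 : ∀ R : ℝ,
    IntegrableOn (fun z : ℝ × ℝ => N2 lam U z.1 z.2) (Icc 0 T ×ˢ Icc (-R) R) volume
  wave_Lam : IsWeakWave T (fun t => (U t).Lam.toFun) (fun t => (U t).Lamt.toFun) (N1 lam U)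
  wave_phi : IsWeakWave T (fun t => (U t).phi.toFun) (fun t => (U t).phit.toFun) (N2 lam U)

/-- The initial data are of class `C² × C²` (for `Ψ`) and `C¹ × C¹` (for `∂ₜΨ`). -/
structure IsC2Data (u₀ : EnergySpace) : Prop where
  Lam : ContDiff ℝ 2 u₀.Lam.toFun
  phi : ContDiff ℝ 2 u₀.phi.toFun
  Lamt : ContDiff ℝ 1 u₀.Lamt.toFun
  phit : ContDiff ℝ 1 u₀.phit.toFun

/-- The curve `U` is given by functions of `(t,x)` of class `C²` on `[0,T] × ℝ` that satisfy the
system pointwise. -/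
def IsClassical (lam T : ℝ) (U : ℝ → EnergySpace) : Prop :=
  ∃ L p : ℝ → ℝ → ℝ,
    ContDiffOn ℝ 2 (fun z : ℝ × ℝ => L z.1 z.2) (Icc 0 T ×ˢ univ) ∧
    ContDiffOn ℝ 2 (fun z : ℝ × ℝ => p z.1 z.2) (Icc 0 T ×ˢ univ) ∧
    (∀ t ∈ Icc (0 : ℝ) T,
      (U t).Lam.toFun =ᵐ[volume] L t ∧ (U t).phi.toFun =ᵐ[volume] p t ∧
      (U t).Lamt.toFun =ᵐ[volume] (fun x => derivWithin (fun s => L s x) (Icc 0 T) t) ∧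
      (U t).phit.toFun =ᵐ[volume] (fun x => derivWithin (fun s => p s x) (Icc 0 T) t)) ∧
    (∀ t ∈ Icc (0 : ℝ) T, ∀ x : ℝ, lam + L t x ≠ 0) ∧
    (∀ t ∈ Ioo (0 : ℝ) T, ∀ x : ℝ,
      -iteratedDeriv 2 (fun s => L s x) t + iteratedDeriv 2 (L t) x =
        F1 lam (L t x) (deriv (fun s => p s x) t) (deriv (p t) x) ∧
      -iteratedDeriv 2 (fun s => p s x) t + iteratedDeriv 2 (p t) x =
        F2 lam (L t x) (deriv (fun s => L s x) t) (deriv (L t) x)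
          (deriv (fun s => p s x) t) (deriv (p t) x))

end PCF

end

/-! With `Λ = lam + Λ̃`, the system is the wave map equation into the hyperbolic plane with metric
`dΛ² + 4 sinh² Λ dφ²`. In one space dimension it becomes a pair of rotations. Put `P₁ = Λₜ + Λₓ`,
`P₂ = 2 sinh Λ (φₜ + φₓ)`, and let `Q₁`, `Q₂` be the same expressions with minus signs. Then `(∂ₜ -
∂ₓ)P₁ = k P₂` and `(∂ₜ - ∂ₓ)P₂ = -k P₁` with `k = coth Λ · Q₂`. In the same way `(Q₁, Q₂)` rotates
along the other family of characteristics with angular velocity `coth Λ · P₂`. Hence `P₁² + P₂²` and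
`Q₁² + Q₂²` are constant along their characteristics, and a solution is encoded by two angles `a`,
`b` and the function `L = Λ̃`. The `L²` data are merely transported and rotated.

The angle `a` is the integral of `coth Λ · Q₂` along a line on which the data of `Q` are sampled
transversally, so Cauchy–Schwarz bounds it by a constant times `√T` times the `L²` norm of the data.
This is the use of the null structure: two `L²` factors belonging to the same family are never
multiplied. On bounded continuous triples `(a, b, L)` the system is therefore a contraction for
short times (`exists_isFrame`), and `IsFrame.Lam_field`, `IsFrame.phi_field` and
`FrameData.exists_solution` read off a weak solution.

The singularity at `Λ = 0` is avoided without a continuity argument. Since rotations keep lengths,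
`L` differs from its initial value by at most `√T` times the norm of the data, whatever the angles
are. This gives `|Λ̃| ≤ lam / 2` both for the constructed solution and for every bounded weak
solution (`IsSolution.ae_abs_Lam_le`), and there `coth` may be replaced by a bounded Lipschitz
truncation.

For uniqueness and continuous dependence, the distributional equations of an arbitrary bounded
solution are first integrated along characteristics (`WeakTransport.mildTransport`,
`transports_of_wave`). Along almost every characteristic the null derivatives are then absolutely
continuous and rotate (`IsSolution.exists_isRotated`). The contraction estimate, run almost
everywhere (`FramePair.bound`), yields the Lipschitz estimate `exists_stability`; its case of equal
data is uniqueness.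

For regular data, the integrand that defines `a` obeys a differential equation along the transverse
characteristics, so the angles have continuous derivatives in both null directions
(`hasNullDerivs_of_integral`) and are `C¹`. Then the null derivatives are `C¹`, and `Λ̃`, `φ` are
`C²` (`FrameData.isClassical`). -/

namespace PCF

/-! ### Calculus of absolutely continuous functions on `[0, T]`, and rotations -/

/-- `F` is a primitive of the integrable function `g` on `[0, T]`. -/
structure IsPrim (T : ℝ) (F g : ℝ → ℝ) : Prop where
  int : IntervalIntegrable g volume 0 T
  eq : ∀ t ∈ Icc 0 T, F t = F 0 + ∫ s in (0 : ℝ)..t, g s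

namespace IsPrim

variable {T : ℝ} {F G g k h h' : ℝ → ℝ}

theorem intervalIntegrable (hF : IsPrim T F g) {t : ℝ} (ht : t ∈ Icc 0 T) :
    IntervalIntegrable g volume 0 t :=
  hF.int.mono_set (by rw [uIcc_of_le ht.1, uIcc_of_le (ht.1.trans ht.2)]; exact Icc_subset_Icc_right ht.2)

theorem ac (hF : IsPrim T F g) :
    AbsolutelyContinuousOnInterval (fun t => F 0 + ∫ s in (0 : ℝ)..t, g s) 0 T :=
  AbsolutelyContinuousOnInterval.fun_add
    (LipschitzOnWith.absolutelyContinuousOnInterval (K := 0) (LipschitzWith.const _).lipschitzOnWith)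
    (hF.int.absolutelyContinuousOnInterval_intervalIntegral left_mem_uIcc)

theorem ae_hasDerivAt (hF : IsPrim T F g) :
    ∀ᵐ t, t ∈ uIcc 0 T → HasDerivAt (fun t => F 0 + ∫ s in (0 : ℝ)..t, g s) (g t) t := by
  filter_upwards [hF.int.ae_hasDerivAt_integral] with t ht h
  exact (ht h 0 left_mem_uIcc).const_add _

theorem of_ac (hT : 0 ≤ T) (hac : AbsolutelyContinuousOnInterval F 0 T)
    (hd : ∀ᵐ t, t ∈ uIcc 0 T → HasDerivAt F (g t) t) : IsPrim T F g := by
  have hg : ∀ᵐ t, t ∈ uIcc 0 T → deriv F t = g t := by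
    filter_upwards [hd] with t ht h using (ht h).deriv
  have hint : IntervalIntegrable g volume 0 T := by
    refine hac.intervalIntegrable_deriv.congr_ae ?_
    rw [Filter.EventuallyEq, ae_restrict_iff' measurableSet_uIoc]
    filter_upwards [hg] with t ht h using ht (uIoc_subset_uIcc h)
  refine ⟨hint, fun t ht => ?_⟩
  have hsub : uIcc 0 t ⊆ uIcc 0 T := by
    rw [uIcc_of_le ht.1, uIcc_of_le hT]; exact Icc_subset_Icc_right ht.2
  have := (hac.mono hsub).integral_deriv_eq_sub
  rw [← intervalIntegral.integral_congr_ae (f := deriv F), this]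
  · ring
  · filter_upwards [hg] with s hs h using hs (hsub (uIoc_subset_uIcc h))

theorem congr_left (hF : IsPrim T F g) (h : ∀ t ∈ Icc 0 T, G t = F t) (hT : 0 ≤ T) :
    IsPrim T G g :=
  ⟨hF.int, fun t ht => by rw [h t ht, h 0 ⟨le_rfl, hT⟩, hF.eq t ht]⟩

theorem congr_right (hF : IsPrim T F g) (h : ∀ᵐ t, t ∈ Ioc 0 T → g t = k t) (hT : 0 ≤ T) :
    IsPrim T F k := by
  refine ⟨hF.int.congr_ae ?_, fun t ht => ?_⟩
  · rw [Filter.EventuallyEq, ae_restrict_iff' measurableSet_uIoc, uIoc_of_le hT]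
    exact h
  · rw [hF.eq t ht]
    congr 1
    refine intervalIntegral.integral_congr_ae ?_
    filter_upwards [h] with s hs h
    rw [uIoc_of_le ht.1] at h
    exact hs ⟨h.1, h.2.trans ht.2⟩

/-- The product rule for absolutely continuous functions. It is applied to the explicit primitives
`F 0 + ∫ g`, because `F` itself is unconstrained outside `[0, T]`. -/
theorem mul (hF : IsPrim T F g) (hG : IsPrim T G k) (hT : 0 ≤ T) :
    IsPrim T (fun t => F t * G t) (fun t => g t * G t + F t * k t) := by
  have h1 := IsPrim.of_ac (g := fun t => g t * (G 0 + ∫ s in (0 : ℝ)..t, k s)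
    + (F 0 + ∫ s in (0 : ℝ)..t, g s) * k t) hT (hF.ac.fun_mul hG.ac) (by
      filter_upwards [hF.ae_hasDerivAt, hG.ae_hasDerivAt] with t h1 h2 h
      exact (h1 h).mul (h2 h))
  refine (h1.congr_left (fun t ht => by rw [hF.eq t ht, hG.eq t ht]) hT).congr_right ?_ hT
  refine Eventually.of_forall fun t ht => ?_
  rw [hF.eq t ⟨ht.1.le, ht.2⟩, hG.eq t ⟨ht.1.le, ht.2⟩]

theorem continuousOn (hF : IsPrim T F g) (hT : 0 ≤ T) : ContinuousOn F (Icc 0 T) := by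
  have := hF.ac.continuousOn
  rw [uIcc_of_le hT] at this
  exact this.congr fun t ht => hF.eq t ht

/-- The range of `F` on `[0, T]` is a compact interval inside `I`, so `h` is Lipschitz there, and a
Lipschitz function of an absolutely continuous one is absolutely continuous. -/
theorem comp (hF : IsPrim T F g) (hT : 0 ≤ T) {I : Set ℝ} (hI : ∀ t ∈ Icc 0 T, F t ∈ I)
    (hd : ∀ z ∈ I, HasDerivAt h (h' z) z) (hc : ContinuousOn h' I) :
    IsPrim T (fun t => h (F t)) (fun t => h' (F t) * g t) := by
  set F' : ℝ → ℝ := fun t => F 0 + ∫ s in (0 : ℝ)..t, g s with hF'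
  have hFF : ∀ t ∈ Icc 0 T, F t = F' t := hF.eq
  have hcont : ContinuousOn F' (Icc 0 T) := (hF.continuousOn hT).congr fun t ht => (hFF t ht).symm
  have hK : IsCompact (F' '' Icc 0 T) := isCompact_Icc.image_of_continuousOn hcont
  have hconv : Convex ℝ (F' '' Icc 0 T) :=
    Real.convex_iff_isPreconnected.2 (isPreconnected_Icc.image _ hcont)
  have hsub : F' '' Icc 0 T ⊆ I := by
    rintro _ ⟨t, ht, rfl⟩
    rw [← hFF t ht]
    exact hI t ht
  obtain ⟨C, hC⟩ := hK.exists_bound_of_continuousOn (hc.mono hsub)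
  have hC0 : 0 ≤ C := (norm_nonneg _).trans (hC _ ⟨0, ⟨le_rfl, hT⟩, rfl⟩)
  have hlip : ∀ x ∈ F' '' Icc 0 T, ∀ y ∈ F' '' Icc 0 T, ‖h y - h x‖ ≤ C * ‖y - x‖ :=
    fun x hx y hy => hconv.norm_image_sub_le_of_norm_hasDerivWithin_le
      (fun z hz => (hd z (hsub hz)).hasDerivWithinAt) hC hx hy
  have hac : AbsolutelyContinuousOnInterval (fun t => h (F' t)) 0 T := by
    have h0 := hF.ac
    rw [absolutelyContinuousOnInterval_iff] at h0 ⊢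
    intro ε hε
    -- Dividing by `C + 1` rather than `C` covers `C = 0`.
    obtain ⟨δ, hδ, hE⟩ := h0 (ε / (C + 1)) (by positivity)
    refine ⟨δ, hδ, fun E hE1 hE2 => ?_⟩
    have h1 := hE E hE1 hE2
    calc _ ≤ ∑ i ∈ Finset.range E.1, C * dist (F' (E.2 i).1) (F' (E.2 i).2) := by
          refine Finset.sum_le_sum fun i hi => ?_
          have hm := hE1.left i hi
          rw [uIcc_of_le hT] at hm
          rw [dist_comm, dist_comm (F' _), dist_eq_norm, dist_eq_norm]
          exact hlip _ ⟨_, hm.1, rfl⟩ _ ⟨_, hm.2, rfl⟩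
      _ = C * ∑ i ∈ Finset.range E.1, dist (F' (E.2 i).1) (F' (E.2 i).2) := by
          rw [Finset.mul_sum]
      _ ≤ C * (ε / (C + 1)) := by gcongr
      _ < (C + 1) * (ε / (C + 1)) := by gcongr; linarith
      _ = ε := by field_simp
  have h1 := IsPrim.of_ac (g := fun t => h' (F' t) * g t) hT hac (by
      filter_upwards [hF.ae_hasDerivAt] with t h1 ht
      rw [uIcc_of_le hT] at ht
      refine HasDerivAt.comp (h₂ := h) t ?_ (h1 (by rwa [uIcc_of_le hT]))
      exact hd _ (hsub ⟨t, ht, rfl⟩))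
  refine (h1.congr_left (fun t ht => by rw [hFF t ht]) hT).congr_right ?_ hT
  exact Eventually.of_forall fun t ht => by rw [hFF t ⟨ht.1.le, ht.2⟩]

theorem const_mul (c : ℝ) (hF : IsPrim T F g) : IsPrim T (fun t => c * F t) (fun t => c * g t) :=
  ⟨hF.int.const_mul c, fun t ht => by
    rw [hF.eq t ht, intervalIntegral.integral_const_mul]; ring⟩

theorem add (hF : IsPrim T F g) (hG : IsPrim T G k) :
    IsPrim T (fun t => F t + G t) (fun t => g t + k t) :=
  ⟨hF.int.add hG.int, fun t ht => by
    rw [hF.eq t ht, hG.eq t ht, intervalIntegral.integral_add (hF.intervalIntegrable ht)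
      (hG.intervalIntegrable ht)]; ring⟩

theorem sub (hF : IsPrim T F g) (hG : IsPrim T G k) :
    IsPrim T (fun t => F t - G t) (fun t => g t - k t) :=
  ⟨hF.int.sub hG.int, fun t ht => by
    rw [hF.eq t ht, hG.eq t ht, intervalIntegral.integral_sub (hF.intervalIntegrable ht)
      (hG.intervalIntegrable ht)]; ring⟩

theorem const_add (c : ℝ) (hF : IsPrim T F g) : IsPrim T (fun t => c + F t) g :=
  ⟨hF.int, fun t ht => by rw [hF.eq t ht]; ring⟩

theorem of_hasDerivAt (hd : ∀ t, HasDerivAt F (g t) t) (hc : Continuous g) : IsPrim T F g :=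
  ⟨hc.intervalIntegrable _ _, fun t _ => by
    rw [intervalIntegral.integral_eq_sub_of_hasDerivAt (fun x _ => hd x) (hc.intervalIntegrable _ _)]
    ring⟩

theorem sin (hF : IsPrim T F g) (hT : 0 ≤ T) :
    IsPrim T (fun t => Real.sin (F t)) (fun t => Real.cos (F t) * g t) :=
  hF.comp hT (I := univ) (fun _ _ => trivial) (fun z _ => Real.hasDerivAt_sin z)
    Real.continuous_cos.continuousOn

theorem cos (hF : IsPrim T F g) (hT : 0 ≤ T) :
    IsPrim T (fun t => Real.cos (F t)) (fun t => -Real.sin (F t) * g t) :=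
  hF.comp hT (I := univ) (fun _ _ => trivial) (fun z _ => Real.hasDerivAt_cos z)
    Real.continuous_sin.neg.continuousOn

theorem sinh (hF : IsPrim T F g) (hT : 0 ≤ T) :
    IsPrim T (fun t => Real.sinh (F t)) (fun t => Real.cosh (F t) * g t) :=
  hF.comp hT (I := univ) (fun _ _ => trivial) (fun z _ => Real.hasDerivAt_sinh z)
    Real.continuous_cosh.continuousOn

theorem sinh_inv (hF : IsPrim T F g) (hT : 0 ≤ T) (hpos : ∀ t ∈ Icc 0 T, 0 < F t) :
    IsPrim T (fun t => (Real.sinh (F t))⁻¹)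
      (fun t => -Real.cosh (F t) / Real.sinh (F t) ^ 2 * g t) := by
  have hne : ∀ z ∈ Ioi (0 : ℝ), Real.sinh z ≠ 0 := fun z hz => (Real.sinh_pos_iff.2 hz).ne'
  exact hF.comp (h := fun z => (Real.sinh z)⁻¹) (h' := fun z => -Real.cosh z / Real.sinh z ^ 2)
    hT (I := Ioi 0) hpos (fun z hz => (Real.hasDerivAt_sinh z).inv (hne z hz))
    (Real.continuous_cosh.neg.continuousOn.div (Real.continuous_sinh.pow 2).continuousOn
      fun z hz => pow_ne_zero 2 (hne z hz))

end IsPrim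

/-- A vector that rotates with angular velocity `k` is the rotation of its initial value. -/
theorem rotation_eq {T : ℝ} (hT : 0 ≤ T) {x y θ k : ℝ → ℝ}
    (hx : IsPrim T x (fun t => k t * y t)) (hy : IsPrim T y (fun t => -(k t * x t)))
    (hθ : IsPrim T θ k) (h0 : θ 0 = 0) {t : ℝ} (ht : t ∈ Icc 0 T) :
    x t = x 0 * Real.cos (θ t) + y 0 * Real.sin (θ t) ∧
      y t = y 0 * Real.cos (θ t) - x 0 * Real.sin (θ t) := by
  -- Rotating the vector back by the angle `θ` removes the motion: the integrands of both primitives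
  -- vanish identically.
  have e1 := ((hx.mul (hθ.cos hT) hT).sub (hy.mul (hθ.sin hT) hT)).eq t ht
  have e2 := ((hx.mul (hθ.sin hT) hT).add (hy.mul (hθ.cos hT) hT)).eq t ht
  rw [intervalIntegral.integral_congr (g := fun _ => 0) (fun s _ => by ring)] at e1 e2
  simp only [h0, Real.cos_zero, Real.sin_zero, intervalIntegral.integral_zero] at e1 e2
  have h3 := Real.sin_sq_add_cos_sq (θ t)
  constructor
  · linear_combination Real.cos (θ t) * e1 + Real.sin (θ t) * e2 - x t * h3
  · linear_combination -Real.sin (θ t) * e1 + Real.cos (θ t) * e2 - y t * h3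

/-- The rotation of a fixed vector by the angle `θ` rotates with angular velocity `θ'`. -/
theorem isPrim_rotation {T : ℝ} (hT : 0 ≤ T) {θ k : ℝ → ℝ} (hθ : IsPrim T θ k) (x0 y0 : ℝ) :
    IsPrim T (fun t => x0 * Real.cos (θ t) + y0 * Real.sin (θ t))
        (fun t => k t * (y0 * Real.cos (θ t) - x0 * Real.sin (θ t))) ∧
      IsPrim T (fun t => y0 * Real.cos (θ t) - x0 * Real.sin (θ t))
        (fun t => -(k t * (x0 * Real.cos (θ t) + y0 * Real.sin (θ t)))) := by
  constructor
  · exact (((hθ.cos hT).const_mul x0).add ((hθ.sin hT).const_mul y0)).congr_right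
      (Eventually.of_forall fun t _ => by ring) hT
  · exact (((hθ.cos hT).const_mul y0).sub ((hθ.sin hT).const_mul x0)).congr_right
      (Eventually.of_forall fun t _ => by ring) hT

/-! ### Measurability and local integrability on the strip, Fubini along characteristics -/

/-- The Lebesgue measure on the strip `[0, T] × ℝ`. -/
noncomputable abbrev stripMeasure (T : ℝ) : Measure (ℝ × ℝ) :=
  (volume.restrict (Icc 0 T)).prod volume

theorem stripMeasure_eq (T : ℝ) : stripMeasure T = volume.restrict (Icc 0 T ×ˢ univ) := by
  rw [stripMeasure, Measure.volume_eq_prod, ← Measure.prod_restrict, Measure.restrict_univ]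

/-- Local integrability on the strip `[0, T] × ℝ`. -/
def LocIntStrip (T : ℝ) (f : ℝ → ℝ → ℝ) : Prop :=
  ∀ R : ℝ, IntegrableOn (fun z : ℝ × ℝ => f z.1 z.2) (Icc 0 T ×ˢ Icc (-R) R) volume

/-- Straightens the characteristics `x + σ t = u` to vertical lines, so that null sets and integrals
can be moved between points of the strip and characteristics. -/
theorem measurePreserving_shear (σ : ℝ) (μ : Measure ℝ) [SFinite μ] :
    MeasurePreserving (fun z : ℝ × ℝ => (z.1, z.2 - σ * z.1)) (μ.prod volume) (μ.prod volume) :=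
  (MeasurePreserving.id μ).skew_product (g := fun s u => u - σ * s) (by fun_prop)
    (Eventually.of_forall fun s => (measurePreserving_sub_right volume (σ * s)).map_eq)

/-- After a shear, this turns a statement at almost every point of the strip into one on almost
every characteristic at almost every time. -/
theorem ae_strip_swap {T : ℝ} {p : ℝ → ℝ → Prop} (h : ∀ᵐ z ∂stripMeasure T, p z.1 z.2) :
    ∀ᵐ u, ∀ᵐ s ∂volume.restrict (Icc 0 T), p s u := by
  have h1 : ∀ᵐ z ∂(volume.prod (volume.restrict (Icc 0 T)) : Measure (ℝ × ℝ)), p z.2 z.1 :=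
    Measure.measurePreserving_swap.quasiMeasurePreserving.ae h
  exact Measure.ae_ae_of_ae_prod h1

theorem ae_strip_of_ae {T : ℝ} {p : ℝ → ℝ → Prop} (h : ∀ᵐ u, ∀ s ∈ Icc 0 T, p s u) :
    ∀ᵐ z ∂stripMeasure T, p z.1 z.2 := by
  have h1 : ∀ᵐ z ∂stripMeasure T, ∀ s ∈ Icc 0 T, p s z.2 :=
    Measure.quasiMeasurePreserving_snd.ae h
  have h2 : ∀ᵐ z ∂stripMeasure T, z.1 ∈ Icc 0 T :=
    Measure.quasiMeasurePreserving_fst.ae (ae_restrict_mem measurableSet_Icc)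
  filter_upwards [h1, h2] with z h1 h2 using h1 _ h2

/-- Two jointly measurable functions that agree a.e. at each time agree a.e. in the strip. -/
theorem ae_strip_of_forall_ae {T : ℝ} {g h : ℝ → ℝ → ℝ}
    (hg : AEStronglyMeasurable (fun z : ℝ × ℝ => g z.1 z.2) (stripMeasure T))
    (hh : AEStronglyMeasurable (fun z : ℝ × ℝ => h z.1 z.2) (stripMeasure T))
    (he : ∀ t ∈ Icc 0 T, g t =ᵐ[volume] h t) :
    ∀ᵐ z ∂stripMeasure T, g z.1 z.2 = h z.1 z.2 := by
  -- A property that holds for each time almost everywhere in space holds almost everywhere in the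
  -- strip only if its set is measurable; hence the passage to measurable representatives.
  have h1 : ∀ᵐ s ∂volume.restrict (Icc 0 T), ∀ᵐ u, hg.mk _ (s, u) = hh.mk _ (s, u) := by
    filter_upwards [Measure.ae_ae_of_ae_prod hg.ae_eq_mk, Measure.ae_ae_of_ae_prod hh.ae_eq_mk,
      ae_restrict_mem measurableSet_Icc] with s h1 h2 hs
    filter_upwards [h1, h2, he s hs] with u h1 h2 h3
    rw [← h1, ← h2, h3]
  have h2 : ∀ᵐ z ∂stripMeasure T, hg.mk _ z = hh.mk _ z :=
    (Measure.ae_prod_iff_ae_ae (measurableSet_eq_fun hg.stronglyMeasurable_mk.measurable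
      hh.stronglyMeasurable_mk.measurable)).2 h1
  filter_upwards [hg.ae_eq_mk, hh.ae_eq_mk, h2] with z h1 h2 h3
  rw [h1, h2, h3]

namespace LocIntStrip

variable {T : ℝ} {f g : ℝ → ℝ → ℝ}

theorem restrict (hf : LocIntStrip T f) {t : ℝ} (ht : t ≤ T) : LocIntStrip t f :=
  fun R => (hf R).mono_set (prod_mono (Icc_subset_Icc_right ht) subset_rfl)

theorem integrable_prod (hf : LocIntStrip T f) (R : ℝ) :
    Integrable (fun z : ℝ × ℝ => f z.1 z.2)
      ((volume.restrict (Icc 0 T)).prod (volume.restrict (Icc (-R) R))) := by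
  rw [Measure.prod_restrict, ← Measure.volume_eq_prod]
  exact hf R

theorem aestronglyMeasurable (hf : LocIntStrip T f) :
    AEStronglyMeasurable (fun z : ℝ × ℝ => f z.1 z.2) (stripMeasure T) := by
  have hU : (⋃ n : ℕ, Icc (0 : ℝ) T ×ˢ Icc (-(n : ℝ)) n) = Icc 0 T ×ˢ univ := by
    rw [← prod_iUnion]
    congr 1
    refine eq_univ_of_forall fun x => mem_iUnion.2 ?_
    obtain ⟨n, hn⟩ := exists_nat_ge |x|
    exact ⟨n, abs_le.1 hn⟩
  rw [stripMeasure_eq, ← hU]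
  exact AEStronglyMeasurable.iUnion fun n => (hf n).aestronglyMeasurable

theorem add (hf : LocIntStrip T f) (hg : LocIntStrip T g) :
    LocIntStrip T (fun t x => f t x + g t x) := fun R => (hf R).add (hg R)

theorem sub (hf : LocIntStrip T f) (hg : LocIntStrip T g) :
    LocIntStrip T (fun t x => f t x - g t x) := fun R => (hf R).sub (hg R)

theorem const_mul (c : ℝ) (hf : LocIntStrip T f) :
    LocIntStrip T (fun t x => c * f t x) := fun R => (hf R).const_mul c

theorem neg (hf : LocIntStrip T f) :
    LocIntStrip T (fun t x => - f t x) := fun R => (hf R).neg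

theorem shear (hf : LocIntStrip T f) (σ : ℝ) : LocIntStrip T (fun s u => f s (u - σ * s)) := by
  intro R
  have hmp := (measurePreserving_shear σ volume).restrict_preimage
    (measurableSet_Icc.prod measurableSet_Icc :
      MeasurableSet (Icc (0 : ℝ) T ×ˢ Icc (-(R + |σ| * T)) (R + |σ| * T)))
  have h1 := hf (R + |σ| * T)
  rw [IntegrableOn, Measure.volume_eq_prod] at h1
  have h2 := hmp.integrable_comp_of_integrable h1
  rw [IntegrableOn, Measure.volume_eq_prod]
  refine IntegrableOn.mono_set h2 ?_
  rintro ⟨s, u⟩ ⟨hs, hu⟩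
  refine ⟨hs, ?_⟩
  simp only [mem_Icc] at hs hu ⊢
  have h3 : |σ * s| ≤ |σ| * T := by
    rw [abs_mul, abs_of_nonneg hs.1]; exact mul_le_mul_of_nonneg_left hs.2 (abs_nonneg _)
  have := abs_le.1 h3
  constructor <;> linarith

theorem ae_forall_of_slab {p : ℝ → Prop} (h : ∀ n : ℕ, ∀ᵐ u ∂volume.restrict (Icc (-(n : ℝ)) n), p u) :
    ∀ᵐ u, p u := by
  have h1 : ∀ᵐ u, ∀ n : ℕ, u ∈ Icc (-(n : ℝ)) n → p u :=
    ae_all_iff.2 fun n => (ae_restrict_iff' measurableSet_Icc).1 (h n)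
  filter_upwards [h1] with u hu
  obtain ⟨n, hn⟩ := exists_nat_ge |u|
  exact hu n (abs_le.1 hn)

theorem ae_intervalIntegrable (hf : LocIntStrip T f) (hT : 0 ≤ T) :
    ∀ᵐ u, IntervalIntegrable (fun s => f s u) volume 0 T := by
  refine ae_forall_of_slab fun n => ?_
  filter_upwards [(hf.integrable_prod n).prod_left_ae] with u hu
  rw [intervalIntegrable_iff_integrableOn_Icc_of_le hT]
  exact hu

theorem integrable_mul_test (hf : LocIntStrip T f) {η : ℝ → ℝ} (hη : Continuous η)
    (hc : HasCompactSupport η) (σ : ℝ) :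
    Integrable (fun z : ℝ × ℝ => f z.1 z.2 * η (z.2 - σ * z.1)) (stripMeasure T) := by
  obtain ⟨B, hB⟩ := hc.exists_bound_of_continuous hη
  -- The translates of the test function by `σ s`, `s ∈ [0, T]`, are all supported in the ball of
  -- radius `R + |σ| T`.
  obtain ⟨R, hR⟩ := hc.isCompact.isBounded.subset_closedBall 0
  set R' := R + |σ| * T
  rw [stripMeasure_eq]
  have h1 : IntegrableOn (fun z : ℝ × ℝ => f z.1 z.2 * η (z.2 - σ * z.1))
      (Icc 0 T ×ˢ Icc (-R') R') volume :=
    (hf R').mul_bdd (c := B) (by fun_prop) (Eventually.of_forall fun z => hB _)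
  refine h1.of_forall_sdiff_eq_zero (measurableSet_Icc.prod MeasurableSet.univ) ?_
  rintro ⟨s, u⟩ ⟨⟨hs, -⟩, hn⟩
  have : u - σ * s ∉ tsupport η := by
    intro hmem
    have h2 := hR hmem
    rw [mem_closedBall_zero_iff, Real.norm_eq_abs, abs_le] at h2
    apply hn
    simp only [mem_Icc] at hs
    have h3 : |σ * s| ≤ |σ| * T := by
      rw [abs_mul, abs_of_nonneg hs.1]; exact mul_le_mul_of_nonneg_left hs.2 (abs_nonneg _)
    have := abs_le.1 h3
    refine ⟨hs, ?_⟩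
    simp only [mem_Icc, R']
    constructor <;> linarith
  simp [image_eq_zero_of_notMem_tsupport this]

theorem intervalIntegrable_pairing (hf : LocIntStrip T f) {η : ℝ → ℝ} (hη : Continuous η)
    (hc : HasCompactSupport η) (hT : 0 ≤ T) :
    IntervalIntegrable (fun s => ∫ x, f s x * η x) volume 0 T := by
  rw [intervalIntegrable_iff_integrableOn_Icc_of_le hT]
  simpa [IntegrableOn] using (hf.integrable_mul_test hη hc 0).integral_prod_left

/-- Joint measurability of a time primitive. -/
theorem _root_.PCF.aestronglyMeasurable_primitive
    (hf : AEStronglyMeasurable (fun z : ℝ × ℝ => f z.1 z.2) (stripMeasure T)) :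
    AEStronglyMeasurable (fun z : ℝ × ℝ => ∫ s in (0 : ℝ)..z.1, f s z.2) (stripMeasure T) := by
  set f' := hf.mk _ with hf'
  have hm : StronglyMeasurable f' := hf.stronglyMeasurable_mk
  -- The variable endpoint is moved into an indicator function, which leaves a parametric integral
  -- over a fixed domain.
  have h1 : StronglyMeasurable (fun z : ℝ × ℝ => ∫ s, (Ioc 0 z.1).indicator (fun s => f' (s, z.2)) s) := by
    have : StronglyMeasurable (fun y : (ℝ × ℝ) × ℝ =>
        {y : (ℝ × ℝ) × ℝ | y.2 ∈ Ioc 0 y.1.1}.indicator (fun y => f' (y.2, y.1.2)) y) := by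
      refine (hm.comp_measurable (by fun_prop)).indicator ?_
      exact (measurableSet_lt measurable_const measurable_snd).inter
        (measurableSet_le measurable_snd (measurable_fst.comp measurable_fst))
    exact this.integral_prod_right'
  refine ⟨_, h1, ?_⟩
  have h2 := ae_strip_swap (p := fun s u => f s u = f' (s, u)) hf.ae_eq_mk
  refine ae_strip_of_ae (p := fun t u => ∫ s in (0 : ℝ)..t, f s u =
    ∫ s, (Ioc 0 t).indicator (fun s => f' (s, u)) s) ?_
  filter_upwards [h2] with u hu t ht
  rw [integral_indicator measurableSet_Ioc, intervalIntegral.integral_of_le ht.1]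
  refine setIntegral_congr_ae measurableSet_Ioc ?_
  rw [ae_restrict_iff' measurableSet_Icc] at hu
  filter_upwards [hu] with s hs h using hs ⟨h.1.le, h.2.trans ht.2⟩

/-- A time primitive with locally integrable initial value. -/
theorem primitive (hf : LocIntStrip T f) {w : ℝ → ℝ} (hw : LocallyIntegrable w volume)
    (hT : 0 ≤ T) : LocIntStrip T (fun t u => w u + ∫ s in (0 : ℝ)..t, f s u) := by
  intro R
  have hw' : IntegrableOn w (Icc (-R) R) := hw.integrableOn_isCompact isCompact_Icc
  have hG := (hf.integrable_prod R).norm.integral_prod_right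
  have h1 : Integrable (fun z : ℝ × ℝ => ‖w z.2‖ + ∫ s in Icc 0 T, ‖f s z.2‖)
      ((volume.restrict (Icc 0 T)).prod (volume.restrict (Icc (-R) R))) :=
    (hw'.norm.add hG).comp_snd _
  have habs : ((volume.restrict (Icc 0 T)).prod (volume.restrict (Icc (-R) R))) ≪
      stripMeasure T :=
    Measure.AbsolutelyContinuous.prod Measure.AbsolutelyContinuous.rfl
      Measure.restrict_le_self.absolutelyContinuous
  rw [IntegrableOn, Measure.volume_eq_prod, ← Measure.prod_restrict]
  refine h1.mono' ?_ ?_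
  · refine AEStronglyMeasurable.add ?_ ?_
    · exact hw'.aestronglyMeasurable.comp_snd
    · exact (aestronglyMeasurable_primitive hf.aestronglyMeasurable).mono_ac habs
  · refine habs.ae_le ?_
    refine ae_strip_of_ae (p := fun t u => ‖w u + ∫ s in (0 : ℝ)..t, f s u‖ ≤
      ‖w u‖ + ∫ s in Icc 0 T, ‖f s u‖) ?_
    filter_upwards [hf.ae_intervalIntegrable hT] with u hu t ht
    refine (norm_add_le _ _).trans (add_le_add_right ?_ _)
    rw [intervalIntegral.integral_of_le ht.1]
    refine (norm_integral_le_integral_norm _).trans ?_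
    rw [intervalIntegrable_iff_integrableOn_Icc_of_le hT] at hu
    exact setIntegral_mono_set hu.norm (Eventually.of_forall fun s => norm_nonneg _)
      (Eventually.of_forall fun s hs => ⟨hs.1.le, hs.2.trans ht.2⟩)

end LocIntStrip

/-! ### Transport equations: distributional and characteristic forms agree -/

/-- The distributional form of `∂ₜ w = σ ∂ₓ w + f` on `[0, T]`. -/
def WeakTransport (T σ : ℝ) (w f : ℝ → ℝ → ℝ) : Prop :=
  ∀ η : ℝ → ℝ, ContDiff ℝ ∞ η → HasCompactSupport η → ∀ t ∈ Icc (0 : ℝ) T,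
    ∫ x, w t x * η x = (∫ x, w 0 x * η x) +
      ∫ s in (0 : ℝ)..t, ((∫ x, f s x * η x) - σ * ∫ x, w s x * deriv η x)

/-- The form of `∂ₜ w = σ ∂ₓ w + f` integrated along the characteristics `x + σ t = u`. -/
def MildTransport (T σ : ℝ) (w f : ℝ → ℝ → ℝ) : Prop :=
  ∀ t ∈ Icc (0 : ℝ) T, ∀ᵐ u, w t (u - σ * t) = w 0 u + ∫ s in (0 : ℝ)..t, f s (u - σ * s)

/-- On each characteristic the product rule is applied to the primitive `W` and `η (u - σ s)`.
Integrating over `u`, exchanging the integrals and translating back gives the weak form. -/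
theorem MildTransport.weakTransport {T σ : ℝ} {w f : ℝ → ℝ → ℝ}
    (hf : LocIntStrip T f) (hw : LocallyIntegrable (w 0) volume) (h : MildTransport T σ w f) :
    WeakTransport T σ w f := by
  intro η hη hc t ht
  have hη' : Continuous (deriv η) := hη.continuous_deriv (by simp)
  have hg := (hf.shear σ).restrict ht.2
  set W : ℝ → ℝ → ℝ := fun t u => w 0 u + ∫ s in (0 : ℝ)..t, f s (u - σ * s) with hW
  have hWi : LocIntStrip t W := hg.primitive hw ht.1
  have i1 := hg.integrable_mul_test hη.continuous hc σ
  have i2 := hWi.integrable_mul_test hη' hc.deriv σ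
  have i3 : Integrable (fun z : ℝ × ℝ => f z.1 (z.2 - σ * z.1) * η (z.2 - σ * z.1) -
    σ * (W z.1 z.2 * deriv η (z.2 - σ * z.1))) (stripMeasure t) := i1.sub (i2.const_mul σ)
  have i4 : Integrable (fun u => w 0 u * η u) := by
    simpa [mul_comm] using hw.integrable_smul_left_of_hasCompactSupport hη.continuous hc
  have e1 : ∫ x, w t x * η x = ∫ u, w t (u - σ * t) * η (u - σ * t) :=
    (integral_sub_right_eq_self (fun x => w t x * η x) (σ * t)).symm
  have e2 : ∀ᵐ u, w t (u - σ * t) * η (u - σ * t) = w 0 u * η u +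
      ∫ s in Icc 0 t, (f s (u - σ * s) * η (u - σ * s) - σ * (W s u * deriv η (u - σ * s))) := by
    filter_upwards [h t ht, hg.ae_intervalIntegrable ht.1] with u h1 h2
    have p1 : IsPrim t (fun s => W s u) (fun s => f s (u - σ * s)) := ⟨h2, fun s _ => by simp [hW]⟩
    have p2 : IsPrim t (fun s => η (u - σ * s)) (fun s => -σ * deriv η (u - σ * s)) := by
      refine IsPrim.of_hasDerivAt (fun s => ?_) (by fun_prop)
      have hd : HasDerivAt (fun s : ℝ => u - σ * s) (-σ) s := by
        simpa using ((hasDerivAt_id s).const_mul σ).const_sub u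
      rw [mul_comm]
      exact (hη.differentiable (by simp) _).hasDerivAt.comp s hd
    have := (p1.mul p2 ht.1).eq t ⟨ht.1, le_rfl⟩
    rw [h1, integral_Icc_eq_integral_Ioc, ← intervalIntegral.integral_of_le ht.1]
    simp only [hW, intervalIntegral.integral_same, add_zero, mul_zero, sub_zero] at this ⊢
    rw [this]
    congr 1
    exact intervalIntegral.integral_congr fun s _ => by ring
  rw [e1, integral_congr_ae e2, integral_add i4 i3.integral_prod_right]
  congr 1
  rw [← integral_integral_swap i3, integral_Icc_eq_integral_Ioc,
    ← intervalIntegral.integral_of_le ht.1]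
  refine intervalIntegral.integral_congr_ae ?_
  have a1 : ∀ᵐ s, s ∈ Icc 0 t → Integrable (fun u => f s (u - σ * s) * η (u - σ * s)) :=
    (ae_restrict_iff' measurableSet_Icc).1 i1.prod_right_ae
  have a2 : ∀ᵐ s, s ∈ Icc 0 t → Integrable (fun u => W s u * deriv η (u - σ * s)) :=
    (ae_restrict_iff' measurableSet_Icc).1 i2.prod_right_ae
  filter_upwards [a1, a2] with s a1 a2 hs
  rw [uIoc_of_le ht.1] at hs
  have hs' : s ∈ Icc 0 t := ⟨hs.1.le, hs.2⟩
  rw [integral_sub (a1 hs') ((a2 hs').const_mul σ), integral_const_mul]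
  congr 1
  · exact integral_sub_right_eq_self (fun x => f s x * η x) (σ * s)
  · congr 1
    rw [← integral_sub_right_eq_self (fun x => w s x * deriv η x) (σ * s)]
    refine integral_congr_ae ?_
    filter_upwards [h s ⟨hs'.1, hs'.2.trans ht.2⟩] with u hu
    rw [hu]

/-- Each `w t`, `t ∈ [0, T]`, is locally integrable, locally uniformly in `t`. -/
structure LocBddStrip (T : ℝ) (w : ℝ → ℝ → ℝ) : Prop where
  loc : ∀ t ∈ Icc 0 T, LocallyIntegrable (w t) volume
  bdd : ∀ R : ℝ, ∃ M : ℝ, ∀ t ∈ Icc 0 T, ∫ x in Icc (-R) R, |w t x| ≤ M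

theorem LocBddStrip.sub {T : ℝ} {v w : ℝ → ℝ → ℝ} (hv : LocBddStrip T v) (hw : LocBddStrip T w) :
    LocBddStrip T (fun t x => v t x - w t x) := by
  refine ⟨fun t ht => (hv.loc t ht).sub (hw.loc t ht), fun R => ?_⟩
  obtain ⟨M, hM⟩ := hv.bdd R
  obtain ⟨N, hN⟩ := hw.bdd R
  refine ⟨M + N, fun t ht => ?_⟩
  have h1 := ((hv.loc t ht).integrableOn_isCompact (isCompact_Icc (a := -R) (b := R))).abs
  have h2 := ((hw.loc t ht).integrableOn_isCompact (isCompact_Icc (a := -R) (b := R))).abs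
  calc _ ≤ ∫ x in Icc (-R) R, (|v t x| + |w t x|) :=
        integral_mono_of_nonneg (Eventually.of_forall fun x => abs_nonneg _) (h1.add h2)
          (Eventually.of_forall fun x => abs_sub _ _)
    _ ≤ M + N := by rw [integral_add h1 h2]; exact add_le_add (hM t ht) (hN t ht)

theorem abs_pairing_le {w ξ : ℝ → ℝ} {R M B : ℝ} (hw : LocallyIntegrable w volume)
    (hM : ∫ x in Icc (-R) R, |w x| ≤ M) (hB : ∀ x, |ξ x| ≤ B)
    (hR : ∀ x, x ∉ Icc (-R) R → ξ x = 0) : |∫ x, w x * ξ x| ≤ M * B := by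
  have hB0 : 0 ≤ B := (abs_nonneg _).trans (hB 0)
  have h1 := ((hw.integrableOn_isCompact (isCompact_Icc (a := -R) (b := R))).abs).mul_const B
  rw [← setIntegral_eq_integral_of_forall_compl_eq_zero (s := Icc (-R) R)
    (f := fun x => w x * ξ x) (fun x hx => by rw [hR x hx, mul_zero])]
  calc _ ≤ ∫ x in Icc (-R) R, |w x| * B := by
        rw [← Real.norm_eq_abs]
        refine norm_integral_le_of_norm_le h1 (Eventually.of_forall fun x => ?_)
        rw [Real.norm_eq_abs, abs_mul]
        exact mul_le_mul_of_nonneg_left (hB x) (abs_nonneg _)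
    _ ≤ M * B := by rw [integral_mul_const]; exact mul_le_mul_of_nonneg_right hM hB0

theorem integrable_locallyIntegrable_mul_test {w η : ℝ → ℝ} (hw : LocallyIntegrable w volume)
    (hη : Continuous η) (hc : HasCompactSupport η) : Integrable (fun x => w x * η x) := by
  simpa [mul_comm] using hw.integrable_smul_left_of_hasCompactSupport hη hc

/-- Taylor's formula to first order about `y`. The quadratic remainder is what makes a telescoping
sum over `n` time steps of size `O(n⁻²)` vanish in the limit; the constant `B` need not be sharp. -/
theorem abs_taylor_le {η : ℝ → ℝ} (hη : ContDiff ℝ ∞ η) {B : ℝ}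
    (hB : ∀ x, |deriv (deriv η) x| ≤ B) (x y : ℝ) :
    |η y - η x - (y - x) * deriv η y| ≤ B * (y - x) ^ 2 := by
  have hη1 : ContDiff ℝ ∞ (deriv η) := hη.iterate_deriv 1
  have hd1 : Differentiable ℝ η := hη.differentiable (by simp)
  have hd2 : Differentiable ℝ (deriv η) := hη1.differentiable (by simp)
  have hB0 : 0 ≤ B := (abs_nonneg _).trans (hB 0)
  have h1 : ∀ z ∈ uIcc x y, ‖deriv η z - deriv η y‖ ≤ B * |y - x| := by
    intro z hz
    have := convex_univ.norm_image_sub_le_of_norm_deriv_le (f := deriv η) (C := B)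
      (fun z _ => hd2 z) (fun z _ => hB z) (mem_univ y) (mem_univ z)
    refine this.trans (mul_le_mul_of_nonneg_left ?_ hB0)
    rw [Real.norm_eq_abs, abs_sub_comm]
    exact abs_sub_right_of_mem_uIcc hz
  have h2 := (convex_uIcc x y).norm_image_sub_le_of_norm_hasDerivWithin_le
    (f := fun z => η z - z * deriv η y) (f' := fun z => deriv η z - deriv η y)
    (fun z _ => ((hd1 z).hasDerivAt.sub (by simpa using (hasDerivAt_id z).mul_const (deriv η y))).hasDerivWithinAt)
    h1 left_mem_uIcc right_mem_uIcc
  simp only [Real.norm_eq_abs] at h2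
  calc _ = |η y - y * deriv η y - (η x - x * deriv η y)| := by congr 1; ring
    _ ≤ _ := h2
    _ = B * (y - x) ^ 2 := by rw [mul_assoc, ← sq, sq_abs]

/-- Uniqueness for the homogeneous weak transport equation. -/
theorem ae_eq_zero_of_weakTransport_zero {T σ : ℝ} {d : ℝ → ℝ → ℝ} (hd : LocIntStrip T d)
    (hb : LocBddStrip T d)
    (h : ∀ η : ℝ → ℝ, ContDiff ℝ ∞ η → HasCompactSupport η → ∀ t ∈ Icc (0 : ℝ) T,
      ∫ x, d t x * η x = -σ * ∫ s in (0 : ℝ)..t, ∫ x, d s x * deriv η x) :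
    ∀ t ∈ Icc (0 : ℝ) T, d t =ᵐ[volume] 0 := by
  intro t₁ ht₁
  have hT : 0 ≤ T := ht₁.1.trans ht₁.2
  refine ae_eq_zero_of_integral_contDiff_smul_eq_zero (hb.loc t₁ ht₁) fun η hη hc => ?_
  simp only [smul_eq_mul, mul_comm (η _)]
  have hη1 : ContDiff ℝ ∞ (deriv η) := hη.iterate_deriv 1
  have hη2 : ContDiff ℝ ∞ (deriv (deriv η)) := hη1.iterate_deriv 1
  obtain ⟨B, hB⟩ := hc.deriv.deriv.exists_bound_of_continuous hη2.continuous
  have hB0 : 0 ≤ B := (norm_nonneg _).trans (hB 0)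
  obtain ⟨R₀, hR₀⟩ := hc.isCompact.isBounded.subset_closedBall 0
  set R := R₀ + |σ| * T
  obtain ⟨M, hM⟩ := hb.bdd R
  have hM0 : 0 ≤ M := le_trans (integral_nonneg fun x => abs_nonneg _) (hM 0 ⟨le_rfl, hT⟩)
  -- The test function that is constant along characteristics and equals `η` at time `t₁`. The
  -- pairing of `d s` with `ζ s` should be constant in `s`, but the hypothesis only allows
  -- time-independent test functions.
  set ζ : ℝ → ℝ → ℝ := fun s x => η (x + σ * (s - t₁)) with hζ
  have hsupp : ∀ s ∈ Icc 0 T, ∀ x, x ∉ Icc (-R) R → x + σ * (s - t₁) ∉ tsupport η := by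
    intro s hs x hx hmem
    have h2 := hR₀ hmem
    rw [mem_closedBall_zero_iff, Real.norm_eq_abs, abs_le] at h2
    have h3 : |σ * (s - t₁)| ≤ |σ| * T := by
      rw [abs_mul]
      refine mul_le_mul_of_nonneg_left ?_ (abs_nonneg _)
      rw [abs_le]; constructor <;> linarith [hs.1, hs.2, ht₁.1, ht₁.2]
    have := abs_le.1 h3
    apply hx
    simp only [mem_Icc, R]
    constructor <;> linarith
  have z0 : ∀ s ∈ Icc 0 T, ∀ x, x ∉ Icc (-R) R → ζ s x = 0 := fun s hs x hx =>
    image_eq_zero_of_notMem_tsupport (f := η) (hsupp s hs x hx)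
  have z1 : ∀ s ∈ Icc 0 T, ∀ x, x ∉ Icc (-R) R → deriv η (x + σ * (s - t₁)) = 0 :=
    fun s hs x hx => image_eq_zero_of_notMem_tsupport
      fun hm => hsupp s hs x hx (tsupport_deriv_subset hm)
  have z2 : ∀ s ∈ Icc 0 T, ∀ x, x ∉ Icc (-R) R → deriv (deriv η) (x + σ * (s - t₁)) = 0 :=
    fun s hs x hx => image_eq_zero_of_notMem_tsupport
      fun hm => hsupp s hs x hx (tsupport_deriv_subset (tsupport_deriv_subset hm))
  have ctr : ∀ {θ : ℝ → ℝ} (c : ℝ), HasCompactSupport θ → HasCompactSupport fun x => θ (x + c) :=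
    fun c hθ => hθ.comp_homeomorph (Homeomorph.addRight c)
  have dtr : ∀ (θ : ℝ → ℝ) (c : ℝ), deriv (fun x => θ (x + c)) = fun x => deriv θ (x + c) :=
    fun θ c => funext fun x => deriv_comp_add_const θ c x
  have str : ∀ {θ : ℝ → ℝ} (c : ℝ), ContDiff ℝ ∞ θ → ContDiff ℝ ∞ fun x => θ (x + c) :=
    fun c hθ => hθ.comp (contDiff_id.add contDiff_const)
  -- Over a short time interval the test function is frozen at its final position. The first-order
  -- changes of `d` and of `ζ` cancel and an error quadratic in the length of the interval is left.
  have key : ∀ s ∈ Icc 0 T, ∀ s' ∈ Icc 0 T, s ≤ s' →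
      |(∫ x, d s' x * ζ s' x) - ∫ x, d s x * ζ s x| ≤ 2 * (σ ^ 2 * M * B) * (s' - s) ^ 2 := by
    intro s hs s' hs' hss
    set c := σ * (s' - t₁) with hcdef
    have hint : ∀ {θ : ℝ → ℝ}, ContDiff ℝ ∞ θ → HasCompactSupport θ →
        ∀ r ∈ Icc 0 T, ∀ r' ∈ Icc 0 T, r ≤ r' → (∫ x, d r' x * θ (x + c)) - ∫ x, d r x * θ (x + c)
          = -σ * ∫ ρ in r..r', ∫ x, d ρ x * deriv θ (x + c) := by
      intro θ hθ hθc r hr r' hr' hrr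
      have hθ' : ContDiff ℝ ∞ (deriv θ) := hθ.iterate_deriv 1
      have hi := hd.intervalIntegrable_pairing (str c hθ').continuous (ctr c hθc.deriv) hT
      have hi1 : ∀ r ∈ Icc 0 T, IntervalIntegrable (fun s => ∫ x, d s x * deriv θ (x + c)) volume 0 r :=
        fun r hr => hi.mono_set (by
          rw [uIcc_of_le hT, uIcc_of_le hr.1]; exact Icc_subset_Icc_right hr.2)
      rw [h _ (str c hθ) (ctr c hθc) r' hr', h _ (str c hθ) (ctr c hθc) r hr, dtr θ c, ← mul_sub,
        intervalIntegral.integral_interval_sub_left (hi1 r' hr') (hi1 r hr)]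
    have hA : ∀ r ∈ Icc s s', |(∫ x, d r x * deriv η (x + c)) - ∫ x, d s x * deriv η (x + c)| ≤
        |σ| * (M * B * (s' - s)) := by
      intro r hr
      have hr' : r ∈ Icc 0 T := ⟨hs.1.trans hr.1, hr.2.trans hs'.2⟩
      rw [hint hη1 hc.deriv s hs r hr' hr.1, abs_mul, abs_neg]
      refine mul_le_mul_of_nonneg_left ?_ (abs_nonneg _)
      rw [← Real.norm_eq_abs]
      refine (intervalIntegral.norm_integral_le_of_norm_le_const (C := M * B) fun ρ hρ => ?_).trans ?_
      · rw [uIoc_of_le hr.1] at hρ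
        have hρ' : ρ ∈ Icc 0 T := ⟨hs.1.trans hρ.1.le, hρ.2.trans hr'.2⟩
        exact abs_pairing_le (hb.loc ρ hρ') (hM ρ hρ') (fun x => hB _) (z2 s' hs')
      · rw [abs_of_nonneg (by linarith [hr.1])]
        exact mul_le_mul_of_nonneg_left (by linarith [hr.2]) (by positivity)
    have hi : IntervalIntegrable (fun r => ∫ x, d r x * deriv η (x + c)) volume s s' :=
      (hd.intervalIntegrable_pairing (str c hη1).continuous (ctr c hc.deriv) hT).mono_set (by
        rw [uIcc_of_le hT, uIcc_of_le hss]; exact Icc_subset_Icc hs.1 hs'.2)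
    have e1 : (∫ x, d s' x * ζ s' x) - ∫ x, d s x * ζ s' x =
        -σ * ((s' - s) * ∫ x, d s x * deriv η (x + c)) - σ * ∫ r in s..s',
          ((∫ x, d r x * deriv η (x + c)) - ∫ x, d s x * deriv η (x + c)) := by
      rw [hint hη hc s hs s' hs' hss, intervalIntegral.integral_sub hi (by simp)]
      simp; ring
    have j0 := integrable_locallyIntegrable_mul_test (hb.loc s hs) (str c hη).continuous (ctr c hc)
    have j1 := integrable_locallyIntegrable_mul_test (hb.loc s hs) (str (σ * (s - t₁)) hη).continuous (ctr _ hc)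
    have j2 := integrable_locallyIntegrable_mul_test (hb.loc s hs) (str c hη1).continuous (ctr c hc.deriv)
    have e2 : (∫ x, d s x * ζ s' x) - (∫ x, d s x * ζ s x) -
        σ * (s' - s) * ∫ x, d s x * deriv η (x + c) =
        ∫ x, d s x * (ζ s' x - ζ s x - σ * (s' - s) * deriv η (x + c)) := by
      have e3 : (fun x => d s x * (ζ s' x - ζ s x - σ * (s' - s) * deriv η (x + c))) =
          fun x => (d s x * η (x + c) - d s x * η (x + σ * (s - t₁))) -
            σ * (s' - s) * (d s x * deriv η (x + c)) := by
        funext x; simp only [hζ, hcdef]; ring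
      rw [e3, integral_sub (by exact j0.sub j1) (j2.const_mul _), integral_sub j0 j1,
        integral_const_mul]
    have b1 : |∫ r in s..s', ((∫ x, d r x * deriv η (x + c)) - ∫ x, d s x * deriv η (x + c))| ≤
        |σ| * (M * B * (s' - s)) * (s' - s) := by
      rw [← Real.norm_eq_abs]
      refine (intervalIntegral.norm_integral_le_of_norm_le_const fun ρ hρ => ?_).trans_eq
        (by rw [abs_of_nonneg (sub_nonneg.2 hss)])
      rw [uIoc_of_le hss] at hρ
      exact hA ρ ⟨hρ.1.le, hρ.2⟩
    have b2 : |∫ x, d s x * (ζ s' x - ζ s x - σ * (s' - s) * deriv η (x + c))| ≤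
        M * (B * (σ * (s' - s)) ^ 2) := by
      refine abs_pairing_le (hb.loc s hs) (hM s hs) (fun x => ?_) fun x hx => ?_
      · have := abs_taylor_le hη hB (x + σ * (s - t₁)) (x + c)
        have e : x + c - (x + σ * (s - t₁)) = σ * (s' - s) := by simp only [hcdef]; ring
        rw [e] at this
        exact this
      · rw [z0 s' hs' x hx, z0 s hs x hx, z1 s' hs' x hx]; simp
    calc _ = |-σ * (∫ r in s..s', ((∫ x, d r x * deriv η (x + c)) - ∫ x, d s x * deriv η (x + c))) +
          ∫ x, d s x * (ζ s' x - ζ s x - σ * (s' - s) * deriv η (x + c))| := by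
          rw [← e2]; congr 1; linear_combination e1
      _ ≤ |σ| * (|σ| * (M * B * (s' - s)) * (s' - s)) + M * (B * (σ * (s' - s)) ^ 2) := by
          refine (abs_add_le _ _).trans (add_le_add ?_ b2)
          rw [abs_mul, abs_neg]
          exact mul_le_mul_of_nonneg_left b1 (abs_nonneg _)
      _ = 2 * (σ ^ 2 * M * B) * (s' - s) ^ 2 := by
          rw [← sq_abs σ]; rw [mul_pow, ← sq_abs σ]; ring
  set G : ℝ → ℝ := fun s => ∫ x, d s x * ζ s x with hG
  have hG0 : G 0 = 0 := by
    have := h (ζ 0) (str _ hη) (ctr _ hc) 0 ⟨le_rfl, hT⟩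
    simpa using this
  have hG1 : G t₁ = ∫ x, d t₁ x * η x := by simp [hG, hζ]
  set C := 2 * (σ ^ 2 * M * B) with hC
  have hC0 : 0 ≤ C := by positivity
  -- Summing the quadratic errors over `n` equal steps leaves `O(1/n)`.
  have hstep : ∀ n : ℕ, 0 < n → |G t₁| ≤ C * t₁ ^ 2 / n := by
    intro n hn
    have hn' : (0 : ℝ) < n := by exact_mod_cast hn
    have hk : ∀ k : ℕ, k ≤ n → |G (k * (t₁ / n))| ≤ k * (C * (t₁ / n) ^ 2) := by
      intro k
      induction k with
      | zero => intro _; simp [hG0]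
      | succ k ih =>
        intro hkn
        have h0 : 0 ≤ t₁ / n := div_nonneg ht₁.1 hn'.le
        have hle : ((k + 1 : ℕ) : ℝ) * (t₁ / n) ≤ t₁ := by
          rw [mul_div_assoc', div_le_iff₀ hn', mul_comm t₁]
          exact mul_le_mul_of_nonneg_right (by exact_mod_cast hkn) ht₁.1
        have hkk : (k : ℝ) * (t₁ / n) ≤ ((k + 1 : ℕ) : ℝ) * (t₁ / n) :=
          mul_le_mul_of_nonneg_right (by push_cast; linarith) h0
        have h1 := key (k * (t₁ / n)) ⟨by positivity, hkk.trans (hle.trans ht₁.2)⟩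
          ((k + 1 : ℕ) * (t₁ / n)) ⟨by positivity, hle.trans ht₁.2⟩ hkk
        have e : ((k + 1 : ℕ) : ℝ) * (t₁ / n) - k * (t₁ / n) = t₁ / n := by push_cast; ring
        rw [e] at h1
        have h2 := ih (by omega)
        have h3 := abs_sub_abs_le_abs_sub (G ((k + 1 : ℕ) * (t₁ / n))) (G (k * (t₁ / n)))
        push_cast at *
        linarith
    have := hk n le_rfl
    have e : (n : ℝ) * (t₁ / n) = t₁ := by field_simp
    rw [e] at this
    refine this.trans_eq ?_
    field_simp
  have hlim : Tendsto (fun n : ℕ => C * t₁ ^ 2 / n) atTop (𝓝 0) :=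
    tendsto_const_div_atTop_nhds_zero_nat _
  have : |G t₁| ≤ 0 := ge_of_tendsto hlim (eventually_atTop.2 ⟨1, fun n hn => hstep n hn⟩)
  rw [← hG1]
  exact abs_nonpos_iff.1 this

theorem locallyIntegrable_of_forall_Icc {w : ℝ → ℝ}
    (h : ∀ R : ℝ, IntegrableOn w (Icc (-R) R) volume) : LocallyIntegrable w volume := by
  intro x
  refine ⟨Icc (-(|x| + 1)) (|x| + 1), Icc_mem_nhds ?_ ?_, h _⟩
  · linarith [neg_abs_le x]
  · linarith [le_abs_self x]

theorem LocBddStrip.shear {T : ℝ} {w : ℝ → ℝ → ℝ} (hw : LocBddStrip T w) (σ : ℝ) :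
    LocBddStrip T (fun t x => w t (x - σ * t)) := by
  have hmp : ∀ c : ℝ, MeasurePreserving (fun x : ℝ => x - c) volume volume :=
    fun c => measurePreserving_sub_right volume c
  have hem : ∀ c : ℝ, MeasurableEmbedding (fun x : ℝ => x - c) :=
    fun c => (MeasurableEquiv.subRight c).measurableEmbedding
  have hsub : ∀ t ∈ Icc 0 T, ∀ R : ℝ, Icc (-R) R ⊆
      (fun x => x - σ * t) ⁻¹' Icc (-(R + |σ| * T)) (R + |σ| * T) := by
    intro t ht R x hx
    have h3 : |σ * t| ≤ |σ| * T := by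
      rw [abs_mul, abs_of_nonneg ht.1]; exact mul_le_mul_of_nonneg_left ht.2 (abs_nonneg _)
    have := abs_le.1 h3
    simp only [mem_Icc, mem_preimage] at hx ⊢
    constructor <;> linarith
  have hint : ∀ t ∈ Icc 0 T, ∀ R : ℝ, IntegrableOn (fun x => w t (x - σ * t))
      ((fun x => x - σ * t) ⁻¹' Icc (-R) R) := fun t ht R =>
    ((hmp (σ * t)).integrableOn_comp_preimage (hem _)).2
      ((hw.loc t ht).integrableOn_isCompact isCompact_Icc)
  refine ⟨fun t ht => locallyIntegrable_of_forall_Icc fun R =>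
    (hint t ht _).mono_set (hsub t ht R), fun R => ?_⟩
  obtain ⟨M, hM⟩ := hw.bdd (R + |σ| * T)
  refine ⟨M, fun t ht => ?_⟩
  refine (setIntegral_mono_set (hint t ht _).abs (Eventually.of_forall fun x => abs_nonneg _)
    (LE.le.eventuallyLE (hsub t ht R))).trans ?_
  rw [(hmp (σ * t)).setIntegral_preimage_emb (hem _) (fun x => |w t x|)]
  exact hM t ht

theorem LocIntStrip.primitive_locBdd {T : ℝ} {f : ℝ → ℝ → ℝ} (hf : LocIntStrip T f) {w : ℝ → ℝ}
    (hw : LocallyIntegrable w volume) (hT : 0 ≤ T) :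
    LocBddStrip T (fun t u => w u + ∫ s in (0 : ℝ)..t, f s u) := by
  have hint : ∀ t ∈ Icc 0 T, ∀ R : ℝ,
      IntegrableOn (fun u => ∫ s in (0 : ℝ)..t, f s u) (Icc (-R) R) := by
    intro t ht R
    have := ((hf.restrict ht.2).integrable_prod R).integral_prod_right
    refine this.congr (Eventually.of_forall fun u => ?_)
    simp only
    rw [integral_Icc_eq_integral_Ioc, ← intervalIntegral.integral_of_le ht.1]
  have hw' : ∀ R : ℝ, IntegrableOn w (Icc (-R) R) := fun R =>
    hw.integrableOn_isCompact isCompact_Icc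
  refine ⟨fun t ht => locallyIntegrable_of_forall_Icc fun R => (hw' R).add (hint t ht R),
    fun R => ?_⟩
  have hG := (hf.integrable_prod R).norm.integral_prod_right
  refine ⟨∫ u in Icc (-R) R, (‖w u‖ + ∫ s in Icc 0 T, ‖f s u‖), fun t ht => ?_⟩
  refine integral_mono_ae ((hw' R).add (hint t ht R)).abs ((hw' R).norm.add hG) ?_
  refine ae_restrict_of_ae ?_
  filter_upwards [hf.ae_intervalIntegrable hT] with u hu
  refine (abs_add_le _ _).trans (add_le_add_right ?_ _)
  rw [intervalIntegral.integral_of_le ht.1, ← Real.norm_eq_abs]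
  refine (norm_integral_le_integral_norm _).trans ?_
  rw [intervalIntegrable_iff_integrableOn_Icc_of_le hT] at hu
  exact setIntegral_mono_set hu.norm (Eventually.of_forall fun s => norm_nonneg _)
    (Eventually.of_forall fun s hs => ⟨hs.1.le, hs.2.trans ht.2⟩)

/-- The characteristic formula defines a function `m` with the same initial value, which is itself a
weak solution. The difference `w - m` solves the homogeneous equation and so vanishes. -/
theorem WeakTransport.mildTransport {T σ : ℝ} {w f : ℝ → ℝ → ℝ} (hT : 0 ≤ T)
    (hf : LocIntStrip T f) (hw : LocIntStrip T w) (hb : LocBddStrip T w)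
    (h : WeakTransport T σ w f) : MildTransport T σ w f := by
  have hw0 := hb.loc 0 ⟨le_rfl, hT⟩
  -- The characteristic through `(t, x)` starts at `x + σ t`, written `x - -σ * t` so that `m` is a
  -- shear of a primitive.
  set m : ℝ → ℝ → ℝ := fun t x => w 0 (x - -σ * t) +
    ∫ s in (0 : ℝ)..t, f s ((x - -σ * t) - σ * s) with hm
  have hm0 : m 0 = w 0 := by funext x; simp [hm]
  have mm : MildTransport T σ m f := by
    intro t _
    refine Eventually.of_forall fun u => ?_
    have e : u - σ * t - -σ * t = u := by ring
    rw [hm0]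
    simp only [hm, e]
  have mi : LocIntStrip T m := ((hf.shear σ).primitive hw0 hT).shear (-σ)
  have mb : LocBddStrip T m := ((hf.shear σ).primitive_locBdd hw0 hT).shear (-σ)
  have mw : WeakTransport T σ m f := mm.weakTransport hf (hm0 ▸ hw0)
  have hd := ae_eq_zero_of_weakTransport_zero (σ := σ) (hw.sub mi) (hb.sub mb) (by
    intro η hη hc t ht
    have hη' : Continuous (deriv η) := hη.continuous_deriv (by simp)
    have hmono : ∀ {g : ℝ → ℝ}, IntervalIntegrable g volume 0 T → IntervalIntegrable g volume 0 t :=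
      fun hg => hg.mono_set (by
        rw [uIcc_of_le hT, uIcc_of_le ht.1]; exact Icc_subset_Icc_right ht.2)
    have i1 := hmono (hf.intervalIntegrable_pairing hη.continuous hc hT)
    have i2 := hmono (hw.intervalIntegrable_pairing hη' hc.deriv hT)
    have i3 := hmono (mi.intervalIntegrable_pairing hη' hc.deriv hT)
    have e1 := h η hη hc t ht
    have e2 := mw η hη hc t ht
    rw [hm0] at e2
    rw [intervalIntegral.integral_sub i1 (i2.const_mul σ), intervalIntegral.integral_const_mul] at e1
    rw [intervalIntegral.integral_sub i1 (i3.const_mul σ), intervalIntegral.integral_const_mul] at e2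
    have e3 : ∀ θ : ℝ → ℝ, Continuous θ → HasCompactSupport θ → ∀ s ∈ Icc 0 T,
        ∫ x, (w s x - m s x) * θ x = (∫ x, w s x * θ x) - ∫ x, m s x * θ x := by
      intro θ hθ hθc s hs
      simp only [sub_mul]
      exact integral_sub (integrable_locallyIntegrable_mul_test (hb.loc s hs) hθ hθc)
        (integrable_locallyIntegrable_mul_test (mb.loc s hs) hθ hθc)
    rw [e3 η hη.continuous hc t ht, intervalIntegral.integral_congr (g := fun s =>
      (∫ x, w s x * deriv η x) - ∫ x, m s x * deriv η x) (fun s hs => by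
        rw [uIcc_of_le ht.1] at hs
        exact e3 _ hη' hc.deriv s ⟨hs.1, hs.2.trans ht.2⟩),
      intervalIntegral.integral_sub i2 i3]
    linear_combination e1 - e2)
  intro t ht
  have h1 := (measurePreserving_sub_right volume (σ * t)).quasiMeasurePreserving.ae (hd t ht)
  filter_upwards [h1, mm t ht] with u h1 h2
  rw [← hm0, ← h2]
  simpa [sub_eq_zero] using h1

/-! ### The `L²` norm on the line -/

theorem l2norm_nonneg (f : ℝ → ℝ) : 0 ≤ l2norm f := ENNReal.toReal_nonneg

theorem l2norm_congr {f g : ℝ → ℝ} (h : f =ᵐ[volume] g) : l2norm f = l2norm g := by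
  rw [l2norm, l2norm, eLpNorm_congr_ae h]

theorem l2norm_sq {f : ℝ → ℝ} (hf : MemLp f 2 volume) : l2norm f ^ 2 = ∫ x, f x ^ 2 := by
  have h := hf.eLpNorm_eq_integral_rpow_norm (by norm_num) (by norm_num)
  have hn : 0 ≤ ∫ x, f x ^ 2 := integral_nonneg fun x => sq_nonneg _
  have e : ∫ x, ‖f x‖ ^ (2 : ℝ≥0∞).toReal = ∫ x, f x ^ 2 :=
    integral_congr_ae (Eventually.of_forall fun x => by simp)
  rw [e] at h
  rw [l2norm, h, ENNReal.toReal_ofReal (by positivity), ← Real.rpow_natCast, ← Real.rpow_mul hn]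
  norm_num

theorem l2norm_add_le {f g : ℝ → ℝ} (hf : MemLp f 2 volume) (hg : MemLp g 2 volume) :
    l2norm (fun x => f x + g x) ≤ l2norm f + l2norm g := by
  rw [l2norm, l2norm, l2norm, ← ENNReal.toReal_add hf.2.ne hg.2.ne]
  exact ENNReal.toReal_mono (ENNReal.add_ne_top.2 ⟨hf.2.ne, hg.2.ne⟩)
    (eLpNorm_add_le hf.1 hg.1 (by norm_num))

theorem l2norm_sub_le {f g : ℝ → ℝ} (hf : MemLp f 2 volume) (hg : MemLp g 2 volume) :
    l2norm (fun x => f x - g x) ≤ l2norm f + l2norm g := by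
  rw [l2norm, l2norm, l2norm, ← ENNReal.toReal_add hf.2.ne hg.2.ne]
  exact ENNReal.toReal_mono (ENNReal.add_ne_top.2 ⟨hf.2.ne, hg.2.ne⟩)
    (eLpNorm_sub_le hf.1 hg.1 (by norm_num))

theorem l2norm_mono {f g : ℝ → ℝ} (hg : MemLp g 2 volume) (h : ∀ᵐ x, |f x| ≤ |g x|) :
    l2norm f ≤ l2norm g :=
  ENNReal.toReal_mono hg.2.ne (eLpNorm_mono_ae h)

theorem l2norm_const_mul (c : ℝ) (f : ℝ → ℝ) : l2norm (fun x => c * f x) = |c| * l2norm f := by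
  have : eLpNorm (fun x => c * f x) 2 volume = ‖c‖ₑ * eLpNorm f 2 volume :=
    eLpNorm_const_smul c f 2 volume
  rw [l2norm, this, ENNReal.toReal_mul, l2norm]
  simp

theorem memLp_comp_affine {f : ℝ → ℝ} (hf : MemLp f 2 volume) (y : ℝ) {ρ : ℝ} (hρ : ρ ≠ 0) :
    MemLp (fun s => f (y + ρ * s)) 2 volume := by
  have hq : Measure.QuasiMeasurePreserving (fun s : ℝ => y + ρ * s) volume volume := by
    have h1 : Measure.QuasiMeasurePreserving (fun s : ℝ => ρ * s) volume volume := by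
      refine ⟨by fun_prop, ?_⟩
      rw [Real.map_volume_mul_left hρ]
      exact Measure.smul_absolutelyContinuous
    exact (measurePreserving_add_left volume y).quasiMeasurePreserving.comp h1
  have hm : AEStronglyMeasurable (fun s => f (y + ρ * s)) volume :=
    hf.1.comp_quasiMeasurePreserving hq
  rw [memLp_two_iff_integrable_sq hm]
  have h2 := (memLp_two_iff_integrable_sq hf.1).1 hf
  exact (h2.comp_add_left y).comp_mul_left' hρ

/-- The Jacobian `1 / |ρ|` is at most one. The values in use are `ρ = ±2`, for data of one family
sampled along characteristics of the other, and `ρ = ±1`, along vertical lines. -/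
theorem l2norm_comp_affine_le {f : ℝ → ℝ} (hf : MemLp f 2 volume) (y : ℝ) {ρ : ℝ} (hρ : 1 ≤ |ρ|) :
    l2norm (fun s => f (y + ρ * s)) ≤ l2norm f := by
  have hρ0 : ρ ≠ 0 := by rintro rfl; norm_num at hρ
  refine le_of_sq_le_sq ?_ (l2norm_nonneg f)
  rw [l2norm_sq (memLp_comp_affine hf y hρ0), l2norm_sq hf]
  rw [Measure.integral_comp_mul_left (fun x => f (y + x) ^ 2) ρ,
    integral_add_left_eq_self (fun x => f x ^ 2) y, smul_eq_mul, abs_inv]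
  have h0 : 0 ≤ ∫ x, f x ^ 2 := integral_nonneg fun x => sq_nonneg _
  exact mul_le_of_le_one_left h0 (inv_le_one_of_one_le₀ hρ)

theorem memLp_comp_add {f : ℝ → ℝ} (hf : MemLp f 2 volume) (y : ℝ) :
    MemLp (fun s => f (s + y)) 2 volume := by
  simpa [add_comm] using memLp_comp_affine hf y one_ne_zero

theorem l2norm_comp_add (f : ℝ → ℝ) (hf : AEStronglyMeasurable f volume) (y : ℝ) :
    l2norm (fun s => f (s + y)) = l2norm f := by
  rw [l2norm, l2norm]
  congr 1
  exact eLpNorm_comp_measurePreserving hf (measurePreserving_add_right volume y)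

/-- Cauchy–Schwarz on a bounded interval. -/
theorem integral_abs_le_l2norm {f : ℝ → ℝ} (hf : MemLp f 2 volume) {a b : ℝ} (hab : a ≤ b) :
    ∫ s in a..b, |f s| ≤ √(b - a) * l2norm f := by
  have hf' : MemLp f 2 (volume.restrict (Ioc a b)) := hf.restrict _
  have h1 := eLpNorm_le_eLpNorm_mul_rpow_measure_univ (μ := volume.restrict (Ioc a b))
    (p := 1) (q := 2) (by norm_num) hf'.1
  have h2 : eLpNorm f 2 (volume.restrict (Ioc a b)) ≤ eLpNorm f 2 volume :=
    eLpNorm_mono_measure _ Measure.restrict_le_self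
  rw [intervalIntegral.integral_of_le hab]
  have e : ∫ s in Ioc a b, |f s| = (eLpNorm f 1 (volume.restrict (Ioc a b))).toReal := by
    rw [eLpNorm_one_eq_lintegral_enorm, ← integral_norm_eq_lintegral_enorm hf'.1]
    rfl
  rw [e]
  have h3 : eLpNorm f 1 (volume.restrict (Ioc a b)) ≤
      eLpNorm f 2 volume * ENNReal.ofReal √(b - a) := by
    refine h1.trans (mul_le_mul' h2 (le_of_eq ?_))
    simp only [Measure.restrict_apply MeasurableSet.univ, univ_inter, Real.volume_Ioc]
    rw [ENNReal.ofReal_rpow_of_nonneg (sub_nonneg.2 hab) (by norm_num), Real.sqrt_eq_rpow]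
    norm_num
  have h4 := ENNReal.toReal_mono (ENNReal.mul_ne_top hf.2.ne ENNReal.ofReal_ne_top) h3
  rwa [ENNReal.toReal_mul, ENNReal.toReal_ofReal (Real.sqrt_nonneg _), mul_comm] at h4

theorem memLp_intervalIntegrable {f : ℝ → ℝ} (hf : MemLp f 2 volume) (a b : ℝ) :
    IntervalIntegrable f volume a b :=
  ((hf.locallyIntegrable (by norm_num)).integrableOn_isCompact isCompact_uIcc).intervalIntegrable

/-! ### The continuous representative of an `H¹` function -/

theorem locIntStrip_static {T : ℝ} {f : ℝ → ℝ} (hf : LocallyIntegrable f volume) :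
    LocIntStrip T (fun _ x => f x) := by
  intro R
  rw [IntegrableOn, Measure.volume_eq_prod, ← Measure.prod_restrict]
  have : Integrable f (volume.restrict (Icc (-R) R)) := hf.integrableOn_isCompact isCompact_Icc
  exact this.comp_snd _

/-- A time-independent function solves the transport equation with source `-σ` times its weak
derivative. The characteristic form of that equation is the fundamental theorem of calculus. -/
theorem H1.ae_translate (f : H1) (σ : ℝ) {t : ℝ} (ht : 0 ≤ t) :
    ∀ᵐ u, f.toFun (u - σ * t) = f.toFun u - ∫ y in (u - σ * t)..u, f.dx y := by
  have h1 : LocallyIntegrable f.toFun volume := f.memLp_toFun.locallyIntegrable (by norm_num)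
  have h2 : LocallyIntegrable f.dx volume := f.memLp_dx.locallyIntegrable (by norm_num)
  have hw : WeakTransport t σ (fun _ x => f.toFun x) (fun _ x => -σ * f.dx x) := by
    intro η hη hc s _
    have e : ∀ r : ℝ, (∫ x, -σ * f.dx x * η x) - σ * ∫ x, f.toFun x * deriv η x = 0 := by
      intro r
      rw [f.hasWeakDeriv η hη hc]
      simp only [mul_assoc]
      rw [integral_const_mul]; ring
    rw [intervalIntegral.integral_congr (g := fun _ => 0) fun r _ => e r]
    simp
  have hm := hw.mildTransport ht ((locIntStrip_static h2).const_mul (-σ)) (locIntStrip_static h1)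
    ⟨fun _ _ => h1, fun R => ⟨_, fun _ _ => le_rfl⟩⟩ t ⟨ht, le_rfl⟩
  filter_upwards [hm] with u hu
  rw [hu, intervalIntegral.integral_const_mul, neg_mul,
    intervalIntegral.mul_integral_comp_sub_mul]
  simp [sub_eq_add_neg]

/-- Subtracting the primitive of the weak derivative leaves a function `k` that is almost everywhere
invariant under each translation. By Fubini such a function is almost everywhere constant. -/
theorem H1.exists_continuous (f : H1) : ∃ g : ℝ → ℝ, Continuous g ∧ f.toFun =ᵐ[volume] g ∧
    ∀ x y, g y - g x = ∫ z in x..y, f.dx z := by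
  have h1 : LocallyIntegrable f.toFun volume := f.memLp_toFun.locallyIntegrable (by norm_num)
  have h2 : LocallyIntegrable f.dx volume := f.memLp_dx.locallyIntegrable (by norm_num)
  have hI : ∀ a b, IntervalIntegrable f.dx volume a b := memLp_intervalIntegrable f.memLp_dx
  set g₀ : ℝ → ℝ := fun x => ∫ z in (0 : ℝ)..x, f.dx z with hg₀
  have hg₀c : Continuous g₀ := intervalIntegral.continuous_primitive hI 0
  set k : ℝ → ℝ := fun x => f.toFun x - g₀ x with hk
  have hkm : AEStronglyMeasurable k volume :=
    f.memLp_toFun.1.sub hg₀c.aestronglyMeasurable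
  have hinv : ∀ σ : ℝ, ∀ t, 0 ≤ t → ∀ᵐ u, k (u - σ * t) = k u := by
    intro σ t ht
    filter_upwards [f.ae_translate σ ht] with u hu
    have := intervalIntegral.integral_interval_sub_left (hI 0 u) (hI 0 (u - σ * t))
    simp only [hk, hg₀]
    linarith
  have hsw : ∀ σ : ℝ, ∀ᵐ u, ∀ n : ℕ, ∀ᵐ t ∂volume.restrict (Icc (0 : ℝ) n), k (u - σ * t) = k u := by
    intro σ
    refine ae_all_iff.2 fun n => ae_strip_swap (p := fun t u => k (u - σ * t) = k u) ?_
    refine ae_strip_of_forall_ae (g := fun t u => k (u - σ * t)) (h := fun _ u => k u) ?_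
      hkm.comp_snd (fun t ht => hinv σ t ht.1)
    exact (hkm.comp_snd (μ := volume.restrict (Icc (0 : ℝ) n))).comp_quasiMeasurePreserving
      (measurePreserving_shear σ (volume.restrict (Icc (0 : ℝ) n))).quasiMeasurePreserving
  -- One base point that is good for almost all shifts to the left and to the right; the value `k u`
  -- is the constant.
  obtain ⟨u, hu1, hu2⟩ := ((hsw 1).and (hsw (-1))).exists
  have hpos : ∀ σ : ℝ, (∀ n : ℕ, ∀ᵐ t ∂volume.restrict (Icc (0 : ℝ) n), k (u - σ * t) = k u) →
      ∀ᵐ t, 0 ≤ t → k (u - σ * t) = k u := by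
    intro σ h
    have : ∀ᵐ t, ∀ n : ℕ, t ∈ Icc (0 : ℝ) n → k (u - σ * t) = k u :=
      ae_all_iff.2 fun n => (ae_restrict_iff' measurableSet_Icc).1 (h n)
    filter_upwards [this] with t ht h0
    obtain ⟨n, hn⟩ := exists_nat_ge t
    exact ht n ⟨h0, hn⟩
  have p1 : ∀ᵐ y, 0 ≤ u - y → k (u - 1 * (u - y)) = k u :=
    (Measure.measurePreserving_sub_left volume u).quasiMeasurePreserving.ae (hpos 1 hu1)
  have p2 : ∀ᵐ y, 0 ≤ y - u → k (u - -1 * (y - u)) = k u :=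
    (measurePreserving_sub_right volume u).quasiMeasurePreserving.ae (hpos (-1) hu2)
  have hc : ∀ᵐ y, k y = k u := by
    filter_upwards [p1, p2] with y p1 p2
    rcases le_total y u with h | h
    · have := p1 (sub_nonneg.2 h)
      simpa using this
    · have := p2 (sub_nonneg.2 h)
      rw [← this]; congr 1; ring
  refine ⟨fun x => g₀ x + k u, hg₀c.add continuous_const, ?_, fun x y => ?_⟩
  · filter_upwards [hc] with y hy
    rw [← hy]; simp [hk]
  · have := intervalIntegral.integral_interval_sub_left (hI 0 y) (hI 0 x)
    simp only [hg₀]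
    linarith

/-- The Sobolev inequality at scale `r`. -/
theorem abs_le_of_primitive {g f' : ℝ → ℝ} (hg : MemLp g 2 volume) (hf' : MemLp f' 2 volume)
    (hgc : Continuous g) (h : ∀ x y, g y - g x = ∫ z in x..y, f' z) {r : ℝ} (hr : 0 < r) (x : ℝ) :
    r * |g x| ≤ √r * l2norm g + r * (√r * l2norm f') := by
  have h1 : ∀ y ∈ Icc x (x + r), |g x| ≤ |g y| + √r * l2norm f' := by
    intro y hy
    have h2 : |g y - g x| ≤ √r * l2norm f' := by
      rw [h x y]
      refine (intervalIntegral.abs_integral_le_integral_abs hy.1).trans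
        ((integral_abs_le_l2norm hf' hy.1).trans ?_)
      exact mul_le_mul_of_nonneg_right (Real.sqrt_le_sqrt (by linarith [hy.2])) (l2norm_nonneg _)
    have := abs_sub_abs_le_abs_sub (g x) (g y)
    rw [abs_sub_comm] at this
    linarith
  have h3 : ∫ _ in x..(x + r), |g x| ≤ ∫ y in x..(x + r), (|g y| + √r * l2norm f') :=
    intervalIntegral.integral_mono_on (by linarith) (by simp)
      (Continuous.intervalIntegrable (by fun_prop) _ _) h1
  rw [intervalIntegral.integral_add (Continuous.intervalIntegrable (by fun_prop) _ _) (by simp)] at h3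
  have h4 := integral_abs_le_l2norm hg (show x ≤ x + r by linarith)
  simp only [intervalIntegral.integral_const, add_sub_cancel_left, smul_eq_mul] at h3 h4
  linarith

/-- The weak derivative is unique. -/
theorem HasWeakDeriv.ae_unique {f f₁ g g₁ : ℝ → ℝ} (hg : LocallyIntegrable g volume)
    (hg₁ : LocallyIntegrable g₁ volume) (h : HasWeakDeriv f g) (h₁ : HasWeakDeriv f₁ g₁)
    (hf : f =ᵐ[volume] f₁) : g =ᵐ[volume] g₁ := by
  refine ae_eq_of_integral_contDiff_smul_eq hg hg₁ fun η hη hc => ?_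
  have e1 := h η hη hc
  have e2 := h₁ η hη hc
  rw [integral_congr_ae (g := fun x => f₁ x * deriv η x) (by
    filter_upwards [hf] with x hx; rw [hx]), e2] at e1
  simp only [smul_eq_mul, mul_comm (η _)]
  linarith

/-! ### Bounded curves in `L²`, and the wave equation as a pair of transport equations -/

/-- A jointly measurable curve in `L²(ℝ)` that is bounded by `M` on `[0, T]`. -/
structure L2Strip (T : ℝ) (w : ℝ → ℝ → ℝ) (M : ℝ) : Prop where
  meas : AEStronglyMeasurable (fun z : ℝ × ℝ => w z.1 z.2) (stripMeasure T)
  memLp : ∀ t ∈ Icc 0 T, MemLp (w t) 2 volume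
  le : ∀ t ∈ Icc 0 T, l2norm (w t) ≤ M

theorem setIntegral_abs_le_l2norm {f : ℝ → ℝ} (hf : MemLp f 2 volume) (R : ℝ) :
    ∫ x in Icc (-R) R, |f x| ≤ √(2 * R) * l2norm f := by
  rcases lt_or_ge R 0 with hR | hR
  · rw [Icc_eq_empty (by linarith)]
    rw [setIntegral_empty]
    exact mul_nonneg (Real.sqrt_nonneg _) (l2norm_nonneg f)
  · rw [integral_Icc_eq_integral_Ioc, ← intervalIntegral.integral_of_le (by linarith)]
    refine (integral_abs_le_l2norm hf (by linarith)).trans_eq ?_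
    ring_nf

theorem sq_integral_le {f : ℝ → ℝ} {a b : ℝ} (hab : a ≤ b)
    (hf : AEStronglyMeasurable f (volume.restrict (Ioc a b)))
    (hf2 : IntegrableOn (fun s => f s ^ 2) (Ioc a b)) :
    (∫ s in a..b, f s) ^ 2 ≤ (b - a) * ∫ s in Ioc a b, f s ^ 2 := by
  have hm : MemLp ((Ioc a b).indicator f) 2 volume := by
    rw [memLp_indicator_iff_restrict measurableSet_Ioc]
    exact (memLp_two_iff_integrable_sq hf).2 hf2
  have h1 := integral_abs_le_l2norm hm hab
  have e1 : ∫ s in a..b, |(Ioc a b).indicator f s| = ∫ s in a..b, |f s| := by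
    refine intervalIntegral.integral_congr_ae (Eventually.of_forall fun s hs => ?_)
    rw [uIoc_of_le hab] at hs
    rw [indicator_of_mem hs]
  have e2 : l2norm ((Ioc a b).indicator f) ^ 2 = ∫ s in Ioc a b, f s ^ 2 := by
    rw [l2norm_sq hm, ← integral_indicator measurableSet_Ioc]
    refine integral_congr_ae (Eventually.of_forall fun s => ?_)
    by_cases hs : s ∈ Ioc a b <;> simp [hs]
  rw [← e2]
  have h2 := (intervalIntegral.abs_integral_le_integral_abs hab).trans (e1 ▸ h1)
  calc _ = |∫ s in a..b, f s| ^ 2 := (sq_abs _).symm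
    _ ≤ (√(b - a) * l2norm ((Ioc a b).indicator f)) ^ 2 := by gcongr
    _ = _ := by rw [mul_pow, Real.sq_sqrt (sub_nonneg.2 hab)]

namespace L2Strip

variable {T M N : ℝ} {w v : ℝ → ℝ → ℝ}

theorem locBdd (hw : L2Strip T w M) : LocBddStrip T w :=
  ⟨fun t ht => (hw.memLp t ht).locallyIntegrable (by norm_num), fun R =>
    ⟨√(2 * R) * M, fun t ht => (setIntegral_abs_le_l2norm (hw.memLp t ht) R).trans
      (mul_le_mul_of_nonneg_left (hw.le t ht) (Real.sqrt_nonneg _))⟩⟩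

theorem locInt (hw : L2Strip T w M) : LocIntStrip T w := by
  intro R
  rw [IntegrableOn, Measure.volume_eq_prod, ← Measure.prod_restrict]
  have hm : AEStronglyMeasurable (fun z : ℝ × ℝ => w z.1 z.2)
      ((volume.restrict (Icc 0 T)).prod (volume.restrict (Icc (-R) R))) :=
    hw.meas.mono_ac (Measure.AbsolutelyContinuous.prod Measure.AbsolutelyContinuous.rfl
      Measure.restrict_le_self.absolutelyContinuous)
  rw [integrable_prod_iff hm]
  refine ⟨?_, ?_⟩
  · filter_upwards [ae_restrict_mem measurableSet_Icc] with t ht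
    exact (hw.locBdd.loc t ht).integrableOn_isCompact isCompact_Icc
  · refine (integrable_const (√(2 * R) * M)).mono' hm.norm.integral_prod_right' ?_
    filter_upwards [ae_restrict_mem measurableSet_Icc] with t ht
    rw [Real.norm_of_nonneg (integral_nonneg fun x => norm_nonneg _)]
    exact (setIntegral_abs_le_l2norm (hw.memLp t ht) R).trans
      (mul_le_mul_of_nonneg_left (hw.le t ht) (Real.sqrt_nonneg _))

theorem add (hw : L2Strip T w M) (hv : L2Strip T v N) :
    L2Strip T (fun t x => w t x + v t x) (M + N) :=
  ⟨hw.meas.add hv.meas, fun t ht => (hw.memLp t ht).add (hv.memLp t ht), fun t ht =>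
    (l2norm_add_le (hw.memLp t ht) (hv.memLp t ht)).trans (add_le_add (hw.le t ht) (hv.le t ht))⟩

theorem sub (hw : L2Strip T w M) (hv : L2Strip T v N) :
    L2Strip T (fun t x => w t x - v t x) (M + N) :=
  ⟨hw.meas.sub hv.meas, fun t ht => (hw.memLp t ht).sub (hv.memLp t ht), fun t ht =>
    (l2norm_sub_le (hw.memLp t ht) (hv.memLp t ht)).trans (add_le_add (hw.le t ht) (hv.le t ht))⟩

theorem const_mul (c : ℝ) (hw : L2Strip T w M) :
    L2Strip T (fun t x => c * w t x) (|c| * M) :=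
  ⟨hw.meas.const_mul c, fun t ht => (hw.memLp t ht).const_mul c, fun t ht => by
    rw [l2norm_const_mul]; exact mul_le_mul_of_nonneg_left (hw.le t ht) (abs_nonneg _)⟩

theorem integrable_sq (hw : L2Strip T w M) :
    Integrable (fun z : ℝ × ℝ => w z.1 z.2 ^ 2) (stripMeasure T) := by
  have hm := hw.meas.pow 2
  have hm' : AEStronglyMeasurable (fun z : ℝ × ℝ => w z.1 z.2 ^ 2) (stripMeasure T) := hm
  rw [integrable_prod_iff hm']
  refine ⟨?_, ?_⟩
  · filter_upwards [ae_restrict_mem measurableSet_Icc] with t ht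
    exact (hw.memLp t ht).integrable_sq
  · refine (integrable_const (M ^ 2)).mono' hm'.norm.integral_prod_right' ?_
    filter_upwards [ae_restrict_mem measurableSet_Icc] with t ht
    rw [Real.norm_of_nonneg (integral_nonneg fun x => norm_nonneg _)]
    simp only [norm_pow, Real.norm_eq_abs, sq_abs]
    rw [← l2norm_sq (hw.memLp t ht)]
    exact pow_le_pow_left₀ (l2norm_nonneg _) (hw.le t ht) 2

/-- Minkowski's inequality for time integrals of curves in `L²`. -/
theorem timeIntegral (hw : L2Strip T w M) {a b : ℝ} (ha : 0 ≤ a) (hab : a ≤ b) (hb : b ≤ T) :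
    MemLp (fun x => ∫ s in a..b, w s x) 2 volume ∧
      l2norm (fun x => ∫ s in a..b, w s x) ≤ (b - a) * M := by
  have hM : 0 ≤ M := (l2norm_nonneg _).trans (hw.le b ⟨ha.trans hab, hb⟩)
  have hsub : Ioc a b ⊆ Icc 0 T := fun s hs => ⟨ha.trans hs.1.le, hs.2.trans hb⟩
  have hac : (volume.restrict (Ioc a b)).prod volume ≪ stripMeasure T :=
    Measure.AbsolutelyContinuous.prod (Measure.restrict_mono hsub le_rfl).absolutelyContinuous
      Measure.AbsolutelyContinuous.rfl
  have hm : AEStronglyMeasurable (fun z : ℝ × ℝ => w z.1 z.2)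
      ((volume.restrict (Ioc a b)).prod volume) := hw.meas.mono_ac hac
  have hi : Integrable (fun z : ℝ × ℝ => w z.1 z.2 ^ 2) ((volume.restrict (Ioc a b)).prod volume) := by
    refine hw.integrable_sq.mono_measure ?_
    exact Measure.prod_mono (Measure.restrict_mono hsub le_rfl) le_rfl
  have hm1 : AEStronglyMeasurable (fun x => ∫ s in a..b, w s x) volume := by
    simp only [intervalIntegral.integral_of_le hab]
    exact hm.prod_swap.integral_prod_right' (f := fun z : ℝ × ℝ => w z.2 z.1)
  -- Cauchy–Schwarz in time at fixed `x`; integrating over `x` then gives the bound because the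
  -- norms are bounded uniformly in time.
  have hb1 : ∀ᵐ x, (∫ s in a..b, w s x) ^ 2 ≤ (b - a) * ∫ s in Ioc a b, w s x ^ 2 := by
    filter_upwards [hm.prodMk_right, hi.prod_left_ae] with x h1 h2
    exact sq_integral_le hab h1 h2
  have hi2 : Integrable (fun x => (b - a) * ∫ s in Ioc a b, w s x ^ 2) :=
    (hi.integral_prod_right).const_mul _
  have hi3 : Integrable (fun x => (∫ s in a..b, w s x) ^ 2) := by
    refine hi2.mono' (hm1.pow 2) ?_
    filter_upwards [hb1] with x hx
    rwa [Real.norm_of_nonneg (sq_nonneg _)]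
  have hmem : MemLp (fun x => ∫ s in a..b, w s x) 2 volume :=
    (memLp_two_iff_integrable_sq hm1).2 hi3
  refine ⟨hmem, le_of_sq_le_sq ?_ (mul_nonneg (sub_nonneg.2 hab) hM)⟩
  rw [l2norm_sq hmem]
  refine (integral_mono_ae hi3 hi2 hb1).trans ?_
  rw [integral_const_mul, ← integral_integral_swap hi, mul_pow, sq (b - a), mul_assoc]
  refine mul_le_mul_of_nonneg_left ?_ (sub_nonneg.2 hab)
  have : ∫ s in Ioc a b, ∫ x, w s x ^ 2 ≤ ∫ _ in Ioc a b, M ^ 2 := by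
    refine setIntegral_mono_on hi.integral_prod_left (by simp) measurableSet_Ioc fun s hs => ?_
    rw [← l2norm_sq (hw.memLp s (hsub hs))]
    exact pow_le_pow_left₀ (l2norm_nonneg _) (hw.le s (hsub hs)) 2
  refine this.trans_eq ?_
  simp [hab]

end L2Strip

/-- The characteristic form of the wave equation implies the distributional one. -/
theorem wave_of_transports {T : ℝ} (hT : 0 ≤ T) {ψ p q f : ℝ → ℝ → ℝ} {A B : ℝ}
    (hp : L2Strip T p A) (hq : L2Strip T q B) (hf : LocIntStrip T f)
    (hψ : ∀ t ∈ Icc 0 T, LocallyIntegrable (ψ t) volume)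
    (hψt : MildTransport T 0 ψ (fun t x => 2⁻¹ * (p t x + q t x)))
    (hpt : MildTransport T 1 p f) (hqt : MildTransport T (-1) q f)
    (h0 : HasWeakDeriv (ψ 0) (fun x => 2⁻¹ * (p 0 x - q 0 x))) :
    (∀ t ∈ Icc 0 T, HasWeakDeriv (ψ t) (fun x => 2⁻¹ * (p t x - q t x))) ∧
      IsWeakWave T ψ (fun t x => 2⁻¹ * (p t x + q t x)) (fun t x => -f t x) ∧
      WeakTransport T 1 ψ q ∧ WeakTransport T (-1) ψ p := by
  have m0 : (0 : ℝ) ∈ Icc 0 T := ⟨le_rfl, hT⟩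
  have wp := hpt.weakTransport hf (hp.locBdd.loc 0 m0)
  have wq := hqt.weakTransport hf (hq.locBdd.loc 0 m0)
  have wψ := hψt.weakTransport ((hp.locInt.add hq.locInt).const_mul 2⁻¹) (hψ 0 m0)
  have ip : ∀ {η : ℝ → ℝ}, Continuous η → HasCompactSupport η → ∀ t ∈ Icc 0 T,
      Integrable (fun x => p t x * η x) := fun hη hc t ht =>
    integrable_locallyIntegrable_mul_test (hp.locBdd.loc t ht) hη hc
  have iq : ∀ {η : ℝ → ℝ}, Continuous η → HasCompactSupport η → ∀ t ∈ Icc 0 T,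
      Integrable (fun x => q t x * η x) := fun hη hc t ht =>
    integrable_locallyIntegrable_mul_test (hq.locBdd.loc t ht) hη hc
  have eadd : ∀ {η : ℝ → ℝ}, Continuous η → HasCompactSupport η → ∀ t ∈ Icc 0 T,
      ∫ x, 2⁻¹ * (p t x + q t x) * η x = 2⁻¹ * (∫ x, p t x * η x) + 2⁻¹ * ∫ x, q t x * η x := by
    intro η hη hc t ht
    rw [← integral_const_mul, ← integral_const_mul,
      ← integral_add ((ip hη hc t ht).const_mul _) ((iq hη hc t ht).const_mul _)]
    congr 1; funext x; ring
  have esub : ∀ {η : ℝ → ℝ}, Continuous η → HasCompactSupport η → ∀ t ∈ Icc 0 T,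
      ∫ x, 2⁻¹ * (p t x - q t x) * η x = 2⁻¹ * (∫ x, p t x * η x) - 2⁻¹ * ∫ x, q t x * η x := by
    intro η hη hc t ht
    rw [← integral_const_mul, ← integral_const_mul,
      ← integral_sub ((ip hη hc t ht).const_mul _) ((iq hη hc t ht).const_mul _)]
    congr 1; funext x; ring
  have hmono : ∀ {g : ℝ → ℝ} {t : ℝ}, t ∈ Icc 0 T → IntervalIntegrable g volume 0 T →
      IntervalIntegrable g volume 0 t :=
    fun ht hg => hg.mono_set (by
      rw [uIcc_of_le hT, uIcc_of_le ht.1]; exact Icc_subset_Icc_right ht.2)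
  have eψ : ∀ {η : ℝ → ℝ}, ContDiff ℝ ∞ η → HasCompactSupport η → ∀ t ∈ Icc 0 T,
      ∫ x, ψ t x * η x = (∫ x, ψ 0 x * η x) +
        (2⁻¹ * (∫ s in (0 : ℝ)..t, ∫ x, p s x * η x) +
          2⁻¹ * ∫ s in (0 : ℝ)..t, ∫ x, q s x * η x) := by
    intro η hη hc t ht
    rw [wψ η hη hc t ht, ← intervalIntegral.integral_const_mul, ← intervalIntegral.integral_const_mul,
      ← intervalIntegral.integral_add
        ((hmono ht (hp.locInt.intervalIntegrable_pairing hη.continuous hc hT)).const_mul _)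
        ((hmono ht (hq.locInt.intervalIntegrable_pairing hη.continuous hc hT)).const_mul _)]
    congr 1
    refine intervalIntegral.integral_congr fun s hs => ?_
    rw [uIcc_of_le ht.1] at hs
    simp only [zero_mul, sub_zero]
    exact eadd hη.continuous hc s ⟨hs.1, hs.2.trans ht.2⟩
  have epq : ∀ {η : ℝ → ℝ}, ContDiff ℝ ∞ η → HasCompactSupport η → ∀ t ∈ Icc 0 T,
      (∫ x, p t x * η x = (∫ x, p 0 x * η x) + ((∫ s in (0 : ℝ)..t, ∫ x, f s x * η x) -
          ∫ s in (0 : ℝ)..t, ∫ x, p s x * deriv η x)) ∧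
      (∫ x, q t x * η x = (∫ x, q 0 x * η x) + ((∫ s in (0 : ℝ)..t, ∫ x, f s x * η x) +
          ∫ s in (0 : ℝ)..t, ∫ x, q s x * deriv η x)) := by
    intro η hη hc t ht
    have hη' : Continuous (deriv η) := hη.continuous_deriv (by simp)
    have i1 := hmono ht (hf.intervalIntegrable_pairing hη.continuous hc hT)
    have i2 := hmono ht (hp.locInt.intervalIntegrable_pairing hη' hc.deriv hT)
    have i3 := hmono ht (hq.locInt.intervalIntegrable_pairing hη' hc.deriv hT)
    refine ⟨?_, ?_⟩
    · rw [wp η hη hc t ht, ← intervalIntegral.integral_sub i1 i2]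
      simp
    · rw [wq η hη hc t ht, ← intervalIntegral.integral_add i1 i3]
      simp
  -- The relation `∂ₓψ = (p - q) / 2` holds at time `0` and propagates: in the equation for `p - q`
  -- the source `f` cancels, and what remains is the `x`-derivative of `(p + q) / 2 = ∂ₜψ`.
  have hweak : ∀ t ∈ Icc 0 T, HasWeakDeriv (ψ t) (fun x => 2⁻¹ * (p t x - q t x)) := by
    intro t ht η hη hc
    have hη' : ContDiff ℝ ∞ (deriv η) := hη.iterate_deriv 1
    have := h0 η hη hc
    rw [esub hη.continuous hc 0 m0] at this
    rw [esub hη.continuous hc t ht, eψ hη' hc.deriv t ht, (epq hη hc t ht).1, (epq hη hc t ht).2,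
      this]
    ring
  refine ⟨hweak, fun η hη hc t ht => ⟨?_, ?_⟩,
    fun η hη hc t ht => ?_, fun η hη hc t ht => ?_⟩
  · rw [wψ η hη hc t ht]
    simp
  · have hη' : ContDiff ℝ ∞ (deriv η) := hη.iterate_deriv 1
    have i1 := hmono ht (hf.intervalIntegrable_pairing hη.continuous hc hT)
    have i2 := hmono ht (hp.locInt.intervalIntegrable_pairing hη'.continuous hc.deriv hT)
    have i3 := hmono ht (hq.locInt.intervalIntegrable_pairing hη'.continuous hc.deriv hT)
    rw [eadd hη.continuous hc t ht, eadd hη.continuous hc 0 m0, (epq hη hc t ht).1,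
      (epq hη hc t ht).2]
    have e : ∫ s in (0 : ℝ)..t, ((∫ x, ψ s x * iteratedDeriv 2 η x) - ∫ x, -f s x * η x) =
        ∫ s in (0 : ℝ)..t, (((2⁻¹ * ∫ x, q s x * deriv η x) - 2⁻¹ * ∫ x, p s x * deriv η x) +
          ∫ x, f s x * η x) := by
      refine intervalIntegral.integral_congr fun s hs => ?_
      rw [uIcc_of_le ht.1] at hs
      have hs' : s ∈ Icc 0 T := ⟨hs.1, hs.2.trans ht.2⟩
      have h2 := hweak s hs' (deriv η) hη' hc.deriv
      rw [esub hη'.continuous hc.deriv s hs'] at h2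
      simp only [neg_mul, integral_neg]
      rw [iteratedDeriv_succ, iteratedDeriv_one, h2]
      ring
    rw [e, intervalIntegral.integral_add ((i3.const_mul _).sub (i2.const_mul _)) i1,
      intervalIntegral.integral_sub (i3.const_mul _) (i2.const_mul _),
      intervalIntegral.integral_const_mul,
      intervalIntegral.integral_const_mul]
    ring
  all_goals
    have hη' : Continuous (deriv η) := hη.continuous_deriv (by simp)
    have i2 := hmono ht (hp.locInt.intervalIntegrable_pairing hη.continuous hc hT)
    have i3 := hmono ht (hq.locInt.intervalIntegrable_pairing hη.continuous hc hT)
    rw [eψ hη hc t ht, ← intervalIntegral.integral_const_mul, ← intervalIntegral.integral_const_mul,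
      ← intervalIntegral.integral_add (i2.const_mul _) (i3.const_mul _)]
    congr 1
    refine intervalIntegral.integral_congr fun s hs => ?_
    rw [uIcc_of_le ht.1] at hs
    have hs' : s ∈ Icc 0 T := ⟨hs.1, hs.2.trans ht.2⟩
    have h2 := hweak s hs' η hη hc
    rw [esub hη.continuous hc s hs'] at h2
    simp only [h2]
    ring

/-- The distributional wave equation implies its characteristic forms. -/
theorem transports_of_wave {T : ℝ} (hT : 0 ≤ T) {ψ ψx v N : ℝ → ℝ → ℝ} {A B C : ℝ}
    (hψ : L2Strip T ψ A) (hψx : L2Strip T ψx B) (hv : L2Strip T v C) (hN : LocIntStrip T N)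
    (hd : ∀ t ∈ Icc 0 T, HasWeakDeriv (ψ t) (ψx t)) (h : IsWeakWave T ψ v N) :
    MildTransport T 1 (fun t x => v t x + ψx t x) (fun t x => -N t x) ∧
      MildTransport T (-1) (fun t x => v t x - ψx t x) (fun t x => -N t x) ∧
      MildTransport T 1 ψ (fun t x => v t x - ψx t x) ∧
      MildTransport T (-1) ψ (fun t x => v t x + ψx t x) ∧ MildTransport T 0 ψ v := by
  have hmono : ∀ {g : ℝ → ℝ} {t : ℝ}, t ∈ Icc 0 T → IntervalIntegrable g volume 0 T →
      IntervalIntegrable g volume 0 t :=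
    fun ht hg => hg.mono_set (by
      rw [uIcc_of_le hT, uIcc_of_le ht.1]; exact Icc_subset_Icc_right ht.2)
  have iv : ∀ {η : ℝ → ℝ}, Continuous η → HasCompactSupport η → ∀ t ∈ Icc 0 T,
      Integrable (fun x => v t x * η x) := fun hη hc t ht =>
    integrable_locallyIntegrable_mul_test (hv.locBdd.loc t ht) hη hc
  have ix : ∀ {η : ℝ → ℝ}, Continuous η → HasCompactSupport η → ∀ t ∈ Icc 0 T,
      Integrable (fun x => ψx t x * η x) := fun hη hc t ht =>
    integrable_locallyIntegrable_mul_test (hψx.locBdd.loc t ht) hη hc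
  have eadd : ∀ (σ : ℝ) {η : ℝ → ℝ}, ContDiff ℝ ∞ η → HasCompactSupport η → ∀ t ∈ Icc 0 T,
      ∫ x, (v t x + σ * ψx t x) * η x = (∫ x, v t x * η x) - σ * ∫ x, ψ t x * deriv η x := by
    intro σ η hη hc t ht
    simp only [add_mul, mul_assoc]
    rw [integral_add (iv hη.continuous hc t ht) ((ix hη.continuous hc t ht).const_mul σ),
      integral_const_mul, hd t ht η hη hc]
    ring
  -- For `σ = ±1`. The term `∂ₓ²ψ` of the wave equation is `σ ∂ₓ (σ ∂ₓψ)`, which is where `σ² = 1`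
  -- enters.
  have w1 : ∀ σ : ℝ, σ * σ = 1 →
      WeakTransport T σ (fun t x => v t x + σ * ψx t x) (fun t x => -N t x) := by
    intro σ hσ η hη hc t ht
    have hη' : ContDiff ℝ ∞ (deriv η) := hη.iterate_deriv 1
    have hη'' : ContDiff ℝ ∞ (deriv (deriv η)) := hη'.iterate_deriv 1
    have i1 := hmono ht (hN.intervalIntegrable_pairing hη.continuous hc hT)
    have i2 := hmono ht (hψ.locInt.intervalIntegrable_pairing hη''.continuous hc.deriv.deriv hT)
    have i3 := hmono ht (hv.locInt.intervalIntegrable_pairing hη'.continuous hc.deriv hT)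
    have h1 := (h η hη hc t ht).2
    rw [iteratedDeriv_succ, iteratedDeriv_one, intervalIntegral.integral_sub i2 i1] at h1
    rw [eadd σ hη hc t ht, eadd σ hη hc 0 ⟨le_rfl, hT⟩, h1, (h _ hη' hc.deriv t ht).1]
    have e : ∫ s in (0 : ℝ)..t, ((∫ x, -N s x * η x) -
          σ * ∫ x, (v s x + σ * ψx s x) * deriv η x) =
        ∫ s in (0 : ℝ)..t, (((∫ x, ψ s x * deriv (deriv η) x) - σ * ∫ x, v s x * deriv η x) -
          ∫ x, N s x * η x) := by
      refine intervalIntegral.integral_congr fun s hs => ?_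
      rw [uIcc_of_le ht.1] at hs
      simp only [neg_mul, integral_neg]
      rw [eadd σ hη' hc.deriv s ⟨hs.1, hs.2.trans ht.2⟩]
      linear_combination (∫ x, ψ s x * deriv (deriv η) x) * hσ
    rw [e, intervalIntegral.integral_sub (i2.sub (i3.const_mul σ)) i1,
      intervalIntegral.integral_sub i2 (i3.const_mul σ), intervalIntegral.integral_const_mul]
    ring
  -- This holds for every speed `σ`; besides `±1`, the value `0` gives the time primitive of `v`.
  have w2 : ∀ σ : ℝ, WeakTransport T σ ψ (fun t x => v t x + -σ * ψx t x) := by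
    intro σ η hη hc t ht
    rw [(h η hη hc t ht).1]
    congr 1
    refine intervalIntegral.integral_congr fun s hs => ?_
    rw [uIcc_of_le ht.1] at hs
    simp only
    rw [eadd (-σ) hη hc s ⟨hs.1, hs.2.trans ht.2⟩]
    ring
  have m1 := fun σ hσ => (w1 σ hσ).mildTransport hT hN.neg
    (hv.locInt.add (hψx.locInt.const_mul σ)) (hv.add (hψx.const_mul σ)).locBdd
  have m2 := fun σ => (w2 σ).mildTransport hT (hv.locInt.add (hψx.locInt.const_mul (-σ)))
    hψ.locInt hψ.locBdd
  have a1 := m1 1 (by norm_num)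
  have a2 := m1 (-1) (by norm_num)
  have a3 := m2 1
  have a4 := m2 (-1)
  have a5 := m2 0
  simp only [one_mul, neg_mul, neg_neg, zero_mul, neg_zero, add_zero, ← sub_eq_add_neg] at a1 a2 a3 a4 a5
  exact ⟨a1, a2, a3, a4, a5⟩

/-! ### Integrals of transported `L²` functions along transverse lines -/

/-- The integral of `h g` along the characteristic of speed `-σ` through `z`, for times up to the
projection of `z.1` to `[0, S]`. -/
noncomputable def charInt (S σ ρ : ℝ) (h : ℝ × ℝ → ℝ) (g : ℝ → ℝ) (z : ℝ × ℝ) : ℝ :=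
  ∫ s in (0 : ℝ)..max 0 (min z.1 S), h (s, z.2 + σ * (z.1 - s)) * g (z.2 + σ * z.1 + ρ * s)

section charInt

variable {S σ ρ H : ℝ} {h h' : ℝ × ℝ → ℝ} {g g' : ℝ → ℝ}

theorem charInt_intervalIntegrable (hh : Continuous h) (hg : MemLp g 2 volume) (hρ : 1 ≤ |ρ|)
    (z : ℝ × ℝ) (a b : ℝ) :
    IntervalIntegrable (fun s => h (s, z.2 + σ * (z.1 - s)) * g (z.2 + σ * z.1 + ρ * s))
      volume a b := by
  have hρ0 : ρ ≠ 0 := by rintro rfl; norm_num at hρ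
  exact (memLp_intervalIntegrable (memLp_comp_affine hg _ hρ0) a b).continuousOn_mul
    (by fun_prop)

/-- Cauchy–Schwarz along a characteristic. -/
theorem integral_abs_affine_le (hg : MemLp g 2 volume) (hρ : 1 ≤ |ρ|) (y : ℝ) {t : ℝ}
    (ht : 0 ≤ t) (htS : t ≤ S) : ∫ s in (0 : ℝ)..t, |g (y + ρ * s)| ≤ √S * l2norm g := by
  have hρ0 : ρ ≠ 0 := by rintro rfl; norm_num at hρ
  refine (integral_abs_le_l2norm (memLp_comp_affine hg y hρ0) ht).trans ?_
  exact mul_le_mul (Real.sqrt_le_sqrt (by linarith)) (l2norm_comp_affine_le hg y hρ)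
    (l2norm_nonneg _) (Real.sqrt_nonneg _)

/-- The bound is uniform in `z` and carries the factor `√S`. This is the only source of smallness
for short times. -/
theorem abs_charInt_le (hS : 0 ≤ S) (hH : ∀ z, |h z| ≤ H) (hg : MemLp g 2 volume)
    (hρ : 1 ≤ |ρ|) (z : ℝ × ℝ) : |charInt S σ ρ h g z| ≤ H * (√S * l2norm g) := by
  have hρ0 : ρ ≠ 0 := by rintro rfl; norm_num at hρ
  have h0 : 0 ≤ max 0 (min z.1 S) := le_max_left _ _
  have h1 : max 0 (min z.1 S) ≤ S := max_le hS (min_le_right _ _)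
  have hH0 : 0 ≤ H := (abs_nonneg _).trans (hH (0, 0))
  have hi := (memLp_intervalIntegrable (memLp_comp_affine hg (z.2 + σ * z.1) hρ0) 0
    (max 0 (min z.1 S))).abs
  rw [charInt, ← Real.norm_eq_abs]
  refine (intervalIntegral.norm_integral_le_of_norm_le h0 (Eventually.of_forall fun s _ => ?_)
    (hi.const_mul H)).trans ?_
  · rw [Real.norm_eq_abs, abs_mul]
    exact mul_le_mul_of_nonneg_right (hH _) (abs_nonneg _)
  · rw [intervalIntegral.integral_const_mul]
    exact mul_le_mul_of_nonneg_left (integral_abs_affine_le hg hρ _ h0 h1) hH0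

theorem charInt_sub_right (hh : Continuous h) (hg : MemLp g 2 volume) (hg' : MemLp g' 2 volume)
    (hρ : 1 ≤ |ρ|) (z : ℝ × ℝ) :
    charInt S σ ρ h g z - charInt S σ ρ h g' z = charInt S σ ρ h (fun x => g x - g' x) z := by
  rw [charInt, charInt, charInt, ← intervalIntegral.integral_sub
    (charInt_intervalIntegrable hh hg hρ z _ _) (charInt_intervalIntegrable hh hg' hρ z _ _)]
  simp only [mul_sub]

theorem charInt_sub_left (hh : Continuous h) (hh' : Continuous h') (hg : MemLp g 2 volume)
    (hρ : 1 ≤ |ρ|) (z : ℝ × ℝ) :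
    charInt S σ ρ h g z - charInt S σ ρ h' g z = charInt S σ ρ (fun z => h z - h' z) g z := by
  rw [charInt, charInt, charInt, ← intervalIntegral.integral_sub
    (charInt_intervalIntegrable hh hg hρ z _ _) (charInt_intervalIntegrable hh' hg hρ z _ _)]
  simp only [sub_mul]

/-- For continuous `g` the integral depends continuously on its parameters. A general `g` is an `L²`
limit of continuous functions of compact support, and by `abs_charInt_le` the integrals converge
uniformly. -/
theorem continuous_charInt (hS : 0 ≤ S) (hh : Continuous h) (hH : ∀ z, |h z| ≤ H)
    (hg : MemLp g 2 volume) (hρ : 1 ≤ |ρ|) : Continuous (charInt S σ ρ h g) := by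
  have hH0 : 0 ≤ H := (abs_nonneg _).trans (hH (0, 0))
  refine continuous_of_uniform_approx_of_continuous fun u hu => ?_
  obtain ⟨ε, hε, hu⟩ := Metric.mem_uniformity_dist.1 hu
  -- The summand `1` keeps the denominator positive when `H * √S = 0`.
  set ε' := ε / (2 * (H * √S + 1)) with hε'
  have hpos : 0 < ε' := by positivity
  obtain ⟨g', hc, hle, hcont, hmem⟩ := hg.exists_hasCompactSupport_eLpNorm_sub_le (by norm_num)
    (ε := ENNReal.ofReal ε') (by simpa using hpos)
  refine ⟨charInt S σ ρ h g', ?_, fun z => hu ?_⟩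
  · unfold charInt
    exact intervalIntegral.continuous_parametric_intervalIntegral_of_continuous
      (f := fun (z : ℝ × ℝ) s => h (s, z.2 + σ * (z.1 - s)) * g' (z.2 + σ * z.1 + ρ * s))
      (by fun_prop) (by fun_prop)
  · have h1 : l2norm (fun x => g x - g' x) ≤ ε' := ENNReal.toReal_le_of_le_ofReal hpos.le hle
    rw [Real.dist_eq, charInt_sub_right hh hg hmem hρ]
    calc _ ≤ H * (√S * l2norm (fun x => g x - g' x)) := abs_charInt_le hS hH (hg.sub hmem) hρ z
      _ ≤ H * (√S * ε') := by gcongr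
      _ ≤ (H * √S + 1) * ε' := by nlinarith
      _ = ε / 2 := by rw [hε']; field_simp
      _ < ε := by linarith

end charInt

/-! ### Characteristic frames and the fixed point argument -/

/-- The first component of the rotation of `(A, B)(x + σ t)` by the angle `a t x`. -/
noncomputable def rot1 (σ : ℝ) (A B : ℝ → ℝ) (a : ℝ → ℝ → ℝ) (t x : ℝ) : ℝ :=
  A (x + σ * t) * Real.cos (a t x) + B (x + σ * t) * Real.sin (a t x)

/-- The second component of the rotation of `(A, B)(x + σ t)` by the angle `a t x`. -/
noncomputable def rot2 (σ : ℝ) (A B : ℝ → ℝ) (a : ℝ → ℝ → ℝ) (t x : ℝ) : ℝ :=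
  B (x + σ * t) * Real.cos (a t x) - A (x + σ * t) * Real.sin (a t x)

/-- The system in characteristic frames: the frame vectors `P`, `Q` are the rotations by `a`, `b`
of the transported initial values `(A, B)`, `(C, D)`. -/
structure IsFrame (K : ℝ → ℝ) (S : ℝ) (A B C D L₀ : ℝ → ℝ) (a b L : ℝ → ℝ → ℝ) : Prop where
  cont_a : Continuous fun z : ℝ × ℝ => a z.1 z.2
  cont_b : Continuous fun z : ℝ × ℝ => b z.1 z.2
  cont_L : Continuous fun z : ℝ × ℝ => L z.1 z.2
  eq_a : ∀ t ∈ Icc 0 S, ∀ u, a t (u - t) =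
    ∫ s in (0 : ℝ)..t, K (L s (u - s)) * rot2 (-1) C D b s (u - s)
  eq_b : ∀ t ∈ Icc 0 S, ∀ u, b t (u + t) =
    ∫ s in (0 : ℝ)..t, K (L s (u + s)) * rot2 1 A B a s (u + s)
  eq_L : ∀ t ∈ Icc 0 S, ∀ x, L t x = L₀ x +
    ∫ s in (0 : ℝ)..t, 2⁻¹ * (rot1 1 A B a s x + rot1 (-1) C D b s x)

/-- The coefficient functions of the system in characteristic frames. -/
theorem coef_diff {K : ℝ → ℝ} {κ : ℝ} (hκ : 1 ≤ κ) (hb : ∀ z, |K z| ≤ κ)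
    (hl : ∀ z z', |K z - K z'| ≤ κ * |z - z'|) {f : ℝ → ℝ} (hf1 : ∀ z, |f z| ≤ 1)
    (hf : ∀ z z', |f z - f z'| ≤ |z - z'|) {δ x x' y y' : ℝ} (hx : |x - x'| ≤ δ)
    (hy : |y - y'| ≤ δ) : |K x * f y - K x' * f y'| ≤ 2 * κ * δ := by
  have e : K x * f y - K x' * f y' = (K x - K x') * f y + K x' * (f y - f y') := by ring
  have hδ : 0 ≤ δ := (abs_nonneg _).trans hx
  rw [e]
  refine (abs_add_le _ _).trans ?_
  rw [abs_mul, abs_mul]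
  have h1 : |K x - K x'| * |f y| ≤ κ * δ * 1 :=
    mul_le_mul ((hl x x').trans (by gcongr)) (hf1 y) (abs_nonneg _) (by positivity)
  have h2 : |K x'| * |f y - f y'| ≤ κ * δ :=
    mul_le_mul (hb x') ((hf y y').trans hy) (abs_nonneg _) (by positivity)
  linarith

theorem abs_sin_sub_sin_le (x y : ℝ) : |Real.sin x - Real.sin y| ≤ |x - y| := by
  simpa using convex_univ.norm_image_sub_le_of_norm_deriv_le (f := Real.sin) (C := 1)
    (fun z _ => Real.differentiableAt_sin) (fun z _ => by simpa using Real.abs_cos_le_one z)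
    (mem_univ y) (mem_univ x)

theorem abs_cos_sub_cos_le (x y : ℝ) : |Real.cos x - Real.cos y| ≤ |x - y| := by
  simpa using convex_univ.norm_image_sub_le_of_norm_deriv_le (f := Real.cos) (C := 1)
    (fun z _ => Real.differentiableAt_cos) (fun z _ => by simpa using Real.abs_sin_le_one z)
    (mem_univ y) (mem_univ x)

/-- Banach's theorem for the triple `(a, b, L)` in the bounded continuous functions on the plane.
The `L²` data enter only as fixed weights in `charInt`; the unknowns enter through bounded Lipschitz
coefficients. Hence the Lipschitz constant is at most `2 κ √S` times the sum of the norms of the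
data, which `hsmall` makes at most `1 / 2`. -/
theorem exists_isFrame {K : ℝ → ℝ} {κ S : ℝ} (hS : 0 ≤ S) (hκ : 1 ≤ κ) (hb : ∀ z, |K z| ≤ κ)
    (hl : ∀ z z', |K z - K z'| ≤ κ * |z - z'|) {A B C D L₀ : ℝ → ℝ} (hA : MemLp A 2 volume)
    (hB : MemLp B 2 volume) (hC : MemLp C 2 volume) (hD : MemLp D 2 volume)
    (hL₀ : Continuous L₀) {ℓ : ℝ} (hℓ : ∀ x, |L₀ x| ≤ ℓ)
    (hsmall : 2 * κ * (√S * (l2norm A + l2norm B + l2norm C + l2norm D)) ≤ 1 / 2) :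
    ∃ a b L : ℝ → ℝ → ℝ, IsFrame K S A B C D L₀ a b L := by
  have hKc : Continuous K := by
    refine (LipschitzWith.of_dist_le_mul (K := κ.toNNReal) fun x y => ?_).continuous
    rw [Real.dist_eq, Real.dist_eq, Real.coe_toNNReal _ (by linarith)]
    exact hl x y
  have one_le_one : (1 : ℝ) ≤ |1| := by simp
  have one_le_neg : (1 : ℝ) ≤ |(-1)| := by simp
  have one_le_two : (1 : ℝ) ≤ |2| := by norm_num
  have one_le_neg2 : (1 : ℝ) ≤ |(-2)| := by norm_num
  have kf : ∀ {f : ℝ → ℝ}, (∀ z, |f z| ≤ 1) → ∀ x y, |K x * f y| ≤ κ := fun hf x y => by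
    rw [abs_mul]
    exact (mul_le_mul (hb x) (hf y) (abs_nonneg _) (by linarith)).trans_eq (mul_one _)
  let X := BoundedContinuousFunction (ℝ × ℝ) (ℝ × ℝ × ℝ)
  -- On the characteristic `x + t = u` the data of `Q` are evaluated at `u - 2 s`, hence the slope
  -- `-2`. On the other family the slope is `2`, and on vertical lines it is `±1`.
  let Fa : X → ℝ × ℝ → ℝ := fun w z =>
    charInt S 1 (-2) (fun z => K (w z).2.2 * Real.cos (w z).2.1) D z -
      charInt S 1 (-2) (fun z => K (w z).2.2 * Real.sin (w z).2.1) C z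
  let Fb : X → ℝ × ℝ → ℝ := fun w z =>
    charInt S (-1) 2 (fun z => K (w z).2.2 * Real.cos (w z).1) B z -
      charInt S (-1) 2 (fun z => K (w z).2.2 * Real.sin (w z).1) A z
  let FL : X → ℝ × ℝ → ℝ := fun w z => L₀ z.2 + 2⁻¹ * (
    (charInt S 0 1 (fun z => Real.cos (w z).1) A z + charInt S 0 1 (fun z => Real.sin (w z).1) B z) +
    (charInt S 0 (-1) (fun z => Real.cos (w z).2.1) C z +
      charInt S 0 (-1) (fun z => Real.sin (w z).2.1) D z))
  have hw : ∀ w : X, Continuous w := fun w => w.continuous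
  have c1 : ∀ w : X, Continuous fun z => K (w z).2.2 * Real.cos (w z).2.1 := fun w => by
    have := hw w; fun_prop
  have c2 : ∀ w : X, Continuous fun z => K (w z).2.2 * Real.sin (w z).2.1 := fun w => by
    have := hw w; fun_prop
  have c3 : ∀ w : X, Continuous fun z => K (w z).2.2 * Real.cos (w z).1 := fun w => by
    have := hw w; fun_prop
  have c4 : ∀ w : X, Continuous fun z => K (w z).2.2 * Real.sin (w z).1 := fun w => by
    have := hw w; fun_prop
  have c5 : ∀ w : X, Continuous fun z => Real.cos (w z).1 := fun w => by have := hw w; fun_prop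
  have c6 : ∀ w : X, Continuous fun z => Real.sin (w z).1 := fun w => by have := hw w; fun_prop
  have c7 : ∀ w : X, Continuous fun z => Real.cos (w z).2.1 := fun w => by have := hw w; fun_prop
  have c8 : ∀ w : X, Continuous fun z => Real.sin (w z).2.1 := fun w => by have := hw w; fun_prop
  have hFac : ∀ w, Continuous (Fa w) := fun w =>
    (continuous_charInt hS (c1 w) (fun z => kf Real.abs_cos_le_one _ _) hD one_le_neg2).sub
      (continuous_charInt hS (c2 w) (fun z => kf Real.abs_sin_le_one _ _) hC one_le_neg2)
  have hFbc : ∀ w, Continuous (Fb w) := fun w =>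
    (continuous_charInt hS (c3 w) (fun z => kf Real.abs_cos_le_one _ _) hB one_le_two).sub
      (continuous_charInt hS (c4 w) (fun z => kf Real.abs_sin_le_one _ _) hA one_le_two)
  have hFLc : ∀ w, Continuous (FL w) := fun w =>
    (hL₀.comp continuous_snd).add (continuous_const.mul
      (((continuous_charInt hS (c5 w) (fun z => Real.abs_cos_le_one _) hA one_le_one).add
        (continuous_charInt hS (c6 w) (fun z => Real.abs_sin_le_one _) hB one_le_one)).add
      ((continuous_charInt hS (c7 w) (fun z => Real.abs_cos_le_one _) hC one_le_neg).add
        (continuous_charInt hS (c8 w) (fun z => Real.abs_sin_le_one _) hD one_le_neg))))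
  have nA := l2norm_nonneg A
  have nB := l2norm_nonneg B
  have nC := l2norm_nonneg C
  have nD := l2norm_nonneg D
  have nS := Real.sqrt_nonneg S
  set n := √S * (l2norm A + l2norm B + l2norm C + l2norm D) with hn
  have hn' : n = √S * l2norm A + √S * l2norm B + √S * l2norm C + √S * l2norm D := by
    rw [hn]; ring
  have pA : 0 ≤ √S * l2norm A := by positivity
  have pB : 0 ≤ √S * l2norm B := by positivity
  have pC : 0 ≤ √S * l2norm C := by positivity
  have pD : 0 ≤ √S * l2norm D := by positivity
  have hn0 : 0 ≤ n := by linarith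
  have hℓ0 : 0 ≤ ℓ := (abs_nonneg _).trans (hℓ 0)
  have bd2 : ∀ {x y p q c : ℝ}, |x| ≤ c * p → |y| ≤ c * q → |x - y| ≤ c * (p + q) :=
    fun hx hy => (abs_sub _ _).trans (by linarith)
  have hFab : ∀ w z, ‖Fa w z‖ ≤ κ * n + ℓ := fun w z => by
    refine (bd2 (abs_charInt_le hS (fun z => kf Real.abs_cos_le_one _ _) hD one_le_neg2 z)
      (abs_charInt_le hS (fun z => kf Real.abs_sin_le_one _ _) hC one_le_neg2 z)).trans ?_
    nlinarith
  have hFbb : ∀ w z, ‖Fb w z‖ ≤ κ * n + ℓ := fun w z => by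
    refine (bd2 (abs_charInt_le hS (fun z => kf Real.abs_cos_le_one _ _) hB one_le_two z)
      (abs_charInt_le hS (fun z => kf Real.abs_sin_le_one _ _) hA one_le_two z)).trans ?_
    nlinarith
  have hFLb : ∀ w z, ‖FL w z‖ ≤ κ * n + ℓ := fun w z => by
    have b1 := abs_le.1 (abs_charInt_le (σ := 0) hS (fun z => Real.abs_cos_le_one (w z).1) hA one_le_one z)
    have b2 := abs_le.1 (abs_charInt_le (σ := 0) hS (fun z => Real.abs_sin_le_one (w z).1) hB one_le_one z)
    have b3 := abs_le.1 (abs_charInt_le (σ := 0) hS (fun z => Real.abs_cos_le_one (w z).2.1) hC one_le_neg z)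
    have b4 := abs_le.1 (abs_charInt_le (σ := 0) hS (fun z => Real.abs_sin_le_one (w z).2.1) hD one_le_neg z)
    have b5 := abs_le.1 (hℓ z.2)
    have hκn : n ≤ κ * n := by nlinarith
    rw [Real.norm_eq_abs, abs_le]
    simp only [FL]
    constructor <;> linarith [b1.1, b1.2, b2.1, b2.2, b3.1, b3.2, b4.1, b4.2, b5.1, b5.2]
  let Φ : X → X := fun w => BoundedContinuousFunction.ofNormedAddCommGroup
    (fun z => (Fa w z, Fb w z, FL w z)) ((hFac w).prodMk ((hFbc w).prodMk (hFLc w)))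
    (κ * n + ℓ) (fun z => by
      simp only [Prod.norm_def]
      exact max_le (hFab w z) (max_le (hFbb w z) (hFLb w z)))
  have hΦ : ∀ w w' : X, dist (Φ w) (Φ w') ≤ 2⁻¹ * dist w w' := by
    intro w w'
    set δ := dist w w' with hδ
    have hδ0 : 0 ≤ δ := dist_nonneg
    have d0 : ∀ z, dist (w z) (w' z) ≤ δ := fun z => BoundedContinuousFunction.dist_coe_le_dist z
    have d1 : ∀ z, |(w z).1 - (w' z).1| ≤ δ := fun z => (le_max_left _ _).trans (d0 z)
    have d2 : ∀ z, |(w z).2.1 - (w' z).2.1| ≤ δ := fun z =>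
      ((le_max_left _ _).trans (le_max_right _ _)).trans (d0 z)
    have d3 : ∀ z, |(w z).2.2 - (w' z).2.2| ≤ δ := fun z =>
      ((le_max_right _ _).trans (le_max_right _ _)).trans (d0 z)
    have ec := fun {x x' y y' : ℝ} => coef_diff hκ hb hl Real.abs_cos_le_one abs_cos_sub_cos_le
      (δ := δ) (x := x) (x' := x') (y := y) (y' := y')
    have es := fun {x x' y y' : ℝ} => coef_diff hκ hb hl Real.abs_sin_le_one abs_sin_sub_sin_le
      (δ := δ) (x := x) (x' := x') (y := y) (y' := y')
    have hfin : 2 * κ * δ * n ≤ 2⁻¹ * δ := by nlinarith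
    rw [BoundedContinuousFunction.dist_le (by positivity)]
    intro z
    refine max_le ?_ (max_le ?_ ?_)
    · change |Fa w z - Fa w' z| ≤ _
      have e : Fa w z - Fa w' z =
          (charInt S 1 (-2) (fun z => K (w z).2.2 * Real.cos (w z).2.1) D z -
            charInt S 1 (-2) (fun z => K (w' z).2.2 * Real.cos (w' z).2.1) D z) -
          (charInt S 1 (-2) (fun z => K (w z).2.2 * Real.sin (w z).2.1) C z -
            charInt S 1 (-2) (fun z => K (w' z).2.2 * Real.sin (w' z).2.1) C z) := by
        simp only [Fa]; ring
      rw [e, charInt_sub_left (c1 w) (c1 w') hD one_le_neg2,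
        charInt_sub_left (c2 w) (c2 w') hC one_le_neg2]
      refine (bd2 (abs_charInt_le hS (fun z => ec (d3 z) (d2 z)) hD one_le_neg2 z)
        (abs_charInt_le hS (fun z => es (d3 z) (d2 z)) hC one_le_neg2 z)).trans ?_
      refine (mul_le_mul_of_nonneg_left ?_ (by positivity)).trans hfin
      linarith
    · change |Fb w z - Fb w' z| ≤ _
      have e : Fb w z - Fb w' z =
          (charInt S (-1) 2 (fun z => K (w z).2.2 * Real.cos (w z).1) B z -
            charInt S (-1) 2 (fun z => K (w' z).2.2 * Real.cos (w' z).1) B z) -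
          (charInt S (-1) 2 (fun z => K (w z).2.2 * Real.sin (w z).1) A z -
            charInt S (-1) 2 (fun z => K (w' z).2.2 * Real.sin (w' z).1) A z) := by
        simp only [Fb]; ring
      rw [e, charInt_sub_left (c3 w) (c3 w') hB one_le_two,
        charInt_sub_left (c4 w) (c4 w') hA one_le_two]
      refine (bd2 (abs_charInt_le hS (fun z => ec (d3 z) (d1 z)) hB one_le_two z)
        (abs_charInt_le hS (fun z => es (d3 z) (d1 z)) hA one_le_two z)).trans ?_
      refine (mul_le_mul_of_nonneg_left ?_ (by positivity)).trans hfin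
      linarith
    · change |FL w z - FL w' z| ≤ _
      have b1 := abs_le.1 (abs_charInt_le (σ := 0) hS
        (fun z => (abs_cos_sub_cos_le (w z).1 (w' z).1).trans (d1 z)) hA one_le_one z)
      have b2 := abs_le.1 (abs_charInt_le (σ := 0) hS
        (fun z => (abs_sin_sub_sin_le (w z).1 (w' z).1).trans (d1 z)) hB one_le_one z)
      have b3 := abs_le.1 (abs_charInt_le (σ := 0) hS
        (fun z => (abs_cos_sub_cos_le (w z).2.1 (w' z).2.1).trans (d2 z)) hC one_le_neg z)
      have b4 := abs_le.1 (abs_charInt_le (σ := 0) hS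
        (fun z => (abs_sin_sub_sin_le (w z).2.1 (w' z).2.1).trans (d2 z)) hD one_le_neg z)
      rw [← charInt_sub_left (c5 w) (c5 w') hA one_le_one] at b1
      rw [← charInt_sub_left (c6 w) (c6 w') hB one_le_one] at b2
      rw [← charInt_sub_left (c7 w) (c7 w') hC one_le_neg] at b3
      rw [← charInt_sub_left (c8 w) (c8 w') hD one_le_neg] at b4
      have hdn : δ * n ≤ 2 * κ * δ * n := by nlinarith [mul_nonneg hδ0 hn0]
      have hs : δ * n = δ * (√S * l2norm A) + δ * (√S * l2norm B) + δ * (√S * l2norm C) +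
        δ * (√S * l2norm D) := by rw [hn']; ring
      have hdn0 : 0 ≤ δ * n := mul_nonneg hδ0 hn0
      rw [abs_le]
      simp only [FL]
      constructor <;> linarith [b1.1, b1.2, b2.1, b2.2, b3.1, b3.2, b4.1, b4.2]
  have hcw : ContractingWith (2⁻¹ : NNReal) Φ :=
    ⟨by norm_num, LipschitzWith.of_dist_le_mul fun w w' => by simpa using hΦ w w'⟩
  obtain ⟨w, hfix⟩ : ∃ w, Φ w = w := ⟨_, hcw.fixedPoint_isFixedPt⟩
  have fa : ∀ z, (w z).1 = Fa w z := fun z => by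
    conv_lhs => rw [← hfix]
    rfl
  have fb : ∀ z, (w z).2.1 = Fb w z := fun z => by
    conv_lhs => rw [← hfix]
    rfl
  have fL : ∀ z, (w z).2.2 = FL w z := fun z => by
    conv_lhs => rw [← hfix]
    rfl
  have hw' := hw w
  -- The clamp of the time variable only serves to define the map on the whole plane; it does
  -- nothing on `[0, S]`.
  have hcl : ∀ t ∈ Icc 0 S, max 0 (min t S) = t := fun t ht => by
    rw [min_eq_left ht.2, max_eq_right ht.1]
  refine ⟨fun t x => (w (t, x)).1, fun t x => (w (t, x)).2.1, fun t x => (w (t, x)).2.2,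
    by fun_prop, by fun_prop, by fun_prop, fun t ht u => ?_, fun t ht u => ?_, fun t ht x => ?_⟩
  · simp only [fa (t, u - t), Fa, charInt]
    rw [← intervalIntegral.integral_sub
      (charInt_intervalIntegrable (c1 w) hD one_le_neg2 (t, u - t) _ _)
      (charInt_intervalIntegrable (c2 w) hC one_le_neg2 (t, u - t) _ _), hcl t ht]
    refine intervalIntegral.integral_congr fun s _ => ?_
    have e1 : u - t + 1 * (t - s) = u - s := by ring
    have e2 : u - t + 1 * t + -2 * s = u - s + -1 * s := by ring
    simp only [e1, e2, rot2]
    ring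
  · simp only [fb (t, u + t), Fb, charInt]
    rw [← intervalIntegral.integral_sub
      (charInt_intervalIntegrable (c3 w) hB one_le_two (t, u + t) _ _)
      (charInt_intervalIntegrable (c4 w) hA one_le_two (t, u + t) _ _), hcl t ht]
    refine intervalIntegral.integral_congr fun s _ => ?_
    have e1 : u + t + -1 * (t - s) = u + s := by ring
    have e2 : u + t + -1 * t + 2 * s = u + s + 1 * s := by ring
    simp only [e1, e2, rot2]
    ring
  · have i1 := charInt_intervalIntegrable (σ := 0) (c5 w) hA one_le_one (t, x) 0 t
    have i2 := charInt_intervalIntegrable (σ := 0) (c6 w) hB one_le_one (t, x) 0 t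
    have i3 := charInt_intervalIntegrable (σ := 0) (c7 w) hC one_le_neg (t, x) 0 t
    have i4 := charInt_intervalIntegrable (σ := 0) (c8 w) hD one_le_neg (t, x) 0 t
    simp only [fL (t, x), FL, charInt, hcl t ht]
    rw [← intervalIntegral.integral_add i1 i2, ← intervalIntegral.integral_add i3 i4,
      ← intervalIntegral.integral_add (i1.add i2) (i3.add i4),
      ← intervalIntegral.integral_const_mul]
    congr 1
    refine intervalIntegral.integral_congr fun s _ => ?_
    simp only [rot1, zero_mul, add_zero]
    ring

/-- Translation invariance of the `L²` norm makes the norm of a transported majorant independent of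
time. -/
theorem L2Strip.of_bound {T σ c : ℝ} {w : ℝ → ℝ → ℝ} {A B : ℝ → ℝ} (hA : MemLp A 2 volume)
    (hB : MemLp B 2 volume) (hm : Measurable fun z : ℝ × ℝ => w z.1 z.2)
    (hw : ∀ t ∈ Icc 0 T, ∀ x, |w t x| ≤ c * (|A (x + σ * t)| + |B (x + σ * t)|)) :
    L2Strip T w (|c| * (l2norm A + l2norm B)) := by
  have mA : ∀ t, MemLp (fun x => A (x + σ * t)) 2 volume := fun t => memLp_comp_add hA _
  have mB : ∀ t, MemLp (fun x => B (x + σ * t)) 2 volume := fun t => memLp_comp_add hB _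
  have mG : ∀ t, MemLp (fun x => c * (|A (x + σ * t)| + |B (x + σ * t)|)) 2 volume := fun t =>
    ((mA t).abs.add (mB t).abs).const_mul c
  have hle : ∀ t ∈ Icc 0 T, ∀ x, |w t x| ≤ |c * (|A (x + σ * t)| + |B (x + σ * t)|)| :=
    fun t ht x => (hw t ht x).trans (le_abs_self _)
  refine ⟨hm.aestronglyMeasurable, fun t ht => ?_, fun t ht => ?_⟩
  · exact (mG t).of_le (hm.comp measurable_prodMk_left).aestronglyMeasurable
      (Eventually.of_forall (hle t ht))
  · refine (l2norm_mono (mG t) (Eventually.of_forall (hle t ht))).trans ?_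
    rw [l2norm_const_mul]
    refine mul_le_mul_of_nonneg_left ?_ (abs_nonneg _)
    refine (l2norm_add_le (mA t).abs (mB t).abs).trans (le_of_eq ?_)
    have e : ∀ f : ℝ → ℝ, l2norm |f| = l2norm f := fun f => by
      rw [l2norm, l2norm]; congr 1; exact eLpNorm_norm f
    rw [e, e, l2norm_comp_add A hA.1, l2norm_comp_add B hB.1]

theorem L2Strip.memLp_strip {T M : ℝ} {w : ℝ → ℝ → ℝ} (hw : L2Strip T w M) :
    MemLp (fun z : ℝ × ℝ => w z.1 z.2) 2 (stripMeasure T) :=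
  (memLp_two_iff_integrable_sq hw.meas).2 hw.integrable_sq

theorem L2Strip.integrable_mul {T M N : ℝ} {w v : ℝ → ℝ → ℝ} (hw : L2Strip T w M)
    (hv : L2Strip T v N) : Integrable (fun z : ℝ × ℝ => w z.1 z.2 * v z.1 z.2) (stripMeasure T) :=
  hw.memLp_strip.integrable_mul (p := 2) (q := 2) hv.memLp_strip

theorem LocIntStrip.of_integrable {T : ℝ} {f : ℝ → ℝ → ℝ}
    (hf : Integrable (fun z : ℝ × ℝ => f z.1 z.2) (stripMeasure T)) : LocIntStrip T f := by
  intro R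
  rw [stripMeasure_eq] at hf
  exact IntegrableOn.mono_set hf (prod_mono subset_rfl (subset_univ _))

theorem LocIntStrip.bdd_mul {T c : ℝ} {f k : ℝ → ℝ → ℝ} (hf : LocIntStrip T f)
    (hk : Continuous fun z : ℝ × ℝ => k z.1 z.2) (hc : ∀ t x, |k t x| ≤ c) :
    LocIntStrip T (fun t x => k t x * f t x) := fun R =>
  (hf R).bdd_mul (c := c) hk.aestronglyMeasurable (Eventually.of_forall fun _ => hc _ _)

theorem L2Strip.primitive {T M : ℝ} {w : ℝ → ℝ → ℝ} (hw : L2Strip T w M) {ψ₀ : ℝ → ℝ}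
    (h₀ : MemLp ψ₀ 2 volume) (hT : 0 ≤ T) :
    L2Strip T (fun t x => ψ₀ x + ∫ s in (0 : ℝ)..t, w s x) (l2norm ψ₀ + T * M) := by
  have hM : 0 ≤ M := (l2norm_nonneg _).trans (hw.le 0 ⟨le_rfl, hT⟩)
  refine ⟨?_, fun t ht => h₀.add (hw.timeIntegral le_rfl ht.1 ht.2).1, fun t ht => ?_⟩
  · exact h₀.1.comp_snd.add (aestronglyMeasurable_primitive hw.meas)
  · refine (l2norm_add_le h₀ (hw.timeIntegral le_rfl ht.1 ht.2).1).trans (add_le_add le_rfl ?_)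
    refine (hw.timeIntegral le_rfl ht.1 ht.2).2.trans (mul_le_mul_of_nonneg_right ?_ hM)
    linarith [ht.2]

section rot

variable {T σ : ℝ} {A B : ℝ → ℝ} {a : ℝ → ℝ → ℝ}

theorem abs_rot1_le (t x : ℝ) : |rot1 σ A B a t x| ≤ |A (x + σ * t)| + |B (x + σ * t)| := by
  refine (abs_add_le _ _).trans ?_
  rw [abs_mul, abs_mul]
  exact add_le_add (mul_le_of_le_one_right (abs_nonneg _) (Real.abs_cos_le_one _))
    (mul_le_of_le_one_right (abs_nonneg _) (Real.abs_sin_le_one _))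

theorem abs_rot2_le (t x : ℝ) : |rot2 σ A B a t x| ≤ |A (x + σ * t)| + |B (x + σ * t)| := by
  refine (abs_sub _ _).trans ?_
  rw [abs_mul, abs_mul, add_comm]
  exact add_le_add (mul_le_of_le_one_right (abs_nonneg _) (Real.abs_sin_le_one _))
    (mul_le_of_le_one_right (abs_nonneg _) (Real.abs_cos_le_one _))

theorem measurable_rot1 (hA : Measurable A) (hB : Measurable B)
    (ha : Continuous fun z : ℝ × ℝ => a z.1 z.2) :
    Measurable fun z : ℝ × ℝ => rot1 σ A B a z.1 z.2 := by
  have := ha.measurable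
  unfold rot1
  fun_prop

theorem measurable_rot2 (hA : Measurable A) (hB : Measurable B)
    (ha : Continuous fun z : ℝ × ℝ => a z.1 z.2) :
    Measurable fun z : ℝ × ℝ => rot2 σ A B a z.1 z.2 := by
  have := ha.measurable
  unfold rot2
  fun_prop

/-- The condition `σ - τ ≠ 0` is transversality: the `L²` data are sampled at a nonconstant affine
function of time, so integrability holds on every line and not just on almost every one. -/
theorem intervalIntegrable_rot (hA : MemLp A 2 volume) (hB : MemLp B 2 volume)
    (ha : Continuous fun z : ℝ × ℝ => a z.1 z.2) (τ : ℝ) (hτ : σ - τ ≠ 0) (u p q : ℝ) :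
    IntervalIntegrable (fun s => rot1 σ A B a s (u - τ * s)) volume p q ∧
      IntervalIntegrable (fun s => rot2 σ A B a s (u - τ * s)) volume p q := by
  have iA := memLp_intervalIntegrable (memLp_comp_affine hA u hτ) p q
  have iB := memLp_intervalIntegrable (memLp_comp_affine hB u hτ) p q
  have e : ∀ s, u - τ * s + σ * s = u + (σ - τ) * s := fun s => by ring
  have c1 : Continuous fun s => Real.cos (a s (u - τ * s)) :=
    Real.continuous_cos.comp (ha.comp (f := fun s => (s, u - τ * s)) (by fun_prop))
  have c2 : Continuous fun s => Real.sin (a s (u - τ * s)) :=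
    Real.continuous_sin.comp (ha.comp (f := fun s => (s, u - τ * s)) (by fun_prop))
  constructor
  · simp only [rot1, e]
    exact (iA.mul_continuousOn c1.continuousOn).add (iB.mul_continuousOn c2.continuousOn)
  · simp only [rot2, e]
    exact (iB.mul_continuousOn c1.continuousOn).sub (iA.mul_continuousOn c2.continuousOn)

end rot

theorem continuous_slice {a : ℝ → ℝ → ℝ} (ha : Continuous fun z : ℝ × ℝ => a z.1 z.2)
    (u τ : ℝ) : Continuous fun s => a s (u - τ * s) :=
  ha.comp (f := fun s => (s, u - τ * s)) (by fun_prop)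

namespace IsFrame

variable {K : ℝ → ℝ} {T : ℝ} {A B C D L₀ : ℝ → ℝ} {a b L : ℝ → ℝ → ℝ}

theorem isPrim_a (h : IsFrame K T A B C D L₀ a b L) (hT : 0 ≤ T) (hK : Continuous K)
    (hC : MemLp C 2 volume) (hD : MemLp D 2 volume) (u : ℝ) :
    IsPrim T (fun s => a s (u - s)) (fun s => K (L s (u - s)) * rot2 (-1) C D b s (u - s)) := by
  have h1 := (intervalIntegrable_rot (σ := -1) hC hD h.cont_b 1 (by norm_num) u 0 T).2
  have h2 := continuous_slice h.cont_L u 1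
  simp only [one_mul] at h1 h2
  refine ⟨h1.continuousOn_mul (hK.comp h2).continuousOn, fun t ht => ?_⟩
  have h0 := h.eq_a 0 ⟨le_rfl, hT⟩ u
  simp only [intervalIntegral.integral_same] at h0
  rw [h.eq_a t ht u, h0, zero_add]

theorem isPrim_b (h : IsFrame K T A B C D L₀ a b L) (hT : 0 ≤ T) (hK : Continuous K)
    (hA : MemLp A 2 volume) (hB : MemLp B 2 volume) (u : ℝ) :
    IsPrim T (fun s => b s (u + s)) (fun s => K (L s (u + s)) * rot2 1 A B a s (u + s)) := by
  have h1 := (intervalIntegrable_rot (σ := 1) hA hB h.cont_a (-1) (by norm_num) u 0 T).2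
  have h2 := continuous_slice h.cont_L u (-1)
  simp only [neg_mul, one_mul, sub_neg_eq_add] at h1 h2
  refine ⟨h1.continuousOn_mul (hK.comp h2).continuousOn, fun t ht => ?_⟩
  have h0 := h.eq_b 0 ⟨le_rfl, hT⟩ u
  simp only [intervalIntegral.integral_same] at h0
  rw [h.eq_b t ht u, h0, zero_add]

theorem a_zero (h : IsFrame K T A B C D L₀ a b L) (hT : 0 ≤ T) (x : ℝ) : a 0 x = 0 := by
  simpa using h.eq_a 0 ⟨le_rfl, hT⟩ x

theorem b_zero (h : IsFrame K T A B C D L₀ a b L) (hT : 0 ≤ T) (x : ℝ) : b 0 x = 0 := by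
  simpa using h.eq_b 0 ⟨le_rfl, hT⟩ x

theorem L_zero (h : IsFrame K T A B C D L₀ a b L) (hT : 0 ≤ T) (x : ℝ) : L 0 x = L₀ x := by
  simpa using h.eq_L 0 ⟨le_rfl, hT⟩ x

theorem isPrim_P (h : IsFrame K T A B C D L₀ a b L) (hT : 0 ≤ T) (hK : Continuous K)
    (hC : MemLp C 2 volume) (hD : MemLp D 2 volume) (u : ℝ) :
    IsPrim T (fun s => rot1 1 A B a s (u - s))
        (fun s => K (L s (u - s)) * rot2 (-1) C D b s (u - s) * rot2 1 A B a s (u - s)) ∧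
      IsPrim T (fun s => rot2 1 A B a s (u - s))
        (fun s => -(K (L s (u - s)) * rot2 (-1) C D b s (u - s) * rot1 1 A B a s (u - s))) := by
  have := isPrim_rotation hT (h.isPrim_a hT hK hC hD u) (A u) (B u)
  have e : ∀ s, u - s + 1 * s = u := fun s => by ring
  have e1 : ∀ s, rot1 1 A B a s (u - s) =
      A u * Real.cos (a s (u - s)) + B u * Real.sin (a s (u - s)) := fun s => by rw [rot1, e]
  have e2 : ∀ s, rot2 1 A B a s (u - s) =
      B u * Real.cos (a s (u - s)) - A u * Real.sin (a s (u - s)) := fun s => by rw [rot2, e]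
  simp only [e1, e2]
  exact this

theorem isPrim_Q (h : IsFrame K T A B C D L₀ a b L) (hT : 0 ≤ T) (hK : Continuous K)
    (hA : MemLp A 2 volume) (hB : MemLp B 2 volume) (u : ℝ) :
    IsPrim T (fun s => rot1 (-1) C D b s (u + s))
        (fun s => K (L s (u + s)) * rot2 1 A B a s (u + s) * rot2 (-1) C D b s (u + s)) ∧
      IsPrim T (fun s => rot2 (-1) C D b s (u + s))
        (fun s => -(K (L s (u + s)) * rot2 1 A B a s (u + s) * rot1 (-1) C D b s (u + s))) := by
  have := isPrim_rotation hT (h.isPrim_b hT hK hA hB u) (C u) (D u)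
  have e : ∀ s, u + s + -1 * s = u := fun s => by ring
  have e1 : ∀ s, rot1 (-1) C D b s (u + s) =
      C u * Real.cos (b s (u + s)) + D u * Real.sin (b s (u + s)) := fun s => by rw [rot1, e]
  have e2 : ∀ s, rot2 (-1) C D b s (u + s) =
      D u * Real.cos (b s (u + s)) - C u * Real.sin (b s (u + s)) := fun s => by rw [rot2, e]
  simp only [e1, e2]
  exact this

end IsFrame

/-- Serves to upgrade identities known for almost every `u` to every `u`. -/
theorem continuous_integral_rot1 {σ τ T : ℝ} {C D : ℝ → ℝ} {b : ℝ → ℝ → ℝ} (hC : MemLp C 2 volume)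
    (hD : MemLp D 2 volume) (hb : Continuous fun z : ℝ × ℝ => b z.1 z.2) (hτ : 1 ≤ |σ - τ|)
    {t : ℝ} (ht : t ∈ Icc 0 T) :
    Continuous fun u => ∫ s in (0 : ℝ)..t, rot1 σ C D b s (u - τ * s) := by
  have hT : 0 ≤ T := ht.1.trans ht.2
  have c1 : Continuous fun z : ℝ × ℝ => Real.cos (b z.1 z.2) := Real.continuous_cos.comp hb
  have c2 : Continuous fun z : ℝ × ℝ => Real.sin (b z.1 z.2) := Real.continuous_sin.comp hb
  have h1 := continuous_charInt (σ := τ) hT c1 (fun z => Real.abs_cos_le_one _) hC hτ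
  have h2 := continuous_charInt (σ := τ) hT c2 (fun z => Real.abs_sin_le_one _) hD hτ
  have h3 : Continuous fun u : ℝ => ((t, u - τ * t) : ℝ × ℝ) := by fun_prop
  refine ((h1.add h2).comp h3).congr fun u => ?_
  have hcl : max 0 (min t T) = t := by rw [min_eq_left ht.2, max_eq_right ht.1]
  simp only [Function.comp, Pi.add_apply, charInt, hcl]
  have i1 := charInt_intervalIntegrable (σ := τ) c1 hC hτ (t, u - τ * t) 0 t
  have i2 := charInt_intervalIntegrable (σ := τ) c2 hD hτ (t, u - τ * t) 0 t
  rw [← intervalIntegral.integral_add i1 i2]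
  refine intervalIntegral.integral_congr fun s _ => ?_
  have e1 : u - τ * t + τ * (t - s) = u - τ * s := by ring
  have e2 : u - τ * t + τ * t + (σ - τ) * s = u - τ * s + σ * s := by ring
  simp only [e1, e2, rot1]
  ring

/-! ### From a frame to solutions of the two wave equations -/

namespace IsFrame

variable {K : ℝ → ℝ} {T κ : ℝ} {A B C D L₀ : ℝ → ℝ} {a b L : ℝ → ℝ → ℝ}

/-- The first components of both rotated vectors satisfy transport equations with the same source
`K(L) P₂ Q₂`, and `L` is the time primitive of half their sum, so `wave_of_transports` applies. The
derivatives of `L` along the two null directions are then `P₁` and `Q₁`, on every characteristic by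
continuity; they are needed to differentiate `sinh (lam + L)` there. -/
theorem Lam_field (h : IsFrame K T A B C D L₀ a b L) (hT : 0 ≤ T) (hK : Continuous K)
    (hKb : ∀ z, |K z| ≤ κ) (mA : Measurable A) (mB : Measurable B) (mC : Measurable C)
    (mD : Measurable D) (hA : MemLp A 2 volume) (hB : MemLp B 2 volume) (hC : MemLp C 2 volume)
    (hD : MemLp D 2 volume) (hL₀ : MemLp L₀ 2 volume)
    (hd : HasWeakDeriv L₀ fun x => 2⁻¹ * (A x - C x)) :
    (∃ M, L2Strip T L M) ∧
    (∀ t ∈ Icc 0 T, HasWeakDeriv (L t) fun x => 2⁻¹ * (rot1 1 A B a t x - rot1 (-1) C D b t x)) ∧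
    IsWeakWave T L (fun t x => 2⁻¹ * (rot1 1 A B a t x + rot1 (-1) C D b t x))
      (fun t x => -(K (L t x) * (rot2 1 A B a t x * rot2 (-1) C D b t x))) ∧
    LocIntStrip T (fun t x => K (L t x) * (rot2 1 A B a t x * rot2 (-1) C D b t x)) ∧
    (∀ u, IsPrim T (fun t => L t (u - t)) (fun s => rot1 (-1) C D b s (u - s))) ∧
    (∀ u, IsPrim T (fun t => L t (u + t)) (fun s => rot1 1 A B a s (u + s))) := by
  have sP1 : L2Strip T (rot1 1 A B a) _ := L2Strip.of_bound (c := 1) hA hB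
    (measurable_rot1 mA mB h.cont_a) (fun t _ x => (abs_rot1_le t x).trans_eq (one_mul _).symm)
  have sP2 : L2Strip T (rot2 1 A B a) _ := L2Strip.of_bound (c := 1) hA hB
    (measurable_rot2 mA mB h.cont_a) (fun t _ x => (abs_rot2_le t x).trans_eq (one_mul _).symm)
  have sQ1 : L2Strip T (rot1 (-1) C D b) _ := L2Strip.of_bound (c := 1) hC hD
    (measurable_rot1 mC mD h.cont_b) (fun t _ x => (abs_rot1_le t x).trans_eq (one_mul _).symm)
  have sQ2 : L2Strip T (rot2 (-1) C D b) _ := L2Strip.of_bound (c := 1) hC hD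
    (measurable_rot2 mC mD h.cont_b) (fun t _ x => (abs_rot2_le t x).trans_eq (one_mul _).symm)
  have hf : LocIntStrip T (fun t x => K (L t x) * (rot2 1 A B a t x * rot2 (-1) C D b t x)) :=
    (LocIntStrip.of_integrable (sP2.integrable_mul sQ2)).bdd_mul
      (k := fun t x => K (L t x)) (hK.comp h.cont_L) (fun _ _ => hKb _)
  have hsum : L2Strip T (fun t x => 2⁻¹ * (rot1 1 A B a t x + rot1 (-1) C D b t x)) _ :=
    (sP1.add sQ1).const_mul 2⁻¹
  have sprim := hsum.primitive hL₀ hT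
  have sL : L2Strip T L _ := ⟨h.cont_L.aestronglyMeasurable,
    fun t ht => (sprim.memLp t ht).ae_eq (Eventually.of_forall fun x => (h.eq_L t ht x).symm),
    fun t ht => (l2norm_congr (Eventually.of_forall fun x => h.eq_L t ht x)).trans_le
      (sprim.le t ht)⟩
  have m0 : MildTransport T 0 L (fun t x => 2⁻¹ * (rot1 1 A B a t x + rot1 (-1) C D b t x)) := by
    intro t ht
    refine Eventually.of_forall fun u => ?_
    simp only [zero_mul, sub_zero]
    rw [h.eq_L t ht, h.L_zero hT]
  have m1 : MildTransport T 1 (rot1 1 A B a)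
      (fun t x => K (L t x) * (rot2 1 A B a t x * rot2 (-1) C D b t x)) := by
    intro t ht
    refine Eventually.of_forall fun u => ?_
    have := (h.isPrim_P hT hK hC hD u).1.eq t ht
    simp only [one_mul, sub_zero] at this ⊢
    rw [this]
    congr 1
    exact intervalIntegral.integral_congr fun s _ => by ring
  have m2 : MildTransport T (-1) (rot1 (-1) C D b)
      (fun t x => K (L t x) * (rot2 1 A B a t x * rot2 (-1) C D b t x)) := by
    intro t ht
    refine Eventually.of_forall fun u => ?_
    have := (h.isPrim_Q hT hK hA hB u).1.eq t ht
    simp only [neg_mul, one_mul, sub_neg_eq_add, add_zero] at this ⊢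
    rw [this]
    congr 1
    exact intervalIntegral.integral_congr fun s _ => by ring
  have h00 : HasWeakDeriv (L 0) (fun x => 2⁻¹ * (rot1 1 A B a 0 x - rot1 (-1) C D b 0 x)) := by
    have e1 : L 0 = L₀ := funext fun x => h.L_zero hT x
    have e2 : ∀ x, rot1 1 A B a 0 x = A x := fun x => by simp [rot1, h.a_zero hT]
    have e3 : ∀ x, rot1 (-1) C D b 0 x = C x := fun x => by simp [rot1, h.b_zero hT]
    simp only [e1, e2, e3]
    exact hd
  obtain ⟨w1, w2, w3, w4⟩ := wave_of_transports hT sP1 sQ1 hf sL.locBdd.loc m0 m1 m2 h00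
  have n3 := w3.mildTransport hT sQ1.locInt sL.locInt sL.locBdd
  have n4 := w4.mildTransport hT sP1.locInt sL.locInt sL.locBdd
  have cslice : ∀ τ t : ℝ, Continuous fun u => L t (u - τ * t) := fun τ t =>
    h.cont_L.comp (f := fun u => (t, u - τ * t)) (by fun_prop)
  have cL₀ : Continuous fun u => L 0 u := h.cont_L.comp (f := fun u => ((0 : ℝ), u)) (by fun_prop)
  refine ⟨⟨_, sL⟩, w1, w2, hf, fun u => ⟨?_, fun t ht => ?_⟩, fun u => ⟨?_, fun t ht => ?_⟩⟩
  · simpa using (intervalIntegrable_rot (σ := -1) hC hD h.cont_b 1 (by norm_num) u 0 T).1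
  · have := congr_fun ((Continuous.ae_eq_iff_eq volume (cslice 1 t) (cL₀.add
      (continuous_integral_rot1 hC hD h.cont_b (by norm_num) ht))).1 (n3 t ht)) u
    simpa using this
  · simpa using (intervalIntegrable_rot (σ := 1) hA hB h.cont_a (-1) (by norm_num) u 0 T).1
  · have := congr_fun ((Continuous.ae_eq_iff_eq volume (cslice (-1) t) (cL₀.add
      (continuous_integral_rot1 hA hB h.cont_a (by norm_num) ht))).1 (n4 t ht)) u
    simpa using this

end IsFrame

/-- The component of a null derivative of `φ` that corresponds to a frame component `w`. -/
noncomputable def unframe (lam : ℝ) (L w : ℝ → ℝ → ℝ) (t x : ℝ) : ℝ :=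
  2⁻¹ * ((Real.sinh (lam + L t x))⁻¹ * w t x)

theorem IsPrim.unframe {T lam : ℝ} (hT : 0 ≤ T) {ℓ w q f : ℝ → ℝ} (hℓ : IsPrim T ℓ q)
    (hw : IsPrim T w f) (hpos : ∀ t ∈ Icc 0 T, 0 < lam + ℓ t) :
    IsPrim T (fun t => 2⁻¹ * ((Real.sinh (lam + ℓ t))⁻¹ * w t))
      (fun t => 2⁻¹ * ((-Real.cosh (lam + ℓ t) / Real.sinh (lam + ℓ t) ^ 2 * q t) * w t +
        (Real.sinh (lam + ℓ t))⁻¹ * f t)) :=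
  ((IsPrim.sinh_inv (hℓ.const_add lam) hT hpos).mul hw hT).const_mul 2⁻¹

namespace IsFrame

variable {K : ℝ → ℝ} {T κ lam m : ℝ} {A B C D L₀ φ₀ : ℝ → ℝ} {a b L : ℝ → ℝ → ℝ}

/-- Dividing the second components by `2 sinh (lam + L)` gives the null derivatives of `φ`. Along a
characteristic, the rotation contributes one product to the source and the derivative of `1 / sinh`
the other. Since `K = coth`, the sources for `p` and `q` agree, which is what `wave_of_transports`
requires. -/
theorem phi_field (h : IsFrame K T A B C D L₀ a b L) (hT : 0 ≤ T) (hK : Continuous K)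
    (hKb : ∀ z, |K z| ≤ κ) (hm : 0 < m) (hLm : ∀ t ∈ Icc 0 T, ∀ x, m ≤ lam + L t x)
    (hKL : ∀ t ∈ Icc 0 T, ∀ x,
      K (L t x) = Real.cosh (lam + L t x) / Real.sinh (lam + L t x))
    (mA : Measurable A) (mB : Measurable B) (mC : Measurable C)
    (mD : Measurable D) (hA : MemLp A 2 volume) (hB : MemLp B 2 volume) (hC : MemLp C 2 volume)
    (hD : MemLp D 2 volume) (hφ₀ : MemLp φ₀ 2 volume)
    (hd : HasWeakDeriv φ₀ fun x => 2⁻¹ * (unframe lam L (rot2 1 A B a) 0 x -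
      unframe lam L (rot2 (-1) C D b) 0 x))
    (hu1 : ∀ u, IsPrim T (fun t => L t (u - t)) (fun s => rot1 (-1) C D b s (u - s)))
    (hu2 : ∀ u, IsPrim T (fun t => L t (u + t)) (fun s => rot1 1 A B a s (u + s)))
    {φ p q : ℝ → ℝ → ℝ} (hp : p = unframe lam L (rot2 1 A B a))
    (hq : q = unframe lam L (rot2 (-1) C D b))
    (hφ : φ = fun t x => φ₀ x + ∫ s in (0 : ℝ)..t, 2⁻¹ * (p s x + q s x)) :
    (∃ M, L2Strip T φ M) ∧ (∃ M, L2Strip T p M) ∧ (∃ M, L2Strip T q M) ∧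
    (∀ t ∈ Icc 0 T, HasWeakDeriv (φ t) fun x => 2⁻¹ * (p t x - q t x)) ∧
    IsWeakWave T φ (fun t x => 2⁻¹ * (p t x + q t x))
      (fun t x => K (L t x) * (rot1 1 A B a t x * q t x + p t x * rot1 (-1) C D b t x)) ∧
    LocIntStrip T (fun t x => K (L t x) *
      (rot1 1 A B a t x * q t x + p t x * rot1 (-1) C D b t x)) ∧
    MildTransport T 1 φ q ∧ MildTransport T (-1) φ p ∧
    MildTransport T 1 p (fun t x => -(K (L t x) *
      (rot1 1 A B a t x * q t x + p t x * rot1 (-1) C D b t x))) ∧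
    MildTransport T (-1) q (fun t x => -(K (L t x) *
      (rot1 1 A B a t x * q t x + p t x * rot1 (-1) C D b t x))) := by
  have sP1 : L2Strip T (rot1 1 A B a) _ := L2Strip.of_bound (c := 1) hA hB
    (measurable_rot1 mA mB h.cont_a) (fun t _ x => (abs_rot1_le t x).trans_eq (one_mul _).symm)
  have sQ1 : L2Strip T (rot1 (-1) C D b) _ := L2Strip.of_bound (c := 1) hC hD
    (measurable_rot1 mC mD h.cont_b) (fun t _ x => (abs_rot1_le t x).trans_eq (one_mul _).symm)
  have hS : ∀ t ∈ Icc 0 T, ∀ x, |2⁻¹ * (Real.sinh (lam + L t x))⁻¹| ≤ m⁻¹ := fun t ht x => by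
    have h1 : m ≤ Real.sinh (lam + L t x) :=
      (hLm t ht x).trans (Real.self_le_sinh_iff.2 (hm.le.trans (hLm t ht x)))
    have h2 : 0 < Real.sinh (lam + L t x) := hm.trans_le h1
    rw [abs_of_pos (by positivity)]
    have h3 : (Real.sinh (lam + L t x))⁻¹ ≤ m⁻¹ := inv_anti₀ hm h1
    have : 0 < m⁻¹ := by positivity
    linarith
  have mS : Measurable fun z : ℝ × ℝ => (Real.sinh (lam + L z.1 z.2))⁻¹ :=
    (Real.continuous_sinh.comp (continuous_const.add h.cont_L)).measurable.inv
  have hbd : ∀ {w : ℝ → ℝ → ℝ} {E : ℝ}, ∀ t ∈ Icc 0 T, ∀ x, |w t x| ≤ E →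
      |PCF.unframe lam L w t x| ≤ m⁻¹ * E := fun {w E} t ht x hw => by
    rw [PCF.unframe, ← mul_assoc, abs_mul]
    exact mul_le_mul (hS t ht x) hw (abs_nonneg _) (by positivity)
  have sp : L2Strip T p (|m⁻¹| * (l2norm A + l2norm B)) := by
    rw [hp]
    exact L2Strip.of_bound (c := m⁻¹) hA hB ((mS.mul (measurable_rot2 mA mB h.cont_a)).const_mul _)
      (fun t ht x => hbd t ht x (abs_rot2_le t x))
  have sq : L2Strip T q (|m⁻¹| * (l2norm C + l2norm D)) := by
    rw [hq]
    exact L2Strip.of_bound (c := m⁻¹) hC hD ((mS.mul (measurable_rot2 mC mD h.cont_b)).const_mul _)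
      (fun t ht x => hbd t ht x (abs_rot2_le t x))
  have hf : LocIntStrip T (fun t x => K (L t x) *
      (rot1 1 A B a t x * q t x + p t x * rot1 (-1) C D b t x)) :=
    (LocIntStrip.of_integrable ((sP1.integrable_mul sq).add (sp.integrable_mul sQ1))).bdd_mul
      (k := fun t x => K (L t x)) (hK.comp h.cont_L) (fun _ _ => hKb _)
  have hsum : L2Strip T (fun t x => 2⁻¹ * (p t x + q t x)) _ := (sp.add sq).const_mul 2⁻¹
  have sφ := hsum.primitive hφ₀ hT
  rw [← hφ] at sφ
  have φ0 : ∀ x, φ 0 x = φ₀ x := fun x => by simp [hφ]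
  have m0 : MildTransport T 0 φ (fun t x => 2⁻¹ * (p t x + q t x)) := by
    intro t ht
    refine Eventually.of_forall fun u => ?_
    simp only [zero_mul, sub_zero]
    rw [φ0, hφ]
  -- The two contributions to the source, collected with the common factor `coth`; here `r` stands
  -- for the derivative of `L` along the characteristic.
  have halg : ∀ t ∈ Icc 0 T, ∀ x r w v y : ℝ, y = K (L t x) →
      2⁻¹ * ((-Real.cosh (lam + L t x) / Real.sinh (lam + L t x) ^ 2 * r) * w +
        (Real.sinh (lam + L t x))⁻¹ * -(y * v)) =
      -(K (L t x) * (v * (2⁻¹ * (Real.sinh (lam + L t x))⁻¹) +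
        2⁻¹ * ((Real.sinh (lam + L t x))⁻¹ * w) * r)) := by
    intro t ht x r w v y hy
    have h2 : Real.sinh (lam + L t x) ≠ 0 :=
      (Real.sinh_pos_iff.2 (hm.trans_le (hLm t ht x))).ne'
    rw [hy, hKL t ht x]
    field_simp
    ring
  have pos : ∀ {t x}, t ∈ Icc 0 T → 0 < lam + L t x := fun ht => hm.trans_le (hLm _ ht _)
  have m1 : MildTransport T 1 p (fun t x => -(K (L t x) *
      (rot1 1 A B a t x * q t x + p t x * rot1 (-1) C D b t x))) := by
    intro t ht
    refine Eventually.of_forall fun u => ?_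
    have := (IsPrim.unframe hT (hu1 u) (h.isPrim_P hT hK hC hD u).2 (fun t ht => pos ht)).eq t ht
    simp only [one_mul, sub_zero] at this ⊢
    rw [hp, hq]
    simp only [PCF.unframe]
    rw [this]
    congr 1
    refine intervalIntegral.integral_congr fun s hs => ?_
    rw [uIcc_of_le ht.1] at hs
    have hs' : s ∈ Icc 0 T := ⟨hs.1, hs.2.trans ht.2⟩
    have e := halg s hs' (u - s) (rot1 (-1) C D b s (u - s)) (rot2 1 A B a s (u - s))
      (rot2 (-1) C D b s (u - s) * rot1 1 A B a s (u - s)) _ rfl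
    simp only [← mul_assoc] at e ⊢
    rw [e]
    ring
  have m2 : MildTransport T (-1) q (fun t x => -(K (L t x) *
      (rot1 1 A B a t x * q t x + p t x * rot1 (-1) C D b t x))) := by
    intro t ht
    refine Eventually.of_forall fun u => ?_
    have := (IsPrim.unframe hT (hu2 u) (h.isPrim_Q hT hK hA hB u).2 (fun t ht => pos ht)).eq t ht
    simp only [neg_mul, one_mul, sub_neg_eq_add, add_zero] at this ⊢
    rw [hp, hq]
    simp only [PCF.unframe]
    rw [this]
    congr 1
    refine intervalIntegral.integral_congr fun s hs => ?_
    rw [uIcc_of_le ht.1] at hs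
    have hs' : s ∈ Icc 0 T := ⟨hs.1, hs.2.trans ht.2⟩
    have e := halg s hs' (u + s) (rot1 1 A B a s (u + s)) (rot2 (-1) C D b s (u + s))
      (rot2 1 A B a s (u + s) * rot1 (-1) C D b s (u + s)) _ rfl
    simp only [← mul_assoc] at e ⊢
    rw [e]
    ring
  have h00 : HasWeakDeriv (φ 0) (fun x => 2⁻¹ * (p 0 x - q 0 x)) := by
    rw [show φ 0 = φ₀ from funext φ0, hp, hq]
    exact hd
  obtain ⟨w1, w2, w3, w4⟩ := wave_of_transports hT sp sq hf.neg sφ.locBdd.loc m0 m1 m2 h00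
  simp only [neg_neg] at w2
  exact ⟨⟨_, sφ⟩, ⟨_, sp⟩, ⟨_, sq⟩, w1, w2, hf, w3.mildTransport hT sq.locInt sφ.locInt sφ.locBdd,
    w4.mildTransport hT sp.locInt sφ.locInt sφ.locBdd, m1, m2⟩

end IsFrame

/-! ### Componentwise norms and the initial values of the frames -/

namespace EnergySpace

theorem le_posNorm (u : EnergySpace) : l2norm u.Lam.toFun ≤ u.posNorm ∧
    l2norm u.Lam.dx ≤ u.posNorm ∧ l2norm u.phi.toFun ≤ u.posNorm ∧
    l2norm u.phi.dx ≤ u.posNorm := by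
  refine ⟨?_, ?_, ?_, ?_⟩ <;>
  · refine Real.le_sqrt_of_sq_le ?_
    nlinarith [sq_nonneg (l2norm u.Lam.toFun), sq_nonneg (l2norm u.Lam.dx),
      sq_nonneg (l2norm u.phi.toFun), sq_nonneg (l2norm u.phi.dx)]

theorem le_velNorm (u : EnergySpace) : l2norm u.Lamt.toFun ≤ u.velNorm ∧
    l2norm u.phit.toFun ≤ u.velNorm := by
  refine ⟨?_, ?_⟩ <;>
  · refine Real.le_sqrt_of_sq_le ?_
    nlinarith [sq_nonneg (l2norm u.Lamt.toFun), sq_nonneg (l2norm u.phit.toFun)]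

theorem posNorm_nonneg (u : EnergySpace) : 0 ≤ u.posNorm := Real.sqrt_nonneg _

theorem velNorm_nonneg (u : EnergySpace) : 0 ≤ u.velNorm := Real.sqrt_nonneg _

/-- All six components are bounded by `r` in `L²`. -/
structure CompLe (u : EnergySpace) (r : ℝ) : Prop where
  Lam : l2norm u.Lam.toFun ≤ r
  Lamx : l2norm u.Lam.dx ≤ r
  phi : l2norm u.phi.toFun ≤ r
  phix : l2norm u.phi.dx ≤ r
  Lamt : l2norm u.Lamt.toFun ≤ r
  phit : l2norm u.phit.toFun ≤ r

theorem compLe_norm (u : EnergySpace) : u.CompLe u.norm := by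
  obtain ⟨h1, h2, h3, h4⟩ := u.le_posNorm
  obtain ⟨h5, h6⟩ := u.le_velNorm
  have := u.posNorm_nonneg
  have := u.velNorm_nonneg
  constructor <;> rw [norm] <;> linarith

theorem CompLe.mono {u : EnergySpace} {r s : ℝ} (h : u.CompLe r) (hrs : r ≤ s) : u.CompLe s :=
  ⟨h.1.trans hrs, h.2.trans hrs, h.3.trans hrs, h.4.trans hrs, h.5.trans hrs, h.6.trans hrs⟩

theorem CompLe.nonneg {u : EnergySpace} {r : ℝ} (h : u.CompLe r) : 0 ≤ r :=
  (l2norm_nonneg _).trans h.Lam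

theorem CompLe.norm_le {u : EnergySpace} {r : ℝ} (h : u.CompLe r) : u.norm ≤ 4 * r := by
  have hr := h.nonneg
  have hs : ∀ {x : ℝ}, 0 ≤ x → x ≤ r → x ^ 2 ≤ r ^ 2 := fun h0 h1 => by gcongr
  have h1 : u.posNorm ≤ 2 * r := by
    refine Real.sqrt_le_iff.2 ⟨by positivity, ?_⟩
    linarith [hs (l2norm_nonneg _) h.Lam, hs (l2norm_nonneg _) h.Lamx, hs (l2norm_nonneg _) h.phi,
      hs (l2norm_nonneg _) h.phix]
  have h2 : u.velNorm ≤ 2 * r := by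
    refine Real.sqrt_le_iff.2 ⟨by positivity, ?_⟩
    nlinarith [hs (l2norm_nonneg _) h.Lamt, hs (l2norm_nonneg _) h.phit]
  rw [norm]
  linarith

theorem CompLe.of_sub {u v : EnergySpace} {r s : ℝ} (h : u.CompLe r) (hs : (v - u).CompLe s) :
    v.CompLe (r + s) := by
  have key : ∀ {f g : ℝ → ℝ}, MemLp f 2 volume → MemLp g 2 volume → l2norm f ≤ r →
      l2norm (fun x => g x - f x) ≤ s → l2norm g ≤ r + s := by
    intro f g hf hg h1 h2
    have := l2norm_add_le hf (hg.sub hf)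
    simp only [Pi.sub_apply, add_sub_cancel] at this
    exact this.trans (add_le_add h1 h2)
  exact ⟨key u.Lam.memLp_toFun v.Lam.memLp_toFun h.1 hs.1, key u.Lam.memLp_dx v.Lam.memLp_dx h.2 hs.2,
    key u.phi.memLp_toFun v.phi.memLp_toFun h.3 hs.3, key u.phi.memLp_dx v.phi.memLp_dx h.4 hs.4,
    key u.Lamt.memLp_toFun v.Lamt.memLp_toFun h.5 hs.5,
    key u.phit.memLp_toFun v.phit.memLp_toFun h.6 hs.6⟩

end EnergySpace

theorem HasWeakDeriv.congr {f f₁ g g₁ : ℝ → ℝ} (h : HasWeakDeriv f g) (hf : f =ᵐ[volume] f₁)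
    (hg : g =ᵐ[volume] g₁) : HasWeakDeriv f₁ g₁ := fun η hη hc => by
  have e1 : ∫ x, f₁ x * deriv η x = ∫ x, f x * deriv η x :=
    integral_congr_ae (by filter_upwards [hf] with x hx; rw [hx])
  have e2 : ∫ x, g₁ x * η x = ∫ x, g x * η x :=
    integral_congr_ae (by filter_upwards [hg] with x hx; rw [hx])
  rw [e1, e2, h η hη hc]

theorem hasWeakDeriv_deriv {f : ℝ → ℝ} (hf : ContDiff ℝ 1 f) : HasWeakDeriv f (deriv f) := by
  intro η hη hc
  have hη1 : ContDiff ℝ 1 η := hη.of_le (by simp)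
  have := integral_mul_deriv_eq_deriv_mul_of_integrable (u := f) (v := η) (u' := deriv f)
    (v' := deriv η) (fun x _ => (hf.differentiable one_ne_zero x).hasDerivAt)
    (fun x _ => (hη1.differentiable one_ne_zero x).hasDerivAt)
    ((hf.continuous.mul (hη1.continuous_deriv le_rfl)).integrable_of_hasCompactSupport
      hc.deriv.mul_left)
    (((hf.continuous_deriv le_rfl).mul hη1.continuous).integrable_of_hasCompactSupport
      hc.mul_left)
    ((hf.continuous.mul hη1.continuous).integrable_of_hasCompactSupport hc.mul_left)
  exact this

theorem H1.dx_ae_eq_deriv (f : H1) (hf : ContDiff ℝ 1 f.toFun) :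
    f.dx =ᵐ[volume] deriv f.toFun :=
  HasWeakDeriv.ae_unique (f.memLp_dx.locallyIntegrable (by norm_num))
    (hf.continuous_deriv le_rfl).locallyIntegrable f.hasWeakDeriv (hasWeakDeriv_deriv hf)
    EventuallyEq.rfl

/-- Pointwise representatives of the initial values of the frame components of `u`. -/
structure FrameData (lam : ℝ) (u : EnergySpace) (A B C D L₀ : ℝ → ℝ) : Prop where
  mA : Measurable A
  mB : Measurable B
  mC : Measurable C
  mD : Measurable D
  cont_L : Continuous L₀
  aeL : u.Lam.toFun =ᵐ[volume] L₀
  aeA : A =ᵐ[volume] fun x => u.Lamt.toFun x + u.Lam.dx x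
  aeB : B =ᵐ[volume] fun x => 2 * Real.sinh (lam + L₀ x) * (u.phit.toFun x + u.phi.dx x)
  aeC : C =ᵐ[volume] fun x => u.Lamt.toFun x - u.Lam.dx x
  aeD : D =ᵐ[volume] fun x => 2 * Real.sinh (lam + L₀ x) * (u.phit.toFun x - u.phi.dx x)

/-- Everywhere defined measurable representatives are required because frames evaluate the data
along individual lines. -/
theorem exists_frameData (lam : ℝ) (u : EnergySpace) :
    ∃ A B C D L₀ : ℝ → ℝ, FrameData lam u A B C D L₀ := by
  obtain ⟨L₀, hc, hae, -⟩ := u.Lam.exists_continuous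
  have h1 := (u.Lamt.memLp_toFun.add u.Lam.memLp_dx).1.aemeasurable
  have h2 := (u.phit.memLp_toFun.add u.phi.memLp_dx).1.aemeasurable
  have h3 := (u.Lamt.memLp_toFun.sub u.Lam.memLp_dx).1.aemeasurable
  have h4 := (u.phit.memLp_toFun.sub u.phi.memLp_dx).1.aemeasurable
  have hs : Measurable fun x => 2 * Real.sinh (lam + L₀ x) :=
    (continuous_const.mul (Real.continuous_sinh.comp (continuous_const.add hc))).measurable
  refine ⟨h1.mk _, fun x => 2 * Real.sinh (lam + L₀ x) * h2.mk _ x, h3.mk _,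
    fun x => 2 * Real.sinh (lam + L₀ x) * h4.mk _ x, L₀, h1.measurable_mk, hs.mul h2.measurable_mk,
    h3.measurable_mk, hs.mul h4.measurable_mk, hc, hae, h1.ae_eq_mk.symm, ?_, h3.ae_eq_mk.symm, ?_⟩
  · filter_upwards [h2.ae_eq_mk] with x hx
    rw [← hx]; rfl
  · filter_upwards [h4.ae_eq_mk] with x hx
    rw [← hx]; rfl

theorem IsC2Data.exists_frameData (lam : ℝ) {u : EnergySpace} (hu : IsC2Data u) :
    ∃ A B C D L₀ : ℝ → ℝ, FrameData lam u A B C D L₀ ∧ ContDiff ℝ 1 A ∧ ContDiff ℝ 1 B ∧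
      ContDiff ℝ 1 C ∧ ContDiff ℝ 1 D ∧ ContDiff ℝ 2 L₀ := by
  have dL : ContDiff ℝ 1 (deriv u.Lam.toFun) := hu.Lam.deriv' (n := 1)
  have dφ : ContDiff ℝ 1 (deriv u.phi.toFun) := hu.phi.deriv' (n := 1)
  have hs : ContDiff ℝ 1 fun x => 2 * Real.sinh (lam + u.Lam.toFun x) :=
    contDiff_const.mul ((contDiff_const.add (hu.Lam.of_le (by norm_num))).sinh)
  have e1 := u.Lam.dx_ae_eq_deriv (hu.Lam.of_le (by norm_num))
  have e2 := u.phi.dx_ae_eq_deriv (hu.phi.of_le (by norm_num))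
  have hA := hu.Lamt.add dL
  have hC := hu.Lamt.sub dL
  have hB := hs.mul (hu.phit.add dφ)
  have hD := hs.mul (hu.phit.sub dφ)
  refine ⟨_, _, _, _, u.Lam.toFun, ⟨hA.continuous.measurable, hB.continuous.measurable,
    hC.continuous.measurable, hD.continuous.measurable, hu.Lam.continuous, EventuallyEq.rfl,
    ?_, ?_, ?_, ?_⟩, hA, hB, hC, hD, hu.Lam⟩
  · filter_upwards [e1] with x hx; rw [hx]
  · filter_upwards [e2] with x hx; rw [hx]
  · filter_upwards [e1] with x hx; rw [hx]
  · filter_upwards [e2] with x hx; rw [hx]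

namespace FrameData

variable {lam r : ℝ} {u : EnergySpace} {A B C D L₀ : ℝ → ℝ}

theorem exists_primitive (h : FrameData lam u A B C D L₀) :
    ∀ x y, L₀ y - L₀ x = ∫ z in x..y, u.Lam.dx z := by
  obtain ⟨g, hc, hae, hp⟩ := u.Lam.exists_continuous
  rw [← (Continuous.ae_eq_iff_eq volume hc h.cont_L).1 (hae.symm.trans h.aeL)]
  exact hp

/-- The Sobolev inequality at scale `1`. For `r = lam / 6` it gives `|L₀| ≤ lam / 3`, which leaves
room `lam / 6` for the evolution up to `lam / 2`. -/
theorem abs_L_le (h : FrameData lam u A B C D L₀) (hu : u.CompLe r) (x : ℝ) : |L₀ x| ≤ 2 * r := by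
  have := abs_le_of_primitive (u.Lam.memLp_toFun.ae_eq h.aeL) u.Lam.memLp_dx h.cont_L
    h.exists_primitive one_pos x
  rw [← l2norm_congr h.aeL] at this
  simp only [one_mul, Real.sqrt_one] at this
  linarith [hu.Lam, hu.Lamx]

theorem memLp_L (h : FrameData lam u A B C D L₀) : MemLp L₀ 2 volume :=
  u.Lam.memLp_toFun.ae_eq h.aeL

theorem memLp_A (h : FrameData lam u A B C D L₀) : MemLp A 2 volume :=
  (u.Lamt.memLp_toFun.add u.Lam.memLp_dx).ae_eq h.aeA.symm

theorem memLp_C (h : FrameData lam u A B C D L₀) : MemLp C 2 volume :=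
  (u.Lamt.memLp_toFun.sub u.Lam.memLp_dx).ae_eq h.aeC.symm

theorem l2norm_A_le (h : FrameData lam u A B C D L₀) (hu : u.CompLe r) : l2norm A ≤ 2 * r := by
  rw [l2norm_congr h.aeA]
  linarith [l2norm_add_le u.Lamt.memLp_toFun u.Lam.memLp_dx, hu.Lamt, hu.Lamx]

theorem l2norm_C_le (h : FrameData lam u A B C D L₀) (hu : u.CompLe r) : l2norm C ≤ 2 * r := by
  rw [l2norm_congr h.aeC]
  linarith [l2norm_sub_le u.Lamt.memLp_toFun u.Lam.memLp_dx, hu.Lamt, hu.Lamx]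

theorem abs_sinh_le {M x : ℝ} (hx : |x| ≤ M) : |Real.sinh x| ≤ Real.sinh M := by
  rw [Real.abs_sinh]
  exact Real.sinh_le_sinh.2 hx

theorem memLp_sinh_mul (h : FrameData lam u A B C D L₀) {w : ℝ → ℝ} (hw : MemLp w 2 volume)
    {ℓ : ℝ} (hℓ : ∀ x, |L₀ x| ≤ ℓ) :
    MemLp (fun x => 2 * Real.sinh (lam + L₀ x) * w x) 2 volume ∧
      l2norm (fun x => 2 * Real.sinh (lam + L₀ x) * w x) ≤
        2 * Real.sinh (|lam| + ℓ) * l2norm w := by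
  have hb : ∀ x, |2 * Real.sinh (lam + L₀ x) * w x| ≤ |2 * Real.sinh (|lam| + ℓ) * w x| := by
    intro x
    rw [abs_mul, abs_mul _ (w x), abs_mul, abs_mul]
    exact mul_le_mul_of_nonneg_right (mul_le_mul_of_nonneg_left ((abs_sinh_le
      ((abs_add_le _ _).trans (add_le_add le_rfl (hℓ x)))).trans (le_abs_self _)) (abs_nonneg _))
      (abs_nonneg _)
  have hm : MemLp (fun x => 2 * Real.sinh (|lam| + ℓ) * w x) 2 volume := hw.const_mul _
  have hc : Continuous fun x => 2 * Real.sinh (lam + L₀ x) :=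
    continuous_const.mul (Real.continuous_sinh.comp (continuous_const.add h.cont_L))
  refine ⟨hm.of_le (hc.aestronglyMeasurable.mul hw.1) (Eventually.of_forall hb),
    (l2norm_mono hm (Eventually.of_forall hb)).trans_eq ?_⟩
  rw [l2norm_const_mul, abs_of_nonneg]
  have : 0 ≤ ℓ := (abs_nonneg _).trans (hℓ 0)
  have : 0 ≤ Real.sinh (|lam| + ℓ) := Real.sinh_nonneg_iff.2 (by positivity)
  positivity

theorem memLp_B (h : FrameData lam u A B C D L₀) : MemLp B 2 volume :=
  (h.memLp_sinh_mul (u.phit.memLp_toFun.add u.phi.memLp_dx)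
    (h.abs_L_le u.compLe_norm)).1.ae_eq h.aeB.symm

theorem memLp_D (h : FrameData lam u A B C D L₀) : MemLp D 2 volume :=
  (h.memLp_sinh_mul (u.phit.memLp_toFun.sub u.phi.memLp_dx)
    (h.abs_L_le u.compLe_norm)).1.ae_eq h.aeD.symm

/-- At `r = lam / 6` the right-hand side is the constant `frameBound lam`, which fixes the size of
the time interval. -/
theorem l2norm_sum_le (h : FrameData lam u A B C D L₀) (hu : u.CompLe r) :
    l2norm A + l2norm B + l2norm C + l2norm D ≤ 4 * r + 8 * Real.sinh (|lam| + 2 * r) * r := by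
  have hr := hu.nonneg
  have h1 : l2norm B ≤ 2 * Real.sinh (|lam| + 2 * r) * (2 * r) := by
    rw [l2norm_congr h.aeB]
    refine (h.memLp_sinh_mul (u.phit.memLp_toFun.add u.phi.memLp_dx) (h.abs_L_le hu)).2.trans ?_
    gcongr
    linarith [l2norm_add_le u.phit.memLp_toFun u.phi.memLp_dx, hu.phit, hu.phix,
      show l2norm (u.phit.toFun + u.phi.dx) = l2norm fun x => u.phit.toFun x + u.phi.dx x from rfl]
  have h2 : l2norm D ≤ 2 * Real.sinh (|lam| + 2 * r) * (2 * r) := by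
    rw [l2norm_congr h.aeD]
    refine (h.memLp_sinh_mul (u.phit.memLp_toFun.sub u.phi.memLp_dx) (h.abs_L_le hu)).2.trans ?_
    gcongr
    linarith [l2norm_sub_le u.phit.memLp_toFun u.phi.memLp_dx, hu.phit, hu.phix,
      show l2norm (u.phit.toFun - u.phi.dx) = l2norm fun x => u.phit.toFun x - u.phi.dx x from rfl]
  linarith [h.l2norm_A_le hu, h.l2norm_C_le hu]

theorem hasWeakDeriv_L (h : FrameData lam u A B C D L₀) :
    HasWeakDeriv L₀ fun x => 2⁻¹ * (A x - C x) :=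
  u.Lam.hasWeakDeriv.congr h.aeL (by
    filter_upwards [h.aeA, h.aeC] with x h1 h2
    rw [h1, h2]; ring)

theorem hasWeakDeriv_phi (h : FrameData lam u A B C D L₀) (hpos : ∀ x, 0 < lam + L₀ x) :
    HasWeakDeriv u.phi.toFun fun x => 2⁻¹ * (2⁻¹ * ((Real.sinh (lam + L₀ x))⁻¹ * B x) -
      2⁻¹ * ((Real.sinh (lam + L₀ x))⁻¹ * D x)) :=
  u.phi.hasWeakDeriv.congr EventuallyEq.rfl (by
    filter_upwards [h.aeB, h.aeD] with x h1 h2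
    have : Real.sinh (lam + L₀ x) ≠ 0 := (Real.sinh_pos_iff.2 (hpos x)).ne'
    rw [h1, h2]; field_simp; ring)

end FrameData

/-! ### The truncated coefficient and the construction of a solution -/

/-- The coefficient `coth (lam + z)`, with `z` projected to `[-lam / 2, lam / 2]`. -/
noncomputable def cothTrunc (lam z : ℝ) : ℝ :=
  Real.cosh (lam + max (-(lam / 2)) (min z (lam / 2))) /
    Real.sinh (lam + max (-(lam / 2)) (min z (lam / 2)))

theorem cothTrunc_eq {lam z : ℝ} (hz : |z| ≤ lam / 2) :
    cothTrunc lam z = Real.cosh (lam + z) / Real.sinh (lam + z) := by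
  rw [cothTrunc, min_eq_left (abs_le.1 hz).2, max_eq_right (abs_le.1 hz).1]

/-- On the compact interval `[-lam / 2, lam / 2]` the argument `lam + z` stays positive, so `coth
(lam + z)` and its derivative are bounded there, and the projection to that interval is Lipschitz
with constant `1`. -/
theorem exists_cothTrunc_bound {lam : ℝ} (hlam : 0 < lam) :
    ∃ κ, 1 ≤ κ ∧ (∀ z, |cothTrunc lam z| ≤ κ) ∧
      ∀ z z', |cothTrunc lam z - cothTrunc lam z'| ≤ κ * |z - z'| := by
  set c : ℝ → ℝ := fun z => max (-(lam / 2)) (min z (lam / 2)) with hc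
  set f : ℝ → ℝ := fun w => Real.cosh (lam + w) / Real.sinh (lam + w) with hf
  set I := Icc (-(lam / 2)) (lam / 2) with hI
  have hcI : ∀ z, c z ∈ I := fun z => ⟨le_max_left _ _, max_le (by linarith) (min_le_right _ _)⟩
  have hpos : ∀ w ∈ I, Real.sinh (lam + w) ≠ 0 := fun w hw =>
    (Real.sinh_pos_iff.2 (by linarith [hw.1])).ne'
  have hd : ∀ w ∈ I, HasDerivAt f ((Real.sinh (lam + w) * Real.sinh (lam + w) -
      Real.cosh (lam + w) * Real.cosh (lam + w)) / Real.sinh (lam + w) ^ 2) w := fun w hw => by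
    have h1 : HasDerivAt (fun w : ℝ => lam + w) 1 w := (hasDerivAt_id w).const_add lam
    have h2 := h1.cosh.div h1.sinh (hpos w hw)
    rw [mul_one, mul_one] at h2
    exact h2
  have hcont : ContinuousOn f I := fun w hw => (hd w hw).continuousAt.continuousWithinAt
  obtain ⟨κ₁, h1⟩ := isCompact_Icc.exists_bound_of_continuousOn hcont
  obtain ⟨κ₂, h2⟩ := isCompact_Icc.exists_bound_of_continuousOn
    (f := fun w => (Real.sinh (lam + w) * Real.sinh (lam + w) -
      Real.cosh (lam + w) * Real.cosh (lam + w)) / Real.sinh (lam + w) ^ 2) (s := I)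
    (ContinuousOn.div (by fun_prop) (by fun_prop) fun w hw => pow_ne_zero 2 (hpos w hw))
  refine ⟨max 1 (max κ₁ κ₂), le_max_left _ _, fun z => (h1 _ (hcI z)).trans
    ((le_max_left _ _).trans (le_max_right _ _)), fun z z' => ?_⟩
  have h3 := (convex_Icc (-(lam / 2)) (lam / 2)).norm_image_sub_le_of_norm_hasDerivWithin_le
    (fun w hw => (hd w hw).hasDerivWithinAt) h2 (hcI z') (hcI z)
  refine h3.trans (mul_le_mul ((le_max_right _ _).trans (le_max_right _ _)) ?_ (abs_nonneg _)
    (zero_le_one.trans (le_max_left _ _)))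
  refine (abs_max_sub_max_le_max _ _ _ _).trans (max_le (by simp) ?_)
  exact (abs_min_sub_min_le_max _ _ _ _).trans (max_le le_rfl (by simp))

theorem IsWeakWave.congr {T : ℝ} {ψ v N ψ' v' N' : ℝ → ℝ → ℝ} (hT : 0 ≤ T)
    (h : IsWeakWave T ψ v N) (hψ : ∀ t ∈ Icc 0 T, ψ' t = ψ t) (hv : ∀ t ∈ Icc 0 T, v' t = v t)
    (hN : ∀ t ∈ Icc 0 T, N' t = N t) : IsWeakWave T ψ' v' N' := by
  intro η hη hc t ht
  have h0 : (0 : ℝ) ∈ Icc 0 T := ⟨le_rfl, hT⟩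
  have hs : ∀ s ∈ uIcc 0 t, s ∈ Icc 0 T := fun s hs => by
    rw [uIcc_of_le ht.1] at hs; exact ⟨hs.1, hs.2.trans ht.2⟩
  obtain ⟨h1, h2⟩ := h η hη hc t ht
  refine ⟨?_, ?_⟩
  · rw [hψ t ht, hψ 0 h0, h1]
    congr 1
    exact intervalIntegral.integral_congr fun s h => by simp only [hv s (hs s h)]
  · rw [hv t ht, hv 0 h0, h2]
    congr 1
    exact intervalIntegral.integral_congr fun s h => by
      simp only [hψ s (hs s h), hN s (hs s h)]

theorem abs_integral_rot_le {T : ℝ} {A B C D : ℝ → ℝ} {a b : ℝ → ℝ → ℝ} (hA : MemLp A 2 volume)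
    (hB : MemLp B 2 volume) (hC : MemLp C 2 volume) (hD : MemLp D 2 volume) {t : ℝ}
    (ht : t ∈ Icc 0 T) (x : ℝ) :
    |∫ s in (0 : ℝ)..t, 2⁻¹ * (rot1 1 A B a s x + rot1 (-1) C D b s x)| ≤
      √T * (l2norm A + l2norm B + l2norm C + l2norm D) := by
  have iA := fun {g : ℝ → ℝ} (hg : MemLp g 2 volume) {σ : ℝ} (hσ : σ ≠ 0) =>
    (memLp_intervalIntegrable (memLp_comp_affine hg x hσ) 0 t).abs
  have h1 : |∫ s in (0 : ℝ)..t, 2⁻¹ * (rot1 1 A B a s x + rot1 (-1) C D b s x)| ≤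
      ∫ s in (0 : ℝ)..t, (|A (x + 1 * s)| + |B (x + 1 * s)| + |C (x + -1 * s)| +
        |D (x + -1 * s)|) := by
    rw [← Real.norm_eq_abs]
    refine intervalIntegral.norm_integral_le_of_norm_le ht.1 (Eventually.of_forall fun s _ => ?_)
      ((((iA hA one_ne_zero).add (iA hB one_ne_zero)).add (iA hC (by norm_num))).add
        (iA hD (by norm_num)))
    rw [Real.norm_eq_abs, abs_mul, abs_of_pos (by norm_num : (0 : ℝ) < 2⁻¹)]
    have e1 := abs_add_le (rot1 1 A B a s x) (rot1 (-1) C D b s x)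
    have e2 := abs_rot1_le (σ := 1) (A := A) (B := B) (a := a) s x
    have e3 := abs_rot1_le (σ := -1) (A := C) (B := D) (a := b) s x
    linarith [abs_nonneg (rot1 1 A B a s x + rot1 (-1) C D b s x)]
  rw [intervalIntegral.integral_add (((iA hA one_ne_zero).add (iA hB one_ne_zero)).add
      (iA hC (by norm_num))) (iA hD (by norm_num)), intervalIntegral.integral_add
      ((iA hA one_ne_zero).add (iA hB one_ne_zero)) (iA hC (by norm_num)),
    intervalIntegral.integral_add (iA hA one_ne_zero) (iA hB one_ne_zero)] at h1
  have e1 := integral_abs_affine_le hA (ρ := 1) (by norm_num) x ht.1 ht.2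
  have e2 := integral_abs_affine_le hB (ρ := 1) (by norm_num) x ht.1 ht.2
  have e3 := integral_abs_affine_le hC (ρ := -1) (by norm_num) x ht.1 ht.2
  have e4 := integral_abs_affine_le hD (ρ := -1) (by norm_num) x ht.1 ht.2
  linarith

/-- The angles drop out because a rotation is bounded by the vector that it rotates. No bound on `K`
and no bootstrap in time is involved. -/
theorem IsFrame.abs_L_le {K : ℝ → ℝ} {T ℓ : ℝ} {A B C D L₀ : ℝ → ℝ} {a b L : ℝ → ℝ → ℝ}
    (h : IsFrame K T A B C D L₀ a b L) (hA : MemLp A 2 volume) (hB : MemLp B 2 volume)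
    (hC : MemLp C 2 volume) (hD : MemLp D 2 volume) (hℓ : ∀ x, |L₀ x| ≤ ℓ) {t : ℝ}
    (ht : t ∈ Icc 0 T) (x : ℝ) :
    |L t x| ≤ ℓ + √T * (l2norm A + l2norm B + l2norm C + l2norm D) := by
  rw [h.eq_L t ht]
  exact (abs_add_le _ _).trans (add_le_add (hℓ x) (abs_integral_rot_le hA hB hC hD ht x))

theorem exists_curve {T : ℝ} (u : EnergySpace) {L Lx Lt φ φx φt : ℝ → ℝ → ℝ}
    (hL : ∃ M, L2Strip T L M) (hLx : ∃ M, L2Strip T Lx M) (hLt : ∃ M, L2Strip T Lt M)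
    (hφ : ∃ M, L2Strip T φ M) (hφx : ∃ M, L2Strip T φx M) (hφt : ∃ M, L2Strip T φt M)
    (dL : ∀ t ∈ Icc 0 T, HasWeakDeriv (L t) (Lx t))
    (dφ : ∀ t ∈ Icc 0 T, HasWeakDeriv (φ t) (φx t)) :
    ∃ U : ℝ → EnergySpace, MemLinf T U ∧ ∀ t ∈ Icc 0 T, (U t).Lam.toFun = L t ∧
      (U t).Lam.dx = Lx t ∧ (U t).phi.toFun = φ t ∧ (U t).phi.dx = φx t ∧
      (U t).Lamt.toFun = Lt t ∧ (U t).phit.toFun = φt t := by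
  obtain ⟨M₁, hL⟩ := hL
  obtain ⟨M₂, hLx⟩ := hLx
  obtain ⟨M₃, hLt⟩ := hLt
  obtain ⟨M₄, hφ⟩ := hφ
  obtain ⟨M₅, hφx⟩ := hφx
  obtain ⟨M₆, hφt⟩ := hφt
  have key : ∀ t, ∃ v : EnergySpace, t ∈ Icc 0 T → v.Lam.toFun = L t ∧
      v.Lam.dx = Lx t ∧ v.phi.toFun = φ t ∧ v.phi.dx = φx t ∧
      v.Lamt.toFun = Lt t ∧ v.phit.toFun = φt t := by
    intro t
    by_cases ht : t ∈ Icc 0 T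
    · exact ⟨⟨⟨L t, Lx t, hL.memLp t ht, hLx.memLp t ht, dL t ht⟩,
        ⟨φ t, φx t, hφ.memLp t ht, hφx.memLp t ht, dφ t ht⟩, ⟨Lt t, hLt.memLp t ht⟩,
        ⟨φt t, hφt.memLp t ht⟩⟩, fun _ => ⟨rfl, rfl, rfl, rfl, rfl, rfl⟩⟩
    -- Outside `[0, T]` the curve takes an arbitrary value.
    · exact ⟨u, fun h => absurd h ht⟩
  choose U hU using key
  have hm : ∀ {w : ℝ → ℝ → ℝ} {g : EnergySpace → ℝ → ℝ} {M : ℝ}, L2Strip T w M →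
      (∀ t ∈ Icc 0 T, g (U t) = w t) → AEStronglyMeasurable (fun z : ℝ × ℝ => g (U z.1) z.2)
        (volume.restrict (Icc 0 T ×ˢ univ)) := by
    intro w g M hw hg
    have h1 := hw.meas
    rw [stripMeasure_eq] at h1
    refine h1.congr ?_
    rw [Filter.EventuallyEq, ae_restrict_iff' (measurableSet_Icc.prod MeasurableSet.univ)]
    exact Eventually.of_forall fun z hz => by rw [hg z.1 hz.1]
  refine ⟨U, ⟨hm (g := fun v => v.Lam.toFun) hL fun t ht => (hU t ht).1,
    hm (g := fun v => v.Lam.dx) hLx fun t ht => (hU t ht).2.1,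
    hm (g := fun v => v.phi.toFun) hφ fun t ht => (hU t ht).2.2.1,
    hm (g := fun v => v.phi.dx) hφx fun t ht => (hU t ht).2.2.2.1,
    hm (g := fun v => v.Lamt.toFun) hLt fun t ht => (hU t ht).2.2.2.2.1,
    hm (g := fun v => v.phit.toFun) hφt fun t ht => (hU t ht).2.2.2.2.2, ?_⟩, hU⟩
  set M := max M₁ (max M₂ (max M₃ (max M₄ (max M₅ M₆)))) with hM
  refine lt_of_le_of_lt (b := ENNReal.ofReal (4 * M)) ?_ ENNReal.ofReal_lt_top
  refine iSup₂_le fun t ht => ENNReal.ofReal_le_ofReal (EnergySpace.CompLe.norm_le ?_)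
  obtain ⟨h1, h2, h3, h4, h5, h6⟩ := hU t ht
  have k1 := hL.le t ht
  have k2 := hLx.le t ht
  have k3 := hLt.le t ht
  have k4 := hφ.le t ht
  have k5 := hφx.le t ht
  have k6 := hφt.le t ht
  refine ⟨?_, ?_, ?_, ?_, ?_, ?_⟩
  · rw [h1, hM]; simp [k1]
  · rw [h2, hM]; simp [k2]
  · rw [h3, hM]; simp [k4]
  · rw [h4, hM]; simp [k5]
  · rw [h5, hM]; simp [k3]
  · rw [h6, hM]; simp [k6]

theorem continuous_cothTrunc {lam : ℝ} (hlam : 0 < lam) : Continuous (cothTrunc lam) := by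
  obtain ⟨κ, hκ1, -, hκl⟩ := exists_cothTrunc_bound hlam
  refine (LipschitzWith.of_dist_le_mul (K := κ.toNNReal) fun x y => ?_).continuous
  rw [Real.dist_eq, Real.dist_eq, Real.coe_toNNReal _ (by linarith)]
  exact hκl x y

/-- As `|L| ≤ lam / 2`, the truncation is inactive, and the sources produced by the frame are the
nonlinearities: `F₁ = -coth Λ · P₂ Q₂` and `F₂ = coth Λ · (P₁ q + p Q₁)`. The null derivatives and
transport equations are returned as well, since the regularity argument uses them. -/
theorem FrameData.exists_solution {lam T : ℝ} {u : EnergySpace} {A B C D L₀ : ℝ → ℝ}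
    {a b L : ℝ → ℝ → ℝ} (h : FrameData lam u A B C D L₀) (hlam : 0 < lam) (hT : 0 ≤ T)
    (hfr : IsFrame (cothTrunc lam) T A B C D L₀ a b L)
    (hL : ∀ t ∈ Icc 0 T, ∀ x, |L t x| ≤ lam / 2) {φ p q : ℝ → ℝ → ℝ}
    (hp : p = unframe lam L (rot2 1 A B a)) (hq : q = unframe lam L (rot2 (-1) C D b))
    (hφ : φ = fun t x => u.phi.toFun x + ∫ s in (0 : ℝ)..t, 2⁻¹ * (p s x + q s x)) :
    ∃ U : ℝ → EnergySpace, IsSolution lam T u U ∧ MemLinf T U ∧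
      (∀ t ∈ Icc 0 T, (U t).Lam.toFun = L t ∧ (U t).phi.toFun = φ t ∧
        (U t).Lamt.toFun = (fun x => 2⁻¹ * (rot1 1 A B a t x + rot1 (-1) C D b t x)) ∧
        (U t).phit.toFun = fun x => 2⁻¹ * (p t x + q t x)) ∧
      (∀ u, IsPrim T (fun t => L t (u - t)) (fun s => rot1 (-1) C D b s (u - s))) ∧
      (∀ u, IsPrim T (fun t => L t (u + t)) (fun s => rot1 1 A B a s (u + s))) ∧
      MildTransport T 1 φ q ∧ MildTransport T (-1) φ p ∧
      MildTransport T 1 p (fun t x => -(cothTrunc lam (L t x) *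
        (rot1 1 A B a t x * q t x + p t x * rot1 (-1) C D b t x))) ∧
      MildTransport T (-1) q (fun t x => -(cothTrunc lam (L t x) *
        (rot1 1 A B a t x * q t x + p t x * rot1 (-1) C D b t x))) := by
  obtain ⟨κ, -, hκ, -⟩ := exists_cothTrunc_bound hlam
  have hKc := continuous_cothTrunc hlam
  have h0 : (0 : ℝ) ∈ Icc 0 T := ⟨le_rfl, hT⟩
  have hLm : ∀ t ∈ Icc 0 T, ∀ x, lam / 2 ≤ lam + L t x := fun t ht x => by
    linarith [(abs_le.1 (hL t ht x)).1]
  have hL0 : L 0 = L₀ := funext fun x => hfr.L_zero hT x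
  have hP0 : ∀ x, rot1 1 A B a 0 x = A x := fun x => by simp [rot1, hfr.a_zero hT]
  have hQ0 : ∀ x, rot1 (-1) C D b 0 x = C x := fun x => by simp [rot1, hfr.b_zero hT]
  have hp0 : ∀ x, p 0 x = 2⁻¹ * ((Real.sinh (lam + L₀ x))⁻¹ * B x) := fun x => by
    simp [hp, unframe, rot2, hfr.a_zero hT, hL0]
  have hq0 : ∀ x, q 0 x = 2⁻¹ * ((Real.sinh (lam + L₀ x))⁻¹ * D x) := fun x => by
    simp [hq, unframe, rot2, hfr.b_zero hT, hL0]
  have hpos0 : ∀ x, 0 < lam + L₀ x := fun x => by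
    have := hLm 0 h0 x; rw [hL0] at this; linarith
  obtain ⟨sL, dL, wL, iL, ch1, ch2⟩ := hfr.Lam_field hT hKc hκ h.mA h.mB h.mC h.mD h.memLp_A
    h.memLp_B h.memLp_C h.memLp_D h.memLp_L h.hasWeakDeriv_L
  obtain ⟨sφ, ⟨Mp, sp⟩, ⟨Mq, sq⟩, dφ, wφ, iφ, t1, t2, t3, t4⟩ := hfr.phi_field (φ₀ := u.phi.toFun) hT hKc hκ
    (half_pos hlam) hLm
    (fun t ht x => cothTrunc_eq (hL t ht x)) h.mA h.mB h.mC h.mD h.memLp_A h.memLp_B h.memLp_C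
    h.memLp_D u.phi.memLp_toFun (by
      have := h.hasWeakDeriv_phi hpos0
      simp only [← hp0, ← hq0] at this
      rw [← hp, ← hq]
      exact this) ch1 ch2 hp hq hφ
  have sP1 : L2Strip T (rot1 1 A B a) _ := L2Strip.of_bound (c := 1) h.memLp_A h.memLp_B
    (measurable_rot1 h.mA h.mB hfr.cont_a)
    (fun t _ x => (abs_rot1_le t x).trans_eq (one_mul _).symm)
  have sQ1 : L2Strip T (rot1 (-1) C D b) _ := L2Strip.of_bound (c := 1) h.memLp_C h.memLp_D
    (measurable_rot1 h.mC h.mD hfr.cont_b)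
    (fun t _ x => (abs_rot1_le t x).trans_eq (one_mul _).symm)
  obtain ⟨U, hU, hUeq⟩ := exists_curve u sL ⟨_, (sP1.sub sQ1).const_mul 2⁻¹⟩
    ⟨_, (sP1.add sQ1).const_mul 2⁻¹⟩ sφ ⟨_, (sp.sub sq).const_mul 2⁻¹⟩
    ⟨_, (sp.add sq).const_mul 2⁻¹⟩ dL dφ
  have hdbl : ∀ t x, Real.sinh (2 * lam + 2 * L t x) =
      2 * Real.sinh (lam + L t x) * Real.cosh (lam + L t x) := fun t x => by
    rw [← Real.sinh_two_mul]; ring_nf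
  have hN1 : ∀ t ∈ Icc 0 T, N1 lam U t = fun x =>
      -(cothTrunc lam (L t x) * (rot2 1 A B a t x * rot2 (-1) C D b t x)) := by
    intro t ht
    obtain ⟨h1, h2, h3, h4, h5, h6⟩ := hUeq t ht
    funext x
    have hne : Real.sinh (lam + L t x) ≠ 0 :=
      (Real.sinh_pos_iff.2 ((half_pos hlam).trans_le (hLm t ht x))).ne'
    rw [N1, F1, h1, h4, h6, cothTrunc_eq (hL t ht x), hdbl]
    simp only [hp, hq, unframe]
    field_simp
    ring
  have hN2 : ∀ t ∈ Icc 0 T, N2 lam U t = fun x => cothTrunc lam (L t x) *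
      (rot1 1 A B a t x * q t x + p t x * rot1 (-1) C D b t x) := by
    intro t ht
    obtain ⟨h1, h2, h3, h4, h5, h6⟩ := hUeq t ht
    funext x
    have hne : Real.sinh (lam + L t x) ≠ 0 :=
      (Real.sinh_pos_iff.2 ((half_pos hlam).trans_le (hLm t ht x))).ne'
    rw [N2, F2, h1, h2, h4, h5, h6, cothTrunc_eq (hL t ht x), hdbl]
    field_simp
    ring
  refine ⟨U, ⟨⟨?_, ?_, ?_, ?_⟩, fun t ht => Eventually.of_forall fun x => ?_, fun R => ?_,
    fun R => ?_, ?_, ?_⟩, hU, fun t ht => ⟨(hUeq t ht).1, (hUeq t ht).2.2.1, (hUeq t ht).2.2.2.2.1,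
      (hUeq t ht).2.2.2.2.2⟩, ch1, ch2, t1, t2, t3, t4⟩
  · rw [(hUeq 0 h0).1, hL0]; exact h.aeL.symm
  · rw [(hUeq 0 h0).2.2.1, hφ]; exact Eventually.of_forall fun x => by simp
  · rw [(hUeq 0 h0).2.2.2.2.1]
    filter_upwards [h.aeA, h.aeC] with x h1 h2
    rw [hP0, hQ0, h1, h2]; ring
  · rw [(hUeq 0 h0).2.2.2.2.2]
    filter_upwards [h.aeB, h.aeD] with x h1 h2
    have : Real.sinh (lam + L₀ x) ≠ 0 := (Real.sinh_pos_iff.2 (hpos0 x)).ne'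
    rw [hp0, hq0, h1, h2]; field_simp; ring
  · rw [(hUeq t ht).1]
    linarith [hLm t ht x]
  · exact (iL.neg R).congr_fun (fun z hz => by simp only [hN1 z.1 hz.1])
      (measurableSet_Icc.prod measurableSet_Icc)
  · exact (iφ R).congr_fun (fun z hz => by simp only [hN2 z.1 hz.1])
      (measurableSet_Icc.prod measurableSet_Icc)
  · exact wL.congr hT (fun t ht => (hUeq t ht).1) (fun t ht => (hUeq t ht).2.2.2.2.1) hN1
  · exact wφ.congr hT (fun t ht => (hUeq t ht).2.2.1) (fun t ht => (hUeq t ht).2.2.2.2.2) hN2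

/-! ### Every bounded weak solution has characteristic frames -/

theorem _root_.MeasureTheory.AEStronglyMeasurable.strip_shear {T : ℝ} {w : ℝ → ℝ → ℝ}
    (hw : AEStronglyMeasurable (fun z : ℝ × ℝ => w z.1 z.2) (stripMeasure T)) (σ : ℝ) :
    AEStronglyMeasurable (fun z : ℝ × ℝ => w z.1 (z.2 - σ * z.1)) (stripMeasure T) :=
  hw.comp_quasiMeasurePreserving (measurePreserving_shear σ _).quasiMeasurePreserving

theorem isPrim_primitive {T : ℝ} {f : ℝ → ℝ} (hf : IntervalIntegrable f volume 0 T) (c : ℝ) :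
    IsPrim T (fun t => c + ∫ s in (0 : ℝ)..t, f s) f :=
  ⟨hf, fun t _ => by simp⟩

theorem ae_restrict_Icc_of_ae {T : ℝ} {p : ℝ → Prop} (h : ∀ᵐ s ∂volume.restrict (Icc 0 T), p s) :
    ∀ᵐ s, s ∈ Ioc 0 T → p s := by
  filter_upwards [(ae_restrict_iff' measurableSet_Icc).1 h] with s hs h using hs ⟨h.1.le, h.2⟩

/-- A transported quantity agrees along almost every characteristic, at almost every time, with
its primitive. -/
theorem MildTransport.ae_eq_primitive {T σ : ℝ} {w f : ℝ → ℝ → ℝ} (h : MildTransport T σ w f)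
    (hf : LocIntStrip T f) (h0 : AEStronglyMeasurable (w 0) volume)
    (hw : AEStronglyMeasurable (fun z : ℝ × ℝ => w z.1 z.2) (stripMeasure T)) :
    ∀ᵐ u, ∀ᵐ s ∂volume.restrict (Icc 0 T),
      w s (u - σ * s) = w 0 u + ∫ r in (0 : ℝ)..s, f r (u - σ * r) :=
  ae_strip_swap (p := fun s u => w s (u - σ * s) = w 0 u + ∫ r in (0 : ℝ)..s, f r (u - σ * r))
    (ae_strip_of_forall_ae (hw.strip_shear σ)
      (h0.comp_snd.add (aestronglyMeasurable_primitive (f := fun s u => f s (u - σ * s))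
        (hf.shear σ).aestronglyMeasurable)) h)

theorem ae_strip_of_forall_ae_eq_true {T : ℝ} {w : ℝ → ℝ → ℝ} {S : Set ℝ} (hS : MeasurableSet S)
    (hw : AEStronglyMeasurable (fun z : ℝ × ℝ => w z.1 z.2) (stripMeasure T))
    (h : ∀ t ∈ Icc 0 T, ∀ᵐ x, w t x ∈ S) : ∀ᵐ z ∂stripMeasure T, w z.1 z.2 ∈ S := by
  have hg : Measurable (Sᶜ.indicator (fun _ => (1 : ℝ))) := measurable_one.indicator hS.compl
  have := ae_strip_of_forall_ae (g := fun t x => Sᶜ.indicator (fun _ => (1 : ℝ)) (w t x))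
    (h := fun _ _ => 0) (hg.comp_aemeasurable hw.aemeasurable).aestronglyMeasurable
    aestronglyMeasurable_const (fun t ht => by
      filter_upwards [h t ht] with x hx
      simp [hx])
  filter_upwards [this] with z hz
  by_contra hn
  simp [hn] at hz

/-- Along characteristics, the pair `(p, 2 sinh (lam + L) p')` of null derivatives rotates. -/
theorem exists_rotation_angle {T σ lam : ℝ} (hT : 0 ≤ T) {p pφ q qφ L f₁ f₂ : ℝ → ℝ → ℝ}
    (hp : MildTransport T σ p f₁) (hpφ : MildTransport T σ pφ f₂) (hL : MildTransport T σ L q)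
    (ip : LocBddStrip T p) (ipφ : LocBddStrip T pφ) (iL : LocBddStrip T L)
    (mp : LocIntStrip T p) (mpφ : LocIntStrip T pφ) (mL : LocIntStrip T L)
    (iq : LocIntStrip T q) (iqφ : LocIntStrip T qφ) (if₁ : LocIntStrip T f₁)
    (if₂ : LocIntStrip T f₂) (hne : ∀ t ∈ Icc 0 T, ∀ᵐ x, lam + L t x ≠ 0)
    (hf₁ : ∀ t x, f₁ t x = 4 * Real.sinh (lam + L t x) * Real.cosh (lam + L t x) *
      (pφ t x * qφ t x))
    (hf₂ : ∀ t x, f₂ t x = -(Real.cosh (lam + L t x) / Real.sinh (lam + L t x)) *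
      (pφ t x * q t x + qφ t x * p t x)) :
    ∃ a : ℝ → ℝ → ℝ, AEStronglyMeasurable (fun z : ℝ × ℝ => a z.1 z.2) (stripMeasure T) ∧
      (∀ᵐ u, a 0 u = 0 ∧ IsPrim T (fun t => a t (u - σ * t))
        (fun s => 2 * Real.cosh (lam + L s (u - σ * s)) * qφ s (u - σ * s))) ∧
      ∀ t ∈ Icc 0 T, ∀ᵐ x,
        p t x = p 0 (x + σ * t) * Real.cos (a t x) +
          2 * Real.sinh (lam + L 0 (x + σ * t)) * pφ 0 (x + σ * t) * Real.sin (a t x) ∧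
        2 * Real.sinh (lam + L t x) * pφ t x =
          2 * Real.sinh (lam + L 0 (x + σ * t)) * pφ 0 (x + σ * t) * Real.cos (a t x) -
          p 0 (x + σ * t) * Real.sin (a t x) := by
  have h0 : (0 : ℝ) ∈ Icc 0 T := ⟨le_rfl, hT⟩
  -- The version of `L` along the characteristic `u` that is absolutely continuous in time; `L`
  -- agrees with it only almost everywhere.
  set ℓ : ℝ → ℝ → ℝ := fun t u => L 0 u + ∫ s in (0 : ℝ)..t, q s (u - σ * s) with hℓ
  set k : ℝ → ℝ → ℝ := fun s u => 2 * Real.cosh (lam + ℓ s u) * qφ s (u - σ * s) with hk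
  have mℓ : AEStronglyMeasurable (fun z : ℝ × ℝ => ℓ z.1 z.2) (stripMeasure T) :=
    (iL.loc 0 h0).aestronglyMeasurable.comp_snd.add
      (aestronglyMeasurable_primitive (f := fun s u => q s (u - σ * s))
        (iq.shear σ).aestronglyMeasurable)
  have mk : AEStronglyMeasurable (fun z : ℝ × ℝ => k z.1 z.2) (stripMeasure T) := by
    refine AEStronglyMeasurable.mul ?_ (iqφ.shear σ).aestronglyMeasurable
    exact (by fun_prop : Continuous fun y : ℝ => 2 * Real.cosh (lam + y)).comp_aestronglyMeasurable mℓ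
  set a : ℝ → ℝ → ℝ := fun t x => ∫ s in (0 : ℝ)..t, k s (x - -σ * t) with ha
  have hau : ∀ t u, a t (u - σ * t) = ∫ s in (0 : ℝ)..t, k s u := fun t u => by
    simp only [ha]; ring_nf
  -- Almost every characteristic meets the set `lam + L = 0` in a null set of times. This suffices:
  -- `f₂` only occurs multiplied by `sinh (lam + L)`, so no lower bound on `|lam + L|` is needed.
  have hneS : ∀ᵐ u, ∀ᵐ s ∂volume.restrict (Icc 0 T), lam + L s (u - σ * s) ≠ 0 := by
    have h1 := ae_strip_of_forall_ae_eq_true (w := fun t x => lam + L t x)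
      (measurableSet_singleton (0 : ℝ)).compl (aestronglyMeasurable_const.add mL.aestronglyMeasurable) hne
    exact ae_strip_swap (p := fun s u => lam + L s (u - σ * s) ≠ 0)
      ((measurePreserving_shear σ _).quasiMeasurePreserving.ae h1)
  have hall : ∀ᵐ u, IsPrim T (fun t => a t (u - σ * t))
        (fun s => 2 * Real.cosh (lam + L s (u - σ * s)) * qφ s (u - σ * s)) ∧
      ∀ t ∈ Icc 0 T,
        p 0 u + ∫ r in (0 : ℝ)..t, f₁ r (u - σ * r) = p 0 u * Real.cos (a t (u - σ * t)) +
          2 * Real.sinh (lam + L 0 u) * pφ 0 u * Real.sin (a t (u - σ * t)) ∧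
        2 * Real.sinh (lam + ℓ t u) * (pφ 0 u + ∫ r in (0 : ℝ)..t, f₂ r (u - σ * r)) =
          2 * Real.sinh (lam + L 0 u) * pφ 0 u * Real.cos (a t (u - σ * t)) -
          p 0 u * Real.sin (a t (u - σ * t)) := by
    filter_upwards [(if₁.shear σ).ae_intervalIntegrable hT, (if₂.shear σ).ae_intervalIntegrable hT,
      (iq.shear σ).ae_intervalIntegrable hT, (iqφ.shear σ).ae_intervalIntegrable hT,
      hp.ae_eq_primitive if₁ (ip.loc 0 h0).aestronglyMeasurable mp.aestronglyMeasurable,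
      hpφ.ae_eq_primitive if₂ (ipφ.loc 0 h0).aestronglyMeasurable mpφ.aestronglyMeasurable,
      hL.ae_eq_primitive iq (iL.loc 0 h0).aestronglyMeasurable mL.aestronglyMeasurable, hneS]
      with u i1 i2 i3 i4 e1 e2 e3 e4
    have e1 := ae_restrict_Icc_of_ae e1
    have e2 := ae_restrict_Icc_of_ae e2
    have e3 := ae_restrict_Icc_of_ae e3
    have e4 := ae_restrict_Icc_of_ae e4
    have P := isPrim_primitive i1 (p 0 u)
    have Pφ := isPrim_primitive i2 (pφ 0 u)
    have Lu : IsPrim T (fun t => ℓ t u) _ := isPrim_primitive i3 (L 0 u)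
    have ik : IntervalIntegrable (fun s => k s u) volume 0 T := by
      refine i4.continuousOn_mul ?_
      have := Lu.continuousOn hT
      rw [uIcc_of_le hT]
      fun_prop
    have θ : IsPrim T (fun t => ∫ s in (0 : ℝ)..t, k s u) (fun s => k s u) := by
      simpa using isPrim_primitive ik 0
    -- The pair `p` and `2 sinh (lam + ℓ) pφ`, each as its primitive along `u`, satisfies the
    -- hypotheses of `rotation_eq` with angular velocity `k`. For the second component the
    -- derivative of `sinh` cancels the term with `q` in `f₂`.
    have hx := P.congr_right (k := fun s => k s u * (2 * (Real.sinh (lam + ℓ s u) *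
        (pφ 0 u + ∫ r in (0 : ℝ)..s, f₂ r (u - σ * r))))) (by
      filter_upwards [e1, e2, e3] with s h1 h2 h3 hs
      rw [← h2 hs, hf₁, h3 hs, hk]
      simp only [hℓ]
      ring) hT
    have hy := ((((Lu.const_add lam).sinh hT).mul Pφ hT).const_mul 2).congr_right
      (k := fun s => -(k s u * (p 0 u + ∫ r in (0 : ℝ)..s, f₁ r (u - σ * r)))) (by
      filter_upwards [e1, e2, e3, e4] with s h1 h2 h3 h4 hs
      have h4 := h4 hs
      rw [← h1 hs, ← h2 hs, hf₂, h3 hs, hk]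
      rw [h3 hs] at h4
      have : Real.sinh (lam + (L 0 u + ∫ r in (0 : ℝ)..s, q r (u - σ * r))) ≠ 0 :=
        fun h => h4 (Real.sinh_eq_zero.1 h)
      simp only [hℓ]
      field_simp
      ring) hT
    refine ⟨?_, fun t ht => ?_⟩
    · simp only [hau]
      exact θ.congr_right (by
        filter_upwards [e3] with s h3 hs
        rw [h3 hs]) hT
    · rw [hau]
      have := rotation_eq hT hx hy θ (by simp) ht
      simp only [intervalIntegral.integral_same, add_zero, hℓ] at this ⊢
      exact ⟨by rw [this.1]; ring, by rw [mul_assoc, this.2]; ring⟩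
  refine ⟨a, ?_, ?_, fun t ht => ?_⟩
  · exact (aestronglyMeasurable_primitive mk).strip_shear (w := fun t x => ∫ s in (0 : ℝ)..t, k s x) (-σ)
  · filter_upwards [hall] with u hu
    exact ⟨by simp [ha], hu.1⟩
  · have hmp := (measurePreserving_add_right volume (σ * t)).quasiMeasurePreserving
    filter_upwards [hmp.ae hall, hmp.ae (hp t ht), hmp.ae (hpφ t ht), hmp.ae (hL t ht)]
      with x h1 h2 h3 h4
    have h1 := h1.2 t ht
    simp only [add_sub_cancel_right] at h1 h2 h3 h4
    simp only [hℓ] at h1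
    rw [← h2, ← h3, ← h4] at h1
    exact h1

/-- The almost everywhere version of `IsFrame`. -/
structure IsWeakFrame (K : ℝ → ℝ) (T : ℝ) (A B C D L₀ : ℝ → ℝ) (a b L : ℝ → ℝ → ℝ) : Prop where
  meas_a : AEStronglyMeasurable (fun z : ℝ × ℝ => a z.1 z.2) (stripMeasure T)
  meas_b : AEStronglyMeasurable (fun z : ℝ × ℝ => b z.1 z.2) (stripMeasure T)
  meas_L : AEStronglyMeasurable (fun z : ℝ × ℝ => L z.1 z.2) (stripMeasure T)
  prim_a : ∀ᵐ u, a 0 u = 0 ∧ IsPrim T (fun t => a t (u - t))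
    (fun s => K (L s (u - s)) * rot2 (-1) C D b s (u - s))
  prim_b : ∀ᵐ u, b 0 u = 0 ∧ IsPrim T (fun t => b t (u + t))
    (fun s => K (L s (u + s)) * rot2 1 A B a s (u + s))
  eq_L : ∀ t ∈ Icc 0 T, ∀ᵐ x, L t x = L₀ x +
    ∫ s in (0 : ℝ)..t, 2⁻¹ * (rot1 1 A B a s x + rot1 (-1) C D b s x)

theorem aestronglyMeasurable_rot {T σ : ℝ} {A B : ℝ → ℝ} {a : ℝ → ℝ → ℝ} (hA : Measurable A)
    (hB : Measurable B)
    (ha : AEStronglyMeasurable (fun z : ℝ × ℝ => a z.1 z.2) (stripMeasure T)) :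
    AEStronglyMeasurable (fun z : ℝ × ℝ => rot1 σ A B a z.1 z.2) (stripMeasure T) ∧
      AEStronglyMeasurable (fun z : ℝ × ℝ => rot2 σ A B a z.1 z.2) (stripMeasure T) := by
  have h1 : AEStronglyMeasurable (fun z : ℝ × ℝ => A (z.2 + σ * z.1)) (stripMeasure T) :=
    (by fun_prop : Measurable fun z : ℝ × ℝ => A (z.2 + σ * z.1)).aestronglyMeasurable
  have h2 : AEStronglyMeasurable (fun z : ℝ × ℝ => B (z.2 + σ * z.1)) (stripMeasure T) :=
    (by fun_prop : Measurable fun z : ℝ × ℝ => B (z.2 + σ * z.1)).aestronglyMeasurable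
  have h3 := Real.continuous_cos.comp_aestronglyMeasurable ha
  have h4 := Real.continuous_sin.comp_aestronglyMeasurable ha
  exact ⟨(h1.mul h3).add (h2.mul h4), (h2.mul h3).sub (h1.mul h4)⟩

theorem MemLinf.l2Strip {T : ℝ} {U : ℝ → EnergySpace} (hU : MemLinf T U) : ∃ M,
    L2Strip T (fun t => (U t).Lam.toFun) M ∧ L2Strip T (fun t => (U t).Lam.dx) M ∧
    L2Strip T (fun t => (U t).phi.toFun) M ∧ L2Strip T (fun t => (U t).phi.dx) M ∧
    L2Strip T (fun t => (U t).Lamt.toFun) M ∧ L2Strip T (fun t => (U t).phit.toFun) M := by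
  have hle : ∀ t ∈ Icc 0 T, (U t).CompLe (linfNorm T U).toReal := by
    intro t ht
    refine (U t).compLe_norm.mono ?_
    have h1 : ENNReal.ofReal (U t).norm ≤ linfNorm T U :=
      le_iSup₂_of_le (f := fun t (_ : t ∈ Icc (0 : ℝ) T) => ENNReal.ofReal (U t).norm) t ht le_rfl
    exact (ENNReal.ofReal_le_iff_le_toReal hU.norm_lt_top.ne).1 h1
  refine ⟨_, ⟨?_, fun t _ => (U t).Lam.memLp_toFun, fun t ht => (hle t ht).Lam⟩,
    ⟨?_, fun t _ => (U t).Lam.memLp_dx, fun t ht => (hle t ht).Lamx⟩,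
    ⟨?_, fun t _ => (U t).phi.memLp_toFun, fun t ht => (hle t ht).phi⟩,
    ⟨?_, fun t _ => (U t).phi.memLp_dx, fun t ht => (hle t ht).phix⟩,
    ⟨?_, fun t _ => (U t).Lamt.memLp_toFun, fun t ht => (hle t ht).Lamt⟩,
    ⟨?_, fun t _ => (U t).phit.memLp_toFun, fun t ht => (hle t ht).phit⟩⟩ <;> rw [stripMeasure_eq]
  exacts [hU.meas_Lam, hU.meas_Lamx, hU.meas_phi, hU.meas_phix, hU.meas_Lamt, hU.meas_phit]

theorem ae_comp_add {p : ℝ → Prop} (h : ∀ᵐ x, p x) (y : ℝ) : ∀ᵐ x, p (x + y) :=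
  (measurePreserving_add_right volume y).quasiMeasurePreserving.ae h

theorem ae_comp_sub {p : ℝ → Prop} (h : ∀ᵐ x, p x) (y : ℝ) : ∀ᵐ x, p (x - y) :=
  (measurePreserving_sub_right volume y).quasiMeasurePreserving.ae h

/-- The null derivatives of `V` are the rotations of their initial values by angles `a`, `b`. -/
structure IsRotated (lam T : ℝ) (V : ℝ → EnergySpace) (A B C D : ℝ → ℝ) (a b : ℝ → ℝ → ℝ) :
    Prop where
  P₁ : ∀ t ∈ Icc 0 T, ∀ᵐ x, (V t).Lamt.toFun x + (V t).Lam.dx x = rot1 1 A B a t x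
  P₂ : ∀ t ∈ Icc 0 T, ∀ᵐ x, 2 * Real.sinh (lam + (V t).Lam.toFun x) *
    ((V t).phit.toFun x + (V t).phi.dx x) = rot2 1 A B a t x
  Q₁ : ∀ t ∈ Icc 0 T, ∀ᵐ x, (V t).Lamt.toFun x - (V t).Lam.dx x = rot1 (-1) C D b t x
  Q₂ : ∀ t ∈ Icc 0 T, ∀ᵐ x, 2 * Real.sinh (lam + (V t).Lam.toFun x) *
    ((V t).phit.toFun x - (V t).phi.dx x) = rot2 (-1) C D b t x

/-- Rewrites the angular velocity, which comes out as `2 cosh Λ` times a null derivative of `φ`, as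
`coth Λ` times a frame component. In that form it involves only the unknowns of the frame system. -/
theorem ae_coef_along {T σ lam : ℝ} {K : ℝ → ℝ} {L q w : ℝ → ℝ → ℝ} (hKm : Measurable K)
    (hK : ∀ t ∈ Icc 0 T, ∀ᵐ x, K (L t x) = Real.cosh (lam + L t x) / Real.sinh (lam + L t x))
    (hne : ∀ t ∈ Icc 0 T, ∀ᵐ x, lam + L t x ≠ 0)
    (mL : AEStronglyMeasurable (fun z : ℝ × ℝ => L z.1 z.2) (stripMeasure T))
    (mq : AEStronglyMeasurable (fun z : ℝ × ℝ => q z.1 z.2) (stripMeasure T))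
    (mw : AEStronglyMeasurable (fun z : ℝ × ℝ => w z.1 z.2) (stripMeasure T))
    (hw : ∀ t ∈ Icc 0 T, ∀ᵐ x, 2 * Real.sinh (lam + L t x) * q t x = w t x) :
    ∀ᵐ u, ∀ᵐ s, s ∈ Ioc 0 T → 2 * Real.cosh (lam + L s (u - σ * s)) * q s (u - σ * s) =
      K (L s (u - σ * s)) * w s (u - σ * s) := by
  have h1 : ∀ᵐ z ∂stripMeasure T, 2 * Real.cosh (lam + L z.1 z.2) * q z.1 z.2 =
      K (L z.1 z.2) * w z.1 z.2 := by
    refine ae_strip_of_forall_ae (g := fun t x => 2 * Real.cosh (lam + L t x) * q t x)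
      (h := fun t x => K (L t x) * w t x) ?_ ?_ fun t ht => ?_
    · exact ((by fun_prop : Continuous fun y : ℝ =>
        2 * Real.cosh (lam + y)).comp_aestronglyMeasurable mL).mul mq
    · exact (hKm.comp_aemeasurable mL.aemeasurable).aestronglyMeasurable.mul mw
    · filter_upwards [hw t ht, hK t ht, hne t ht] with x h1 h2 h3
      have : Real.sinh (lam + L t x) ≠ 0 := fun h => h3 (Real.sinh_eq_zero.1 h)
      rw [h2, ← h1]
      field_simp
  have h2 := ae_strip_swap (p := fun s u => 2 * Real.cosh (lam + L s (u - σ * s)) *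
      q s (u - σ * s) = K (L s (u - σ * s)) * w s (u - σ * s))
    ((measurePreserving_shear σ _).quasiMeasurePreserving.ae h1)
  filter_upwards [h2] with u hu using ae_restrict_Icc_of_ae hu

/-- The mild form of the equations of a solution. -/
theorem IsSolution.transports {lam T : ℝ} {v : EnergySpace} {V : ℝ → EnergySpace} (hT : 0 ≤ T)
    (hV : IsSolution lam T v V) (hb : MemLinf T V) :
    (MildTransport T 1 (fun t x => (V t).Lamt.toFun x + (V t).Lam.dx x) (fun t x => -N1 lam V t x) ∧
      MildTransport T (-1) (fun t x => (V t).Lamt.toFun x - (V t).Lam.dx x)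
        (fun t x => -N1 lam V t x) ∧
      MildTransport T 1 (fun t => (V t).Lam.toFun)
        (fun t x => (V t).Lamt.toFun x - (V t).Lam.dx x) ∧
      MildTransport T (-1) (fun t => (V t).Lam.toFun)
        (fun t x => (V t).Lamt.toFun x + (V t).Lam.dx x) ∧
      MildTransport T 0 (fun t => (V t).Lam.toFun) (fun t => (V t).Lamt.toFun)) ∧
    (MildTransport T 1 (fun t x => (V t).phit.toFun x + (V t).phi.dx x) (fun t x => -N2 lam V t x) ∧
      MildTransport T (-1) (fun t x => (V t).phit.toFun x - (V t).phi.dx x)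
        (fun t x => -N2 lam V t x) ∧
      MildTransport T 1 (fun t => (V t).phi.toFun)
        (fun t x => (V t).phit.toFun x - (V t).phi.dx x) ∧
      MildTransport T (-1) (fun t => (V t).phi.toFun)
        (fun t x => (V t).phit.toFun x + (V t).phi.dx x) ∧
      MildTransport T 0 (fun t => (V t).phi.toFun) (fun t => (V t).phit.toFun)) := by
  obtain ⟨M, s1, s2, s3, s4, s5, s6⟩ := hb.l2Strip
  exact ⟨transports_of_wave hT s1 s2 s5 hV.integrable_N1 (fun t _ => (V t).Lam.hasWeakDeriv)
    hV.wave_Lam, transports_of_wave hT s3 s4 s6 hV.integrable_N2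
    (fun t _ => (V t).phi.hasWeakDeriv) hV.wave_phi⟩

/-- A bounded solution has characteristic frames. -/
theorem IsSolution.exists_isRotated {lam T : ℝ} {v : EnergySpace} {V : ℝ → EnergySpace}
    {A B C D L₀ : ℝ → ℝ} (hT : 0 ≤ T)
    (hV : IsSolution lam T v V) (hb : MemLinf T V) (h : FrameData lam v A B C D L₀) :
    ∃ a b : ℝ → ℝ → ℝ, IsRotated lam T V A B C D a b ∧ ∀ K : ℝ → ℝ, Measurable K →
      (∀ t ∈ Icc 0 T, ∀ᵐ x, K ((V t).Lam.toFun x) =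
        Real.cosh (lam + (V t).Lam.toFun x) / Real.sinh (lam + (V t).Lam.toFun x)) →
      IsWeakFrame K T A B C D L₀ a b (fun t => (V t).Lam.toFun) := by
  have h0 : (0 : ℝ) ∈ Icc 0 T := ⟨le_rfl, hT⟩
  obtain ⟨M, s1, s2, s3, s4, s5, s6⟩ := hb.l2Strip
  obtain ⟨⟨t1, t2, t3, t4, t5⟩, u1, u2, -, -, -⟩ := hV.transports hT hb
  have iN1 : LocIntStrip T (fun t x => -N1 lam V t x) :=
    LocIntStrip.neg (f := N1 lam V) hV.integrable_N1
  have iN2 : LocIntStrip T (fun t x => -N2 lam V t x) :=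
    LocIntStrip.neg (f := N2 lam V) hV.integrable_N2
  have hdbl : ∀ y, Real.sinh (2 * lam + 2 * y) =
      2 * Real.sinh (lam + y) * Real.cosh (lam + y) := fun y => by
    rw [← Real.sinh_two_mul]; ring_nf
  -- If `sinh (lam + y) = 0`, both sides are `0` because division by zero gives `0`; so the identity
  -- holds for every `y`.
  have hdiv : ∀ y, Real.sinh (2 * lam + 2 * y) / Real.sinh (lam + y) ^ 2 =
      2 * (Real.cosh (lam + y) / Real.sinh (lam + y)) := fun y => by
    rw [hdbl]
    rcases eq_or_ne (Real.sinh (lam + y)) 0 with h | h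
    · simp [h]
    · field_simp
  obtain ⟨a, ma, pa, ra⟩ := exists_rotation_angle (lam := lam) hT t1 u1 t3 (s5.add s2).locBdd
    (s6.add s4).locBdd s1.locBdd (s5.add s2).locInt (s6.add s4).locInt s1.locInt (s5.sub s2).locInt
    (s6.sub s4).locInt iN1 iN2 hV.ne_zero (fun t x => by rw [N1, F1, hdbl]; ring)
    (fun t x => by rw [N2, F2, hdiv]; ring)
  obtain ⟨b, mb, pb, rb⟩ := exists_rotation_angle (lam := lam) hT t2 u2 t4 (s5.sub s2).locBdd
    (s6.sub s4).locBdd s1.locBdd (s5.sub s2).locInt (s6.sub s4).locInt s1.locInt (s5.add s2).locInt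
    (s6.add s4).locInt iN1 iN2 hV.ne_zero (fun t x => by rw [N1, F1, hdbl]; ring)
    (fun t x => by rw [N2, F2, hdiv]; ring)
  obtain ⟨e1, e2, e3, e4⟩ := hV.initial
  have d1 : (V 0).Lam.dx =ᵐ[volume] v.Lam.dx :=
    HasWeakDeriv.ae_unique ((V 0).Lam.memLp_dx.locallyIntegrable (by norm_num))
      (v.Lam.memLp_dx.locallyIntegrable (by norm_num)) (V 0).Lam.hasWeakDeriv v.Lam.hasWeakDeriv e1
  have d2 : (V 0).phi.dx =ᵐ[volume] v.phi.dx :=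
    HasWeakDeriv.ae_unique ((V 0).phi.memLp_dx.locallyIntegrable (by norm_num))
      (v.phi.memLp_dx.locallyIntegrable (by norm_num)) (V 0).phi.hasWeakDeriv v.phi.hasWeakDeriv e2
  have i1 : ∀ᵐ x, (V 0).Lam.toFun x = L₀ x := e1.trans h.aeL
  have iA : ∀ᵐ x, (V 0).Lamt.toFun x + (V 0).Lam.dx x = A x := by
    filter_upwards [h.aeA, e3, d1] with x k1 k2 k3; rw [k1, k2, k3]
  have iC : ∀ᵐ x, (V 0).Lamt.toFun x - (V 0).Lam.dx x = C x := by
    filter_upwards [h.aeC, e3, d1] with x k1 k2 k3; rw [k1, k2, k3]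
  have iB : ∀ᵐ x, 2 * Real.sinh (lam + (V 0).Lam.toFun x) *
      ((V 0).phit.toFun x + (V 0).phi.dx x) = B x := by
    filter_upwards [h.aeB, e4, d2, i1] with x k1 k2 k3 k4; rw [k1, k2, k3, k4]
  have iD : ∀ᵐ x, 2 * Real.sinh (lam + (V 0).Lam.toFun x) *
      ((V 0).phit.toFun x - (V 0).phi.dx x) = D x := by
    filter_upwards [h.aeD, e4, d2, i1] with x k1 k2 k3 k4; rw [k1, k2, k3, k4]
  have ka : ∀ t ∈ Icc 0 T, ∀ᵐ x, (V t).Lamt.toFun x + (V t).Lam.dx x = rot1 1 A B a t x ∧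
      2 * Real.sinh (lam + (V t).Lam.toFun x) *
        ((V t).phit.toFun x + (V t).phi.dx x) = rot2 1 A B a t x := fun t ht => by
    filter_upwards [ra t ht, ae_comp_add iA (1 * t), ae_comp_add iB (1 * t)] with x k1 k2 k3
    rw [k2, k3] at k1
    exact k1
  have kb : ∀ t ∈ Icc 0 T, ∀ᵐ x, (V t).Lamt.toFun x - (V t).Lam.dx x = rot1 (-1) C D b t x ∧
      2 * Real.sinh (lam + (V t).Lam.toFun x) *
        ((V t).phit.toFun x - (V t).phi.dx x) = rot2 (-1) C D b t x := fun t ht => by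
    filter_upwards [rb t ht, ae_comp_add iC (-1 * t), ae_comp_add iD (-1 * t)] with x k1 k2 k3
    rw [k2, k3] at k1
    exact k1
  have hrot : IsRotated lam T V A B C D a b :=
    ⟨fun t ht => (ka t ht).mono fun _ h => h.1, fun t ht => (ka t ht).mono fun _ h => h.2,
      fun t ht => (kb t ht).mono fun _ h => h.1, fun t ht => (kb t ht).mono fun _ h => h.2⟩
  -- The coefficient `K` is left open. With `coth` itself one first derives `|Λ̃| ≤ lam / 2`; after
  -- that the truncated coefficient may be inserted with the same angles.
  refine ⟨a, b, hrot, fun K hKm hK => ⟨ma, mb, s1.meas, ?_, ?_, ?_⟩⟩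
  · filter_upwards [pa, ae_coef_along (σ := 1) (q := fun t x => (V t).phit.toFun x - (V t).phi.dx x)
      hKm hK hV.ne_zero s1.meas (s6.sub s4).meas
      (aestronglyMeasurable_rot h.mC h.mD mb).2 hrot.Q₂] with u k1 k2
    have := k1.2.congr_right k2 hT
    simp only [one_mul] at this
    exact ⟨k1.1, this⟩
  · filter_upwards [pb, ae_coef_along (σ := -1) (q := fun t x => (V t).phit.toFun x + (V t).phi.dx x)
      hKm hK hV.ne_zero s1.meas (s6.add s4).meas
      (aestronglyMeasurable_rot h.mA h.mB ma).2 hrot.P₂] with u k1 k2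
    have := k1.2.congr_right k2 hT
    simp only [neg_mul, one_mul, sub_neg_eq_add] at this
    exact ⟨k1.1, this⟩
  · have hv : ∀ᵐ z ∂stripMeasure T, (V z.1).Lamt.toFun z.2 =
        2⁻¹ * (rot1 1 A B a z.1 z.2 + rot1 (-1) C D b z.1 z.2) := by
      refine ae_strip_of_forall_ae (g := fun t => (V t).Lamt.toFun)
        (h := fun t x => 2⁻¹ * (rot1 1 A B a t x + rot1 (-1) C D b t x)) s5.meas
        (((aestronglyMeasurable_rot h.mA h.mB ma).1.add
          (aestronglyMeasurable_rot h.mC h.mD mb).1).const_mul _) fun t ht => ?_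
      filter_upwards [hrot.P₁ t ht, hrot.Q₁ t ht] with x k1 k2
      rw [← k1, ← k2]; ring
    have hv' := ae_strip_swap (p := fun s x => (V s).Lamt.toFun x =
      2⁻¹ * (rot1 1 A B a s x + rot1 (-1) C D b s x)) hv
    intro t ht
    filter_upwards [t5 t ht, hv', i1] with x k1 k2 k3
    simp only [zero_mul, sub_zero] at k1
    rw [k1, k3]
    congr 1
    refine intervalIntegral.integral_congr_ae ?_
    filter_upwards [ae_restrict_Icc_of_ae k2] with s hs h
    rw [uIoc_of_le ht.1] at h
    exact hs ⟨h.1, h.2.trans ht.2⟩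

/-! ### Lipschitz dependence of weak frames on their data -/

/-- Each product is split so that the difference of coefficients multiplies the first vector only,
and the difference of vectors is multiplied by a coefficient bounded by `κ`. Smallness is therefore
required of one of the two data sets only. -/
theorem rot_diff_le {κ δ k k' y y' A A' B B' : ℝ} (hk : |k'| ≤ κ)
    (hc : |k * Real.cos y - k' * Real.cos y'| ≤ 2 * κ * δ)
    (hs : |k * Real.sin y - k' * Real.sin y'| ≤ 2 * κ * δ) :
    |k * (B * Real.cos y - A * Real.sin y) - k' * (B' * Real.cos y' - A' * Real.sin y')| ≤
        2 * κ * δ * (|A| + |B|) + κ * (|A - A'| + |B - B'|) ∧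
      |k * (A * Real.cos y + B * Real.sin y) - k' * (A' * Real.cos y' + B' * Real.sin y')| ≤
        2 * κ * δ * (|A| + |B|) + κ * (|A - A'| + |B - B'|) := by
  have hm : ∀ {x z c w : ℝ}, |x| ≤ c → |z| ≤ w → |x * z| ≤ c * w := fun h1 h2 => by
    rw [abs_mul]; exact mul_le_mul h1 h2 (abs_nonneg _) ((abs_nonneg _).trans h1)
  have kc : |k' * Real.cos y'| ≤ κ := (hm hk (Real.abs_cos_le_one _)).trans_eq (mul_one _)
  have ks : |k' * Real.sin y'| ≤ κ := (hm hk (Real.abs_sin_le_one _)).trans_eq (mul_one _)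
  have a1 := abs_le.1 (hm hc (le_refl |A|))
  have a2 := abs_le.1 (hm hs (le_refl |A|))
  have a3 := abs_le.1 (hm hc (le_refl |B|))
  have a4 := abs_le.1 (hm hs (le_refl |B|))
  have b1 := abs_le.1 (hm kc (le_refl |A - A'|))
  have b2 := abs_le.1 (hm ks (le_refl |A - A'|))
  have b3 := abs_le.1 (hm kc (le_refl |B - B'|))
  have b4 := abs_le.1 (hm ks (le_refl |B - B'|))
  constructor <;> refine abs_le.2 ⟨?_, ?_⟩ <;> linarith

theorem locIntStrip_rot {T σ : ℝ} {A B : ℝ → ℝ} {a : ℝ → ℝ → ℝ} (hA : Measurable A)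
    (hB : Measurable B) (iA : MemLp A 2 volume) (iB : MemLp B 2 volume)
    (ha : AEStronglyMeasurable (fun z : ℝ × ℝ => a z.1 z.2) (stripMeasure T)) :
    LocIntStrip T (rot1 σ A B a) := by
  have hG : L2Strip T (fun t x => |A (x + σ * t)| + |B (x + σ * t)|) _ :=
    L2Strip.of_bound (c := 1) (σ := σ) iA iB (by fun_prop) (fun t _ x => by
      rw [one_mul, abs_of_nonneg (by positivity)])
  intro R
  refine (hG.locInt R).mono' ?_ (Eventually.of_forall fun z => abs_rot1_le _ _)
  have := (aestronglyMeasurable_rot (σ := σ) hA hB ha).1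
  rw [stripMeasure_eq] at this
  exact this.mono_measure (Measure.restrict_mono (prod_mono subset_rfl (subset_univ _)) le_rfl)

theorem ae_along {T : ℝ} {p : ℝ → ℝ → Prop} (h : ∀ᵐ z ∂stripMeasure T, p z.1 z.2) (σ : ℝ) :
    ∀ᵐ u, ∀ᵐ s, s ∈ Ioc 0 T → p s (u - σ * s) := by
  have h2 := ae_strip_swap (p := fun s u => p s (u - σ * s))
    ((measurePreserving_shear σ _).quasiMeasurePreserving.ae h)
  filter_upwards [h2] with u hu using ae_restrict_Icc_of_ae hu

/-- If `|f - f'|` is bounded by transported `L²` functions, so is the difference of primitives. -/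
theorem abs_integral_sub_le {T c κ ρ : ℝ} {F G F' G' f f' : ℝ → ℝ} (hc : 0 ≤ c) (hκ : 0 ≤ κ)
    (hF : MemLp F 2 volume) (hG : MemLp G 2 volume) (hF' : MemLp F' 2 volume)
    (hG' : MemLp G' 2 volume) (hρ : 1 ≤ |ρ|) (u : ℝ) {t : ℝ} (ht : t ∈ Icc 0 T)
    (hf : ∀ᵐ s, s ∈ Ioc 0 T → |f s - f' s| ≤ c * (|F (u + ρ * s)| + |G (u + ρ * s)|) +
      κ * (|F (u + ρ * s) - F' (u + ρ * s)| + |G (u + ρ * s) - G' (u + ρ * s)|)) :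
    |∫ s in (0 : ℝ)..t, (f s - f' s)| ≤ √T * (c * (l2norm F + l2norm G) +
      κ * (l2norm (fun x => F x - F' x) + l2norm fun x => G x - G' x)) := by
  have hρ0 : ρ ≠ 0 := by rintro rfl; norm_num at hρ
  have i : ∀ {g : ℝ → ℝ}, MemLp g 2 volume →
      IntervalIntegrable (fun s => |g (u + ρ * s)|) volume 0 t := fun hg =>
    (memLp_intervalIntegrable (memLp_comp_affine hg u hρ0) 0 t).abs
  have i1 := i hF
  have i2 := i hG
  have i3 := i (hF.sub hF')
  have i4 := i (hG.sub hG')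
  have e1 := integral_abs_affine_le hF hρ u ht.1 ht.2
  have e2 := integral_abs_affine_le hG hρ u ht.1 ht.2
  have e3 := integral_abs_affine_le (hF.sub hF') hρ u ht.1 ht.2
  have e4 := integral_abs_affine_le (hG.sub hG') hρ u ht.1 ht.2
  simp only [Pi.sub_apply] at i3 i4 e3 e4
  rw [← Real.norm_eq_abs]
  refine (intervalIntegral.norm_integral_le_of_norm_le ht.1 (by
    filter_upwards [hf] with s hs h using hs ⟨h.1, h.2.trans ht.2⟩)
    (((i1.add i2).const_mul c).add ((i3.add i4).const_mul κ))).trans ?_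
  rw [intervalIntegral.integral_add ((i1.add i2).const_mul c) ((i3.add i4).const_mul κ),
    intervalIntegral.integral_const_mul, intervalIntegral.integral_const_mul,
    intervalIntegral.integral_add i1 i2, intervalIntegral.integral_add i3 i4]
  have k1 := mul_le_mul_of_nonneg_left (add_le_add e1 e2) hc
  have k2 := mul_le_mul_of_nonneg_left (add_le_add e3 e4) hκ
  refine (add_le_add k1 k2).trans (le_of_eq ?_)
  simp only [l2norm, show (F - F') = fun x => F x - F' x from rfl,
    show (G - G') = fun x => G x - G' x from rfl]
  ring

/-- Two weak frames with coefficients `K`, and a bound for the differences of their data. -/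
structure FramePair (K : ℝ → ℝ) (κ T ε : ℝ) (A B C D L₀ A' B' C' D' L₀' : ℝ → ℝ)
    (a b L a' b' L' : ℝ → ℝ → ℝ) : Prop where
  hT : 0 ≤ T
  one_le : 1 ≤ κ
  bdd : ∀ z, |K z| ≤ κ
  lip : ∀ z z', |K z - K z'| ≤ κ * |z - z'|
  frame : IsWeakFrame K T A B C D L₀ a b L
  frame' : IsWeakFrame K T A' B' C' D' L₀' a' b' L'
  mA : Measurable A
  mB : Measurable B
  mC : Measurable C
  mD : Measurable D
  mA' : Measurable A'
  mB' : Measurable B'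
  mC' : Measurable C'
  mD' : Measurable D'
  hA : MemLp A 2 volume
  hB : MemLp B 2 volume
  hC : MemLp C 2 volume
  hD : MemLp D 2 volume
  hA' : MemLp A' 2 volume
  hB' : MemLp B' 2 volume
  hC' : MemLp C' 2 volume
  hD' : MemLp D' 2 volume
  small : 2 * κ * (√T * (l2norm A + l2norm B + l2norm C + l2norm D)) ≤ 1 / 2
  le : ∀ x, |L₀ x - L₀' x| + κ * (√T * ((l2norm (fun x => A x - A' x) +
    l2norm fun x => B x - B' x) + (l2norm (fun x => C x - C' x) +
    l2norm fun x => D x - D' x))) ≤ ε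

/-- Pointwise closeness of two rotated pairs. -/
def RotClose (K : ℝ → ℝ) (κ δ σ : ℝ) (A B A' B' : ℝ → ℝ) (a L a' L' : ℝ → ℝ → ℝ) (t x : ℝ) :
    Prop :=
  |K (L t x) * rot2 σ A B a t x - K (L' t x) * rot2 σ A' B' a' t x| ≤
      2 * κ * δ * (|A (x + σ * t)| + |B (x + σ * t)|) +
      κ * (|A (x + σ * t) - A' (x + σ * t)| + |B (x + σ * t) - B' (x + σ * t)|) ∧
    |rot1 σ A B a t x - rot1 σ A' B' a' t x| ≤
      2 * κ * δ * (|A (x + σ * t)| + |B (x + σ * t)|) +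
      κ * (|A (x + σ * t) - A' (x + σ * t)| + |B (x + σ * t) - B' (x + σ * t)|)

namespace FramePair

variable {K : ℝ → ℝ} {κ T ε δ : ℝ} {A B C D L₀ A' B' C' D' L₀' : ℝ → ℝ}
    {a b L a' b' L' : ℝ → ℝ → ℝ}

/-- One step of the contraction argument. -/
theorem improve (h : FramePair K κ T ε A B C D L₀ A' B' C' D' L₀' a b L a' b' L') (hδ : 0 ≤ δ)
    (hd : ∀ᵐ z ∂stripMeasure T, (|a z.1 z.2 - a' z.1 z.2| ≤ δ ∧ |b z.1 z.2 - b' z.1 z.2| ≤ δ ∧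
      |L z.1 z.2 - L' z.1 z.2| ≤ δ) ∨ δ = 1) :
    ∀ t ∈ Icc 0 T, ∀ᵐ x, |a t x - a' t x| ≤ δ / 2 + ε ∧ |b t x - b' t x| ≤ δ / 2 + ε ∧
      |L t x - L' t x| ≤ δ / 2 + ε := by
  have hκ0 : 0 ≤ κ := zero_le_one.trans h.one_le
  have hone : 2 * 1 * δ ≤ 2 * κ * δ := by nlinarith [h.one_le]
  -- The alternative `δ = 1` starts the iteration. Nothing is known yet about `a - a'`, but the
  -- coefficients `K cos` and `K sin` are bounded by `κ` and so differ by at most `2 κ`.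
  have htriv : ∀ {k k' c c' : ℝ}, |k| ≤ κ → |k'| ≤ κ → |c| ≤ 1 → |c'| ≤ 1 →
      |k * c - k' * c'| ≤ 2 * κ * 1 := fun h1 h2 h3 h4 => by
    refine (abs_sub _ _).trans ?_
    rw [abs_mul, abs_mul]
    nlinarith [mul_le_mul h1 h3 (abs_nonneg _) hκ0, mul_le_mul h2 h4 (abs_nonneg _) hκ0]
  have key : ∀ {k k' y y' : ℝ}, (|y - y'| ≤ δ ∧ |k - k'| ≤ δ) ∨ δ = 1 →
      |K k * Real.cos y - K k' * Real.cos y'| ≤ 2 * κ * δ ∧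
      |K k * Real.sin y - K k' * Real.sin y'| ≤ 2 * κ * δ ∧
      |1 * Real.cos y - 1 * Real.cos y'| ≤ 2 * κ * δ ∧
      |1 * Real.sin y - 1 * Real.sin y'| ≤ 2 * κ * δ := by
    rintro k k' y y' (⟨h1, h2⟩ | rfl)
    · refine ⟨coef_diff h.one_le h.bdd h.lip Real.abs_cos_le_one abs_cos_sub_cos_le h2 h1,
        coef_diff h.one_le h.bdd h.lip Real.abs_sin_le_one abs_sin_sub_sin_le h2 h1, ?_, ?_⟩
      · rw [one_mul, one_mul]
        linarith [abs_cos_sub_cos_le y y']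
      · rw [one_mul, one_mul]
        linarith [abs_sin_sub_sin_le y y']
    · have h1 : |(1 : ℝ)| ≤ κ := by rw [abs_one]; exact h.one_le
      exact ⟨htriv (h.bdd _) (h.bdd _) (Real.abs_cos_le_one _) (Real.abs_cos_le_one _),
        htriv (h.bdd _) (h.bdd _) (Real.abs_sin_le_one _) (Real.abs_sin_le_one _),
        htriv h1 h1 (Real.abs_cos_le_one _) (Real.abs_cos_le_one _),
        htriv h1 h1 (Real.abs_sin_le_one _) (Real.abs_sin_le_one _)⟩
  have h1κ : |(1 : ℝ)| ≤ κ := by rw [abs_one]; exact h.one_le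
  have hc : 0 ≤ 2 * κ * δ := by positivity
  have hs0 : 0 ≤ √T := Real.sqrt_nonneg _
  have n1 := l2norm_nonneg A
  have n2 := l2norm_nonneg B
  have n3 := l2norm_nonneg C
  have n4 := l2norm_nonneg D
  have n5 := l2norm_nonneg (fun x => A x - A' x)
  have n6 := l2norm_nonneg (fun x => B x - B' x)
  have n7 := l2norm_nonneg (fun x => C x - C' x)
  have n8 := l2norm_nonneg (fun x => D x - D' x)
  -- The contraction factor `1 / 2`; the remaining terms come from the differences of the data and
  -- are bounded by `ε`.
  have hsm : √T * (2 * κ * δ * (l2norm A + l2norm B + l2norm C + l2norm D)) ≤ δ / 2 := by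
    have := mul_le_mul_of_nonneg_right h.small hδ
    linarith
  have hε := h.le
  have sAB : √T * (2 * κ * δ * (l2norm A + l2norm B) + κ * (l2norm (fun x => A x - A' x) +
      l2norm fun x => B x - B' x)) + √T * (2 * κ * δ * (l2norm C + l2norm D) +
      κ * (l2norm (fun x => C x - C' x) + l2norm fun x => D x - D' x)) =
      √T * (2 * κ * δ * (l2norm A + l2norm B + l2norm C + l2norm D)) +
      κ * (√T * ((l2norm (fun x => A x - A' x) +
    l2norm fun x => B x - B' x) + (l2norm (fun x => C x - C' x) +
    l2norm fun x => D x - D' x))) := by ring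
  have pAB : 0 ≤ √T * (2 * κ * δ * (l2norm A + l2norm B) + κ * (l2norm (fun x => A x - A' x) +
      l2norm fun x => B x - B' x)) := by positivity
  have pCD : 0 ≤ √T * (2 * κ * δ * (l2norm C + l2norm D) +
      κ * (l2norm (fun x => C x - C' x) + l2norm fun x => D x - D' x)) := by positivity
  have hAB : ∀ᵐ z ∂stripMeasure T, RotClose K κ δ 1 A B A' B' a L a' L' z.1 z.2 := by
    filter_upwards [hd] with z hz
    obtain ⟨k1, k2, k3, k4⟩ := key (k := L z.1 z.2) (k' := L' z.1 z.2) (y := a z.1 z.2)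
      (y' := a' z.1 z.2) (hz.imp_left fun h => ⟨h.1, h.2.2⟩)
    have h2 := (rot_diff_le (A := A (z.2 + 1 * z.1)) (B := B (z.2 + 1 * z.1))
      (A' := A' (z.2 + 1 * z.1)) (B' := B' (z.2 + 1 * z.1)) h1κ k3 k4).2
    exact ⟨(rot_diff_le (h.bdd _) k1 k2).1, by simpa only [one_mul, rot1] using h2⟩
  have hCD : ∀ᵐ z ∂stripMeasure T, RotClose K κ δ (-1) C D C' D' b L b' L' z.1 z.2 := by
    filter_upwards [hd] with z hz
    obtain ⟨k1, k2, k3, k4⟩ := key (k := L z.1 z.2) (k' := L' z.1 z.2) (y := b z.1 z.2)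
      (y' := b' z.1 z.2) (hz.imp_left fun h => ⟨h.2.1, h.2.2⟩)
    have h2 := (rot_diff_le (A := C (z.2 + -1 * z.1)) (B := D (z.2 + -1 * z.1))
      (A' := C' (z.2 + -1 * z.1)) (B' := D' (z.2 + -1 * z.1)) h1κ k3 k4).2
    rw [one_mul, one_mul] at h2
    exact ⟨(rot_diff_le (h.bdd _) k1 k2).1, h2⟩
  have ba : ∀ᵐ u, ∀ t ∈ Icc 0 T, |a t (u - t) - a' t (u - t)| ≤ δ / 2 + ε := by
    filter_upwards [h.frame.prim_a, h.frame'.prim_a, ae_along hCD 1] with u h1 h2 h3 t ht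
    have e := (h1.2.sub h2.2).eq t ht
    simp only [sub_zero, h1.1, h2.1, zero_add] at e
    rw [e]
    refine (abs_integral_sub_le (ρ := -2) hc hκ0 h.hC h.hD h.hC' h.hD' (by norm_num) u ht ?_).trans ?_
    · filter_upwards [h3] with s hs hm
      have := (hs hm).1
      simp only [one_mul, show u - s + -1 * s = u + -2 * s by ring] at this
      exact this
    · linarith [h.le 0, abs_nonneg (L₀ 0 - L₀' 0)]
  have bb : ∀ᵐ u, ∀ t ∈ Icc 0 T, |b t (u + t) - b' t (u + t)| ≤ δ / 2 + ε := by
    filter_upwards [h.frame.prim_b, h.frame'.prim_b, ae_along hAB (-1)] with u h1 h2 h3 t ht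
    have e := (h1.2.sub h2.2).eq t ht
    simp only [add_zero, h1.1, h2.1, zero_add, sub_zero] at e
    rw [e]
    refine (abs_integral_sub_le (ρ := 2) hc hκ0 h.hA h.hB h.hA' h.hB' (by norm_num) u ht ?_).trans ?_
    · filter_upwards [h3] with s hs hm
      have := (hs hm).1
      simp only [neg_mul, one_mul, sub_neg_eq_add, show u + s + s = u + 2 * s by ring] at this
      exact this
    · linarith [h.le 0, abs_nonneg (L₀ 0 - L₀' 0)]
  intro t ht
  have i1 := locIntStrip_rot (σ := 1) h.mA h.mB h.hA h.hB h.frame.meas_a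
  have i2 := locIntStrip_rot (σ := 1) h.mA' h.mB' h.hA' h.hB' h.frame'.meas_a
  have i3 := locIntStrip_rot (σ := -1) h.mC h.mD h.hC h.hD h.frame.meas_b
  have i4 := locIntStrip_rot (σ := -1) h.mC' h.mD' h.hC' h.hD' h.frame'.meas_b
  have hmono : ∀ {g : ℝ → ℝ}, IntervalIntegrable g volume 0 T → IntervalIntegrable g volume 0 t :=
    fun hg => hg.mono_set (by
      rw [uIcc_of_le h.hT, uIcc_of_le ht.1]; exact Icc_subset_Icc_right ht.2)
  filter_upwards [ae_comp_add ba t, ae_comp_sub bb t, h.frame.eq_L t ht, h.frame'.eq_L t ht,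
    ae_along hAB 0, ae_along hCD 0, i1.ae_intervalIntegrable h.hT, i2.ae_intervalIntegrable h.hT,
    i3.ae_intervalIntegrable h.hT, i4.ae_intervalIntegrable h.hT]
    with x h1 h2 h3 h4 h5 h6 j1 j2 j3 j4
  have h1 := h1 t ht
  have h2 := h2 t ht
  rw [add_sub_cancel_right] at h1
  rw [sub_add_cancel] at h2
  refine ⟨h1, h2, ?_⟩
  have j1 := hmono j1
  have j2 := hmono j2
  have j3 := hmono j3
  have j4 := hmono j4
  have k1 := abs_integral_sub_le (ρ := 1) (f := fun s => rot1 1 A B a s x)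
    (f' := fun s => rot1 1 A' B' a' s x) hc hκ0 h.hA h.hB h.hA' h.hB' (by norm_num) x ht (by
    filter_upwards [h5] with s hs hm
    have := (hs hm).2
    simp only [zero_mul, sub_zero] at this
    exact this)
  have k2 := abs_integral_sub_le (ρ := -1) (f := fun s => rot1 (-1) C D b s x)
    (f' := fun s => rot1 (-1) C' D' b' s x) hc hκ0 h.hC h.hD h.hC' h.hD' (by norm_num) x ht (by
    filter_upwards [h6] with s hs hm
    have := (hs hm).2
    simp only [zero_mul, sub_zero] at this
    exact this)
  rw [intervalIntegral.integral_sub j1 j2] at k1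
  rw [intervalIntegral.integral_sub j3 j4] at k2
  rw [h3, h4, intervalIntegral.integral_const_mul, intervalIntegral.integral_const_mul,
    intervalIntegral.integral_add j1 j3, intervalIntegral.integral_add j2 j4]
  have k1 := abs_le.1 k1
  have k2 := abs_le.1 k2
  have k3 := abs_le.1 (le_refl |L₀ x - L₀' x|)
  have k4 := h.le x
  refine abs_le.2 ⟨?_, ?_⟩ <;> linarith

/-- The differences of the angles and of `L` are controlled by the differences of the data. -/
theorem bound (h : FramePair K κ T ε A B C D L₀ A' B' C' D' L₀' a b L a' b' L') :
    ∀ t ∈ Icc 0 T, ∀ᵐ x, |a t x - a' t x| ≤ 2 * ε ∧ |b t x - b' t x| ≤ 2 * ε ∧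
      |L t x - L' t x| ≤ 2 * ε := by
  have hε : 0 ≤ ε := by
    refine le_trans ?_ (h.le 0)
    have := l2norm_nonneg (fun x => A x - A' x)
    have := l2norm_nonneg (fun x => B x - B' x)
    have := l2norm_nonneg (fun x => C x - C' x)
    have := l2norm_nonneg (fun x => D x - D' x)
    have := h.one_le
    positivity
  have hstrip : ∀ {w : ℝ → ℝ → ℝ} {δ : ℝ},
      AEStronglyMeasurable (fun z : ℝ × ℝ => w z.1 z.2) (stripMeasure T) →
      (∀ t ∈ Icc 0 T, ∀ᵐ x, |w t x| ≤ δ) → ∀ᵐ z ∂stripMeasure T, |w z.1 z.2| ≤ δ :=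
    fun {w δ} hw hb => ae_strip_of_forall_ae_eq_true (S := {y | |y| ≤ δ})
      (isClosed_le continuous_abs continuous_const).measurableSet hw hb
  have ma := h.frame.meas_a.sub h.frame'.meas_a
  have mb := h.frame.meas_b.sub h.frame'.meas_b
  have mL := h.frame.meas_L.sub h.frame'.meas_L
  -- Iteration of `δ ↦ δ / 2 + ε`, whose fixed point is `2 ε`. This avoids the supremum of the
  -- differences of the angles, which is not known in advance to be finite.
  have main : ∀ n : ℕ, ∃ δ, 0 ≤ δ ∧ δ ≤ 2 * ε + (1 / 2) ^ n * (1 + 2 * ε) ∧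
      ∀ t ∈ Icc 0 T, ∀ᵐ x, |a t x - a' t x| ≤ δ ∧ |b t x - b' t x| ≤ δ ∧ |L t x - L' t x| ≤ δ := by
    intro n
    induction n with
    | zero =>
      exact ⟨1 / 2 + ε, by positivity, by rw [pow_zero]; linarith,
        h.improve zero_le_one (Eventually.of_forall fun _ => Or.inr rfl)⟩
    | succ n ih =>
      obtain ⟨δ, h0, h1, h2⟩ := ih
      refine ⟨δ / 2 + ε, by positivity, by rw [pow_succ]; linarith, h.improve h0 ?_⟩
      filter_upwards [hstrip (w := fun t x => a t x - a' t x) ma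
          fun t ht => (h2 t ht).mono fun _ h => h.1,
        hstrip (w := fun t x => b t x - b' t x) mb
          fun t ht => (h2 t ht).mono fun _ h => h.2.1,
        hstrip (w := fun t x => L t x - L' t x) mL
          fun t ht => (h2 t ht).mono fun _ h => h.2.2] with z k1 k2 k3
      exact Or.inl ⟨k1, k2, k3⟩
  intro t ht
  choose δ _ hδ2 hδ3 using main
  filter_upwards [ae_all_iff.2 fun n => hδ3 n t ht] with x hx
  have hlim : Tendsto (fun n : ℕ => 2 * ε + (1 / 2 : ℝ) ^ n * (1 + 2 * ε)) atTop (𝓝 (2 * ε)) := by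
    have := ((tendsto_pow_atTop_nhds_zero_of_lt_one (by norm_num : (0 : ℝ) ≤ 1 / 2)
      (by norm_num)).mul_const (1 + 2 * ε)).const_add (2 * ε)
    simpa using this
  exact ⟨ge_of_tendsto' hlim fun n => (hx n).1.trans (hδ2 n),
    ge_of_tendsto' hlim fun n => (hx n).2.1.trans (hδ2 n),
    ge_of_tendsto' hlim fun n => (hx n).2.2.trans (hδ2 n)⟩

end FramePair

theorem abs_sinh_sub_sinh_le {M x y : ℝ} (hx : |x| ≤ M) (hy : |y| ≤ M) :
    |Real.sinh x - Real.sinh y| ≤ Real.cosh M * |x - y| := by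
  refine (convex_Icc (-M) M).norm_image_sub_le_of_norm_hasDerivWithin_le (f := Real.sinh)
    (f' := Real.cosh) (fun z _ => (Real.hasDerivAt_sinh z).hasDerivWithinAt) (fun z hz => ?_)
    (abs_le.1 hy) (abs_le.1 hx)
  rw [Real.norm_eq_abs, abs_of_pos (Real.cosh_pos z), Real.cosh_le_cosh]
  exact (abs_le.2 hz).trans (le_abs_self M)

/-- An `L²` bound from a pointwise bound by two functions. -/
theorem l2norm_le_of_abs_le {f g h : ℝ → ℝ} {c d : ℝ} (hc : 0 ≤ c) (hd : 0 ≤ d)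
    (hg : MemLp g 2 volume) (hh : MemLp h 2 volume)
    (hf : ∀ᵐ x, |f x| ≤ c * |g x| + d * |h x|) :
    l2norm f ≤ c * l2norm g + d * l2norm h := by
  have e : ∀ f : ℝ → ℝ, l2norm |f| = l2norm f := fun f => by
    rw [l2norm, l2norm]; congr 1; exact eLpNorm_norm f
  have m1 : MemLp (fun x => c * |g x|) 2 volume := hg.abs.const_mul c
  have m2 : MemLp (fun x => d * |h x|) 2 volume := hh.abs.const_mul d
  refine (l2norm_mono (m1.add m2) ?_).trans ((l2norm_add_le m1 m2).trans (le_of_eq ?_))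
  · filter_upwards [hf] with x hx
    exact hx.trans (le_abs_self _)
  · rw [l2norm_const_mul, l2norm_const_mul, abs_of_nonneg hc, abs_of_nonneg hd]
    congr 2
    exacts [e g, e h]

/-- The bound for the sum of the norms of the frame data of small elements. -/
noncomputable def frameBound (lam : ℝ) : ℝ :=
  4 * (lam / 6) + 8 * Real.sinh (|lam| + 2 * (lam / 6)) * (lam / 6)

theorem frameBound_nonneg {lam : ℝ} (hlam : 0 < lam) : 0 ≤ frameBound lam := by
  have : 0 ≤ Real.sinh (|lam| + 2 * (lam / 6)) := Real.sinh_nonneg_iff.2 (by positivity)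
  unfold frameBound
  positivity

/-- The equation for `Λ̃` in the frame system only involves rotated data, whose size does not depend
on the possibly unbounded coefficient. So `lam / 3` from Sobolev plus `√T * frameBound lam ≤ lam /
6` bounds `Λ̃` on the whole interval at once, and a weak solution cannot come near `Λ = 0`. -/
theorem IsSolution.ae_abs_Lam_le {lam T : ℝ} {v : EnergySpace} {V : ℝ → EnergySpace}
    (hT : 0 ≤ T) (hv : v.CompLe (lam / 6))
    (hsmall : √T * frameBound lam ≤ lam / 6) (hV : IsSolution lam T v V) (hb : MemLinf T V) :
    ∀ t ∈ Icc 0 T, ∀ᵐ x, |(V t).Lam.toFun x| ≤ lam / 2 := by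
  obtain ⟨A, B, C, D, L₀, h⟩ := exists_frameData lam v
  obtain ⟨a, b, -, hw⟩ := hV.exists_isRotated hT hb h
  have hw := hw (fun z => Real.cosh (lam + z) / Real.sinh (lam + z))
    ((by fun_prop : Continuous fun z => Real.cosh (lam + z)).measurable.div
      (by fun_prop : Continuous fun z => Real.sinh (lam + z)).measurable)
    (fun t _ => Eventually.of_forall fun _ => rfl)
  intro t ht
  filter_upwards [hw.eq_L t ht] with x hx
  rw [hx]
  refine (abs_add_le _ _).trans ?_
  have h1 := h.abs_L_le hv x
  have h2 := abs_integral_rot_le (a := a) (b := b) h.memLp_A h.memLp_B h.memLp_C h.memLp_D ht x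
  have h3 := mul_le_mul_of_nonneg_left (h.l2norm_sum_le hv) (Real.sqrt_nonneg T)
  change _ ≤ √T * frameBound lam at h3
  linarith

theorem measurable_cothTrunc (lam : ℝ) : Measurable (cothTrunc lam) :=
  ((by fun_prop : Continuous fun z => Real.cosh (lam + max (-(lam / 2)) (min z (lam / 2)))).measurable).div
    (by fun_prop : Continuous fun z => Real.sinh (lam + max (-(lam / 2)) (min z (lam / 2)))).measurable

theorem rot_diff_ae {T σ δ r : ℝ} {A A' B B' : ℝ → ℝ} {a a' : ℝ → ℝ → ℝ} (hδ : 0 ≤ δ)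
    (hA : MemLp A 2 volume) (hB : MemLp B 2 volume) (hA' : MemLp A' 2 volume)
    (hB' : MemLp B' 2 volume) {N : ℝ} (hN : l2norm A + l2norm B ≤ N)
    (hr : l2norm (fun x => A x - A' x) + l2norm (fun x => B x - B' x) ≤ r) {t : ℝ}
    (_ht : t ∈ Icc 0 T) (ha : ∀ᵐ x, |a t x - a' t x| ≤ δ) :
    l2norm (fun x => rot1 σ A B a t x - rot1 σ A' B' a' t x) ≤ 2 * δ * N + r ∧
      l2norm (fun x => rot2 σ A B a t x - rot2 σ A' B' a' t x) ≤ 2 * δ * N + r := by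
  have m : ∀ {f : ℝ → ℝ}, MemLp f 2 volume → MemLp (fun x => |f (x + σ * t)|) 2 volume :=
    fun hf => (memLp_comp_add hf (σ * t)).abs
  have e : ∀ f : ℝ → ℝ, l2norm (fun x => |f x|) = l2norm f := fun f => by
    rw [l2norm, l2norm]; congr 1; exact eLpNorm_norm f
  have n : ∀ {f g : ℝ → ℝ}, MemLp f 2 volume → MemLp g 2 volume →
      l2norm (fun x => |f (x + σ * t)| + |g (x + σ * t)|) ≤ l2norm f + l2norm g := fun hf hg => by
    refine (l2norm_add_le (m hf) (m hg)).trans (le_of_eq ?_)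
    rw [e (fun x => _), e (fun x => _), l2norm_comp_add _ hf.1, l2norm_comp_add _ hg.1]
  have n1 := n hA hB
  have n2 := n (hA.sub hA') (hB.sub hB')
  simp only [Pi.sub_apply] at n2
  have n2' : l2norm (fun x => |A (x + σ * t) - A' (x + σ * t)| +
      |B (x + σ * t) - B' (x + σ * t)|) ≤ r := n2.trans hr
  have key : ∀ᵐ x, |rot2 σ A B a t x - rot2 σ A' B' a' t x| ≤
        2 * δ * (|A (x + σ * t)| + |B (x + σ * t)|) +
        1 * (|A (x + σ * t) - A' (x + σ * t)| + |B (x + σ * t) - B' (x + σ * t)|) ∧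
      |rot1 σ A B a t x - rot1 σ A' B' a' t x| ≤
        2 * δ * (|A (x + σ * t)| + |B (x + σ * t)|) +
        1 * (|A (x + σ * t) - A' (x + σ * t)| + |B (x + σ * t) - B' (x + σ * t)|) := by
    filter_upwards [ha] with x hx
    have := rot_diff_le (κ := 1) (δ := δ) (k := 1) (k' := 1) (y := a t x) (y' := a' t x)
      (A := A (x + σ * t)) (A' := A' (x + σ * t)) (B := B (x + σ * t)) (B' := B' (x + σ * t))
      (by simp) (by rw [one_mul, one_mul]; linarith [abs_cos_sub_cos_le (a t x) (a' t x)])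
      (by rw [one_mul, one_mul]; linarith [abs_sin_sub_sin_le (a t x) (a' t x)])
    simpa only [one_mul, mul_one, rot1, rot2] using this
  have h1 : MemLp (fun x => |A (x + σ * t)| + |B (x + σ * t)|) 2 volume := (m hA).add (m hB)
  have h2 : MemLp (fun x => |A (x + σ * t) - A' (x + σ * t)| +
      |B (x + σ * t) - B' (x + σ * t)|) 2 volume := (m (hA.sub hA')).add (m (hB.sub hB'))
  have fin : ∀ {f : ℝ → ℝ}, (∀ᵐ x, |f x| ≤ 2 * δ * (|A (x + σ * t)| + |B (x + σ * t)|) +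
        1 * (|A (x + σ * t) - A' (x + σ * t)| + |B (x + σ * t) - B' (x + σ * t)|)) →
      l2norm f ≤ 2 * δ * N + r := fun {f} hf => by
    refine (l2norm_le_of_abs_le (mul_nonneg zero_le_two hδ) zero_le_one h1 h2 (hf.mono fun x hx => ?_)).trans ?_
    · rw [abs_of_nonneg (add_nonneg (abs_nonneg (A (x + σ * t))) (abs_nonneg (B (x + σ * t)))),
        abs_of_nonneg (add_nonneg (abs_nonneg (A (x + σ * t) - A' (x + σ * t)))
          (abs_nonneg (B (x + σ * t) - B' (x + σ * t))))]
      exact hx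
    · rw [one_mul]
      exact add_le_add (mul_le_mul_of_nonneg_left (n1.trans hN) (mul_nonneg zero_le_two hδ)) n2'
  exact ⟨fin (key.mono fun _ h => h.2), fin (key.mono fun _ h => h.1)⟩

theorem L2Strip.abs_sub_primitive_le {T M r : ℝ} {ψ ψ' w w' : ℝ → ℝ → ℝ}
    (hw : L2Strip T (fun t x => w t x - w' t x) M) (iw : LocIntStrip T w) (iw' : LocIntStrip T w')
    (h : MildTransport T 0 ψ w) (h' : MildTransport T 0 ψ' w')
    (h0 : MemLp (fun x => ψ 0 x - ψ' 0 x) 2 volume) (hr : l2norm (fun x => ψ 0 x - ψ' 0 x) ≤ r)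
    {t : ℝ} (ht : t ∈ Icc 0 T) : l2norm (fun x => ψ t x - ψ' t x) ≤ r + T * M := by
  have hT : 0 ≤ T := ht.1.trans ht.2
  have hp := (hw.primitive h0 hT).le t ht
  refine (le_of_eq (l2norm_congr ?_)).trans (hp.trans (add_le_add hr le_rfl))
  have hmono : ∀ {g : ℝ → ℝ}, IntervalIntegrable g volume 0 T → IntervalIntegrable g volume 0 t :=
    fun hg => hg.mono_set (by
      rw [uIcc_of_le hT, uIcc_of_le ht.1]; exact Icc_subset_Icc_right ht.2)
  filter_upwards [h t ht, h' t ht, iw.ae_intervalIntegrable hT, iw'.ae_intervalIntegrable hT]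
    with x h1 h2 h3 h4
  simp only [zero_mul, sub_zero] at h1 h2
  rw [h1, h2, intervalIntegral.integral_sub (hmono h3) (hmono h4)]
  ring

/-- The data of `P₁`, `Q₁` are linear in the element; those of `P₂`, `Q₂` contain `sinh (lam + L₀)`,
whose argument is at most `2 * lam` in absolute value. There `sinh` is bounded by, and has Lipschitz
constant, `cosh (2 * lam)`. -/
theorem FrameData.sub_le {lam r : ℝ} {u v : EnergySpace} {A B C D L₀ A' B' C' D' L₀' : ℝ → ℝ}
    (hlam : 0 < lam) (h : FrameData lam u A B C D L₀) (h' : FrameData lam v A' B' C' D' L₀')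
    (hu : u.CompLe (lam / 6)) (hv : v.CompLe (lam / 6)) (hr : (u - v).CompLe r) :
    (∀ x, |L₀ x - L₀' x| ≤ 2 * r) ∧ l2norm (fun x => A x - A' x) ≤ 2 * r ∧
      l2norm (fun x => C x - C' x) ≤ 2 * r ∧
      l2norm (fun x => B x - B' x) ≤ 4 * Real.cosh (2 * lam) * (1 + lam) * r ∧
      l2norm (fun x => D x - D' x) ≤ 4 * Real.cosh (2 * lam) * (1 + lam) * r := by
  have hr0 := hr.nonneg
  have hL : ∀ x, |L₀ x - L₀' x| ≤ 2 * r := by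
    intro x
    have hc := h.cont_L.sub h'.cont_L
    have hp : ∀ x y, (L₀ y - L₀' y) - (L₀ x - L₀' x) = ∫ z in x..y, (u - v).Lam.dx z := by
      intro x y
      have e : ∀ z, (u - v).Lam.dx z = u.Lam.dx z - v.Lam.dx z := fun _ => rfl
      simp only [e]
      rw [intervalIntegral.integral_sub (memLp_intervalIntegrable u.Lam.memLp_dx _ _)
        (memLp_intervalIntegrable v.Lam.memLp_dx _ _), ← h.exists_primitive, ← h'.exists_primitive]
      ring
    have hae : (u - v).Lam.toFun =ᵐ[volume] fun x => L₀ x - L₀' x := h.aeL.sub h'.aeL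
    have := abs_le_of_primitive ((u - v).Lam.memLp_toFun.ae_eq hae) (u - v).Lam.memLp_dx hc hp
      one_pos x
    rw [← l2norm_congr hae] at this
    simp only [one_mul, Real.sqrt_one] at this
    linarith [hr.Lam, hr.Lamx]
  have hA : l2norm (fun x => A x - A' x) ≤ 2 * r := by
    have e : (fun x => A x - A' x) =ᵐ[volume]
        fun x => (u - v).Lamt.toFun x + (u - v).Lam.dx x := by
      filter_upwards [h.aeA, h'.aeA] with x h1 h2
      rw [h1, h2]
      change _ = (u.Lamt.toFun x - v.Lamt.toFun x) + (u.Lam.dx x - v.Lam.dx x)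
      ring
    rw [l2norm_congr e]
    linarith [l2norm_add_le (u - v).Lamt.memLp_toFun (u - v).Lam.memLp_dx, hr.Lamt, hr.Lamx]
  have hC : l2norm (fun x => C x - C' x) ≤ 2 * r := by
    have e : (fun x => C x - C' x) =ᵐ[volume]
        fun x => (u - v).Lamt.toFun x - (u - v).Lam.dx x := by
      filter_upwards [h.aeC, h'.aeC] with x h1 h2
      rw [h1, h2]
      change _ = (u.Lamt.toFun x - v.Lamt.toFun x) - (u.Lam.dx x - v.Lam.dx x)
      ring
    rw [l2norm_congr e]
    linarith [l2norm_sub_le (u - v).Lamt.memLp_toFun (u - v).Lam.memLp_dx, hr.Lamt, hr.Lamx]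
  have key : ∀ {E E' w w' : ℝ → ℝ}, MemLp w 2 volume → MemLp w' 2 volume →
      l2norm (fun x => w x - w' x) ≤ 2 * r → l2norm w' ≤ 2 * (lam / 6) →
      (E =ᵐ[volume] fun x => 2 * Real.sinh (lam + L₀ x) * w x) →
      (E' =ᵐ[volume] fun x => 2 * Real.sinh (lam + L₀' x) * w' x) →
      l2norm (fun x => E x - E' x) ≤ 4 * Real.cosh (2 * lam) * (1 + lam) * r := by
    intro E E' w w' mw mw' h1 h2 h3 h4
    set H := Real.cosh (2 * lam) with hH
    have hH0 : 0 < H := Real.cosh_pos _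
    refine (l2norm_le_of_abs_le (c := 2 * H) (d := 4 * H * r) (by positivity) (by positivity)
      (mw.sub mw') mw' ?_).trans ?_
    · filter_upwards [h3, h4] with x k1 k2
      have b1 : |lam + L₀ x| ≤ 2 * lam := by
        refine (abs_add_le _ _).trans ?_
        rw [abs_of_pos hlam]; linarith [h.abs_L_le hu x]
      have b2 : |lam + L₀' x| ≤ 2 * lam := by
        refine (abs_add_le _ _).trans ?_
        rw [abs_of_pos hlam]; linarith [h'.abs_L_le hv x]
      have c1 := abs_sinh_sub_sinh_le b1 b2
      have c2 : |Real.sinh (lam + L₀ x)| ≤ H :=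
        (abs_sinh_le b1).trans (Real.sinh_lt_cosh _).le
      have e : E x - E' x = 2 * Real.sinh (lam + L₀ x) * (w x - w' x) +
          2 * (Real.sinh (lam + L₀ x) - Real.sinh (lam + L₀' x)) * w' x := by
        rw [k1, k2]; ring
      rw [e]
      refine (abs_add_le _ _).trans ?_
      rw [abs_mul, abs_mul, abs_mul, abs_mul, abs_two]
      have c3 : |Real.sinh (lam + L₀ x) - Real.sinh (lam + L₀' x)| ≤ H * (2 * r) := by
        refine c1.trans (mul_le_mul_of_nonneg_left ?_ hH0.le)
        rw [add_sub_add_left_eq_sub]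
        exact hL x
      refine add_le_add (mul_le_mul_of_nonneg_right (by linarith) (abs_nonneg _))
        (mul_le_mul_of_nonneg_right (by linarith) (abs_nonneg _))
    · have k1 : 2 * H * l2norm (w - w') ≤ 2 * H * (2 * r) :=
        mul_le_mul_of_nonneg_left h1 (by positivity)
      have k2 : 4 * H * r * l2norm w' ≤ 4 * H * r * (2 * (lam / 6)) :=
        mul_le_mul_of_nonneg_left h2 (by positivity)
      have : 0 ≤ H * r * lam := by positivity
      nlinarith
  refine ⟨hL, hA, hC, key (u.phit.memLp_toFun.add u.phi.memLp_dx)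
    (v.phit.memLp_toFun.add v.phi.memLp_dx) ?_ ?_ h.aeB h'.aeB,
    key (u.phit.memLp_toFun.sub u.phi.memLp_dx) (v.phit.memLp_toFun.sub v.phi.memLp_dx)
    ?_ ?_ h.aeD h'.aeD⟩
  · have e : (fun x => (u.phit.toFun + u.phi.dx) x - (v.phit.toFun + v.phi.dx) x) =
        fun x => (u - v).phit.toFun x + (u - v).phi.dx x := by
      funext x
      change _ = (u.phit.toFun x - v.phit.toFun x) + (u.phi.dx x - v.phi.dx x)
      simp only [Pi.add_apply]; ring
    rw [e]
    linarith [l2norm_add_le (u - v).phit.memLp_toFun (u - v).phi.memLp_dx, hr.phit, hr.phix]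
  · have := l2norm_add_le v.phit.memLp_toFun v.phi.memLp_dx
    change l2norm (v.phit.toFun + v.phi.dx) ≤ _ at this
    linarith [hv.phit, hv.phix]
  · have e : (fun x => (u.phit.toFun - u.phi.dx) x - (v.phit.toFun - v.phi.dx) x) =
        fun x => (u - v).phit.toFun x - (u - v).phi.dx x := by
      funext x
      change _ = (u.phit.toFun x - v.phit.toFun x) - (u.phi.dx x - v.phi.dx x)
      simp only [Pi.sub_apply]; ring
    rw [e]
    linarith [l2norm_sub_le (u - v).phit.memLp_toFun (u - v).phi.memLp_dx, hr.phit, hr.phix]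
  · have := l2norm_sub_le v.phit.memLp_toFun v.phi.memLp_dx
    change l2norm (v.phit.toFun - v.phi.dx) ≤ _ at this
    linarith [hv.phit, hv.phix]

namespace EnergySpace

variable (u v : EnergySpace) (x : ℝ)

theorem sub_Lam : (u - v).Lam.toFun x = u.Lam.toFun x - v.Lam.toFun x := rfl

theorem sub_Lamx : (u - v).Lam.dx x = u.Lam.dx x - v.Lam.dx x := rfl

theorem sub_phi : (u - v).phi.toFun x = u.phi.toFun x - v.phi.toFun x := rfl

theorem sub_phix : (u - v).phi.dx x = u.phi.dx x - v.phi.dx x := rfl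

theorem sub_Lamt : (u - v).Lamt.toFun x = u.Lamt.toFun x - v.Lamt.toFun x := rfl

theorem sub_phit : (u - v).phit.toFun x = u.phit.toFun x - v.phit.toFun x := rfl

end EnergySpace

theorem l2norm_half_le {f g h : ℝ → ℝ} {c : ℝ} (hg : MemLp g 2 volume) (hh : MemLp h 2 volume)
    (h1 : l2norm g ≤ c) (h2 : l2norm h ≤ c)
    (hf : (∀ x, f x = 2⁻¹ * (g x + h x)) ∨ ∀ x, f x = 2⁻¹ * (g x - h x)) : l2norm f ≤ c := by
  refine (l2norm_le_of_abs_le (c := 2⁻¹) (d := 2⁻¹) (by norm_num) (by norm_num) hg hh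
    (Eventually.of_forall fun x => ?_)).trans (by linarith)
  have e : |(2⁻¹ : ℝ)| = 2⁻¹ := abs_of_pos (by norm_num)
  rcases hf with hf | hf <;> rw [hf, abs_mul, e]
  · linarith [abs_add_le (g x) (h x)]
  · linarith [abs_sub (g x) (h x)]

theorem memLp_rot2 {σ t N : ℝ} {A B f : ℝ → ℝ} {a : ℝ → ℝ → ℝ} (hA : MemLp A 2 volume)
    (hB : MemLp B 2 volume) (hN : l2norm A + l2norm B ≤ N) (hf : AEStronglyMeasurable f volume)
    (h : ∀ᵐ x, f x = rot2 σ A B a t x) : MemLp f 2 volume ∧ l2norm f ≤ N := by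
  have m1 : MemLp (fun x => A (x + σ * t)) 2 volume := memLp_comp_add hA _
  have m2 : MemLp (fun x => B (x + σ * t)) 2 volume := memLp_comp_add hB _
  have hb : ∀ᵐ x, |f x| ≤ 1 * |A (x + σ * t)| + 1 * |B (x + σ * t)| := by
    filter_upwards [h] with x hx
    rw [hx, one_mul, one_mul]
    exact abs_rot2_le t x
  refine ⟨(m1.abs.add m2.abs).of_le hf (hb.mono fun x hx => ?_),
    (l2norm_le_of_abs_le zero_le_one zero_le_one m1 m2 hb).trans ?_⟩
  · rw [one_mul, one_mul] at hx
    exact hx.trans (le_abs_self _)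
  · rw [one_mul, one_mul, l2norm_comp_add _ hA.1, l2norm_comp_add _ hB.1]
    exact hN

/-- Differences of `φ`-derivatives from those of the frame components. -/
theorem l2norm_unframe_sub_le {lam δ c N : ℝ} (hlam : 0 < lam) {L L' w w' : ℝ → ℝ} (hδ : 0 ≤ δ)
    (hL : ∀ᵐ x, |L x| ≤ lam / 2) (hL' : ∀ᵐ x, |L' x| ≤ lam / 2) (hd : ∀ᵐ x, |L x - L' x| ≤ δ)
    (mL : AEStronglyMeasurable L volume)
    (hw : MemLp w 2 volume) (hR' : MemLp (fun x => 2 * Real.sinh (lam + L' x) * w' x) 2 volume)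
    (hRn : l2norm (fun x => 2 * Real.sinh (lam + L' x) * w' x) ≤ N)
    (hc : l2norm (fun x => 2 * Real.sinh (lam + L x) * w x -
      2 * Real.sinh (lam + L' x) * w' x) ≤ c) :
    l2norm (fun x => w x - w' x) ≤ lam⁻¹ * c + 2 * Real.cosh (2 * lam) * δ / lam ^ 2 * N := by
  have hb : ∀ {y : ℝ}, |y| ≤ lam / 2 → |lam + y| ≤ 2 * lam ∧ lam / 2 ≤ Real.sinh (lam + y) := by
    intro y hy
    have h1 := abs_le.1 hy
    refine ⟨abs_le.2 ⟨by linarith, by linarith⟩, ?_⟩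
    exact (by linarith : lam / 2 ≤ lam + y).trans (Real.self_le_sinh_iff.2 (by linarith))
  set H := Real.cosh (2 * lam) with hH
  have hH0 : 0 < H := Real.cosh_pos _
  have hR : MemLp (fun x => 2 * Real.sinh (lam + L x) * w x) 2 volume := by
    refine (hw.const_mul (2 * H)).of_le ?_ ?_
    · exact ((by fun_prop : Continuous fun y : ℝ =>
        2 * Real.sinh (lam + y)).comp_aestronglyMeasurable mL).mul hw.1
    · filter_upwards [hL] with x hx
      rw [Real.norm_eq_abs, Real.norm_eq_abs, abs_mul, abs_mul, abs_mul, abs_mul, abs_two,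
        abs_of_pos hH0]
      have := (FrameData.abs_sinh_le (hb hx).1).trans (Real.sinh_lt_cosh _).le
      exact mul_le_mul_of_nonneg_right (by linarith) (abs_nonneg _)
  refine (l2norm_le_of_abs_le (c := lam⁻¹) (d := 2 * H * δ / lam ^ 2) (by positivity)
    (by positivity) (hR.sub hR') hR' ?_).trans ?_
  · filter_upwards [hL, hL', hd] with x h1 h2 h3
    obtain ⟨b1, b2⟩ := hb h1
    obtain ⟨b3, b4⟩ := hb h2
    have k1 := abs_sinh_sub_sinh_le b1 b3
    rw [add_sub_add_left_eq_sub] at k1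
    have k2 : |Real.sinh (lam + L x) - Real.sinh (lam + L' x)| ≤ H * δ :=
      k1.trans (mul_le_mul_of_nonneg_left h3 hH0.le)
    set s := Real.sinh (lam + L x) with hs
    set s' := Real.sinh (lam + L' x) with hs'
    have s0 : 0 < s := by linarith
    have s0' : 0 < s' := by linarith
    simp only [Pi.sub_apply, ← hs, ← hs']
    have e1 : s * |w x - w' x| ≤ 2⁻¹ * |2 * s * w x - 2 * s' * w' x| + H * δ * |w' x| := by
      rw [← abs_of_pos s0, ← abs_mul, abs_of_pos s0]
      have e : s * (w x - w' x) = 2⁻¹ * (2 * s * w x - 2 * s' * w' x) - (s - s') * w' x := by ring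
      rw [e]
      refine (abs_sub _ _).trans ?_
      rw [abs_mul, abs_mul (s - s'), abs_of_pos (by norm_num : (0 : ℝ) < 2⁻¹)]
      exact add_le_add le_rfl (mul_le_mul_of_nonneg_right k2 (abs_nonneg _))
    have e2 : lam * |w' x| ≤ |2 * s' * w' x| := by
      rw [abs_mul, abs_of_pos (by positivity : 0 < 2 * s')]
      exact mul_le_mul_of_nonneg_right (by linarith) (abs_nonneg _)
    have e3 : lam / 2 * |w x - w' x| ≤ s * |w x - w' x| :=
      mul_le_mul_of_nonneg_right b2 (abs_nonneg _)
    have e4 : H * δ * (lam * |w' x|) ≤ H * δ * |2 * s' * w' x| :=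
      mul_le_mul_of_nonneg_left e2 (by positivity)
    have e5 : lam ^ 2 * |w x - w' x| ≤ lam * |2 * s * w x - 2 * s' * w' x| +
        2 * H * δ * |2 * s' * w' x| := by nlinarith
    have e6 : lam⁻¹ * |2 * s * w x - 2 * s' * w' x| + 2 * H * δ / lam ^ 2 * |2 * s' * w' x| =
        (lam * |2 * s * w x - 2 * s' * w' x| + 2 * H * δ * |2 * s' * w' x|) / lam ^ 2 := by
      field_simp
    rw [e6, le_div_iff₀ (by positivity)]
    linarith
  · exact add_le_add (mul_le_mul_of_nonneg_left hc (by positivity))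
      (mul_le_mul_of_nonneg_left hRn (by positivity))

/-- Lipschitz dependence of solutions on their data. -/
theorem exists_stability {lam T κ : ℝ} (hlam : 0 < lam) (hT : 0 ≤ T) (hκ1 : 1 ≤ κ)
    (hκ : ∀ z, |cothTrunc lam z| ≤ κ)
    (hκl : ∀ z z', |cothTrunc lam z - cothTrunc lam z'| ≤ κ * |z - z'|)
    (hs1 : 2 * κ * (√T * frameBound lam) ≤ 1 / 2) (hs2 : √T * frameBound lam ≤ lam / 6) :
    ∃ M, ∀ (u v : EnergySpace) (U V : ℝ → EnergySpace) (r : ℝ), u.CompLe (lam / 6) →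
      v.CompLe (lam / 6) → (u - v).CompLe r → IsSolution lam T u U → MemLinf T U →
      IsSolution lam T v V → MemLinf T V → ∀ t ∈ Icc 0 T, (U t - V t).CompLe (M * r) := by
  set N := frameBound lam with hN
  have hN0 : 0 ≤ N := frameBound_nonneg hlam
  set H := Real.cosh (2 * lam) with hH
  have hH0 : 0 < H := Real.cosh_pos _
  set cB := 4 * H * (1 + lam) with hcB
  have hcB0 : 0 ≤ cB := by positivity
  have hκ0 : 0 ≤ κ := zero_le_one.trans hκ1
  -- All constants are per unit of `r`: `cε` is for the data differences in `FramePair`, `c1` for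
  -- the frame components and hence for the derivatives of `Λ̃`, and `c2` for the derivatives of
  -- `φ`, after division by `sinh`.
  set cε := 2 + κ * (√T * (2 + cB + (2 + cB))) with hcε
  have hcε0 : 0 ≤ cε := by positivity
  set c1 := 4 * cε * N + (2 + cB) with hc1
  have hc10 : 0 ≤ c1 := by positivity
  set c2 := lam⁻¹ * c1 + 2 * H * (2 * cε) / lam ^ 2 * N with hc2
  have hc20 : 0 ≤ c2 := by positivity
  refine ⟨(1 + T) * (1 + c1 + c2), fun u v U V r hu hv hr hU mU hV mV => ?_⟩
  have hr0 := hr.nonneg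
  have h0 : (0 : ℝ) ∈ Icc 0 T := ⟨le_rfl, hT⟩
  have bU := hU.ae_abs_Lam_le hT hu hs2 mU
  have bV := hV.ae_abs_Lam_le hT hv hs2 mV
  obtain ⟨A, B, C, D, L₀, h⟩ := exists_frameData lam u
  obtain ⟨A', B', C', D', L₀', h'⟩ := exists_frameData lam v
  obtain ⟨a, b, rU, hwU⟩ := hU.exists_isRotated hT mU h
  obtain ⟨a', b', rV, hwV⟩ := hV.exists_isRotated hT mV h'
  have hwU := hwU (cothTrunc lam) (measurable_cothTrunc lam)
    (fun t ht => (bU t ht).mono fun x hx => cothTrunc_eq hx)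
  have hwV := hwV (cothTrunc lam) (measurable_cothTrunc lam)
    (fun t ht => (bV t ht).mono fun x hx => cothTrunc_eq hx)
  obtain ⟨dL, dA, dC, dB, dD⟩ := h.sub_le hlam h' hu hv hr
  have sN := h.l2norm_sum_le hu
  have sN' := h'.l2norm_sum_le hv
  change _ ≤ N at sN sN'
  have hpair : FramePair (cothTrunc lam) κ T (cε * r) A B C D L₀ A' B' C' D' L₀' a b
      (fun t => (U t).Lam.toFun) a' b' (fun t => (V t).Lam.toFun) := by
    refine ⟨hT, hκ1, hκ, hκl, hwU, hwV, h.mA, h.mB, h.mC, h.mD, h'.mA, h'.mB, h'.mC, h'.mD,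
      h.memLp_A, h.memLp_B, h.memLp_C, h.memLp_D, h'.memLp_A, h'.memLp_B, h'.memLp_C, h'.memLp_D,
      ?_, fun x => ?_⟩
    · refine le_trans ?_ hs1
      gcongr
    · have e : cε * r = 2 * r + κ * (√T * ((2 * r + cB * r) + (2 * r + cB * r))) := by
        rw [hcε]; ring
      rw [e]
      exact add_le_add (dL x) (mul_le_mul_of_nonneg_left (mul_le_mul_of_nonneg_left
        (add_le_add (add_le_add dA dB) (add_le_add dC dD)) (Real.sqrt_nonneg _)) hκ0)
  have hbd := hpair.bound
  have n1 := l2norm_nonneg A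
  have n2 := l2norm_nonneg B
  have n3 := l2norm_nonneg C
  have n4 := l2norm_nonneg D
  have n1' := l2norm_nonneg A'
  have n2' := l2norm_nonneg B'
  have n3' := l2norm_nonneg C'
  have n4' := l2norm_nonneg D'
  have hδ : 0 ≤ 2 * (cε * r) := by positivity
  have ec1 : 2 * (2 * (cε * r)) * N + (2 * r + cB * r) = c1 * r := by rw [hc1]; ring
  have ec2 : lam⁻¹ * (c1 * r) + 2 * H * (2 * (cε * r)) / lam ^ 2 * N = c2 * r := by
    rw [hc2]; ring
  have hrot : ∀ t ∈ Icc 0 T,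
      (l2norm (U t - V t).Lamt.toFun ≤ c1 * r ∧ l2norm (U t - V t).Lam.dx ≤ c1 * r) ∧
      l2norm (U t - V t).phit.toFun ≤ c2 * r ∧ l2norm (U t - V t).phi.dx ≤ c2 * r := by
    intro t ht
    have p := rot_diff_ae (σ := 1) hδ h.memLp_A h.memLp_B h'.memLp_A h'.memLp_B (N := N) (by linarith)
      (add_le_add dA dB) ht ((hbd t ht).mono fun _ h => h.1)
    have q := rot_diff_ae (σ := -1) hδ h.memLp_C h.memLp_D h'.memLp_C h'.memLp_D (N := N)
      (by linarith) (add_le_add dC dD) ht ((hbd t ht).mono fun _ h => h.2.1)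
    rw [ec1] at p q
    have mp1 := (U t - V t).Lamt.memLp_toFun.add (U t - V t).Lam.memLp_dx
    have mq1 := (U t - V t).Lamt.memLp_toFun.sub (U t - V t).Lam.memLp_dx
    have mp2 := (U t - V t).phit.memLp_toFun.add (U t - V t).phi.memLp_dx
    have mq2 := (U t - V t).phit.memLp_toFun.sub (U t - V t).phi.memLp_dx
    have hp1 : l2norm ((U t - V t).Lamt.toFun + (U t - V t).Lam.dx) ≤ c1 * r := by
      refine (le_of_eq (l2norm_congr ?_)).trans p.1
      filter_upwards [rU.P₁ t ht, rV.P₁ t ht] with x k1 k2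
      rw [← k1, ← k2]
      simp only [Pi.add_apply, EnergySpace.sub_Lamt, EnergySpace.sub_Lamx]
      ring
    have hq1 : l2norm ((U t - V t).Lamt.toFun - (U t - V t).Lam.dx) ≤ c1 * r := by
      refine (le_of_eq (l2norm_congr ?_)).trans q.1
      filter_upwards [rU.Q₁ t ht, rV.Q₁ t ht] with x k1 k2
      rw [← k1, ← k2]
      simp only [Pi.sub_apply, EnergySpace.sub_Lamt, EnergySpace.sub_Lamx]
      ring
    have hLd : ∀ᵐ x, |(U t).Lam.toFun x - (V t).Lam.toFun x| ≤ 2 * (cε * r) :=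
      (hbd t ht).mono fun _ h => h.2.2
    have mLU := (U t).Lam.memLp_toFun.1
    have mLV := (V t).Lam.memLp_toFun.1
    have mS : AEStronglyMeasurable (fun x => 2 * Real.sinh (lam + (V t).Lam.toFun x)) volume :=
      (by fun_prop : Continuous fun y : ℝ => 2 * Real.sinh (lam + y)).comp_aestronglyMeasurable mLV
    have hp2 : l2norm ((U t - V t).phit.toFun + (U t - V t).phi.dx) ≤ c2 * r := by
      obtain ⟨k1, k2⟩ := memLp_rot2 (N := N) h'.memLp_A h'.memLp_B (by linarith)
        (mS.mul ((V t).phit.memLp_toFun.add (V t).phi.memLp_dx).1) (rV.P₂ t ht)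
      have := l2norm_unframe_sub_le hlam hδ (bU t ht) (bV t ht) hLd mLU
        ((U t).phit.memLp_toFun.add (U t).phi.memLp_dx) k1 k2 (c := c1 * r) (by
          refine (le_of_eq (l2norm_congr ?_)).trans p.2
          filter_upwards [rU.P₂ t ht, rV.P₂ t ht] with x k1 k2
          rw [← k1, ← k2]; rfl)
      rw [ec2] at this
      refine (le_of_eq (congrArg l2norm (funext fun x => ?_))).trans this
      simp only [Pi.add_apply, EnergySpace.sub_phit, EnergySpace.sub_phix]
      ring
    have hq2 : l2norm ((U t - V t).phit.toFun - (U t - V t).phi.dx) ≤ c2 * r := by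
      obtain ⟨k1, k2⟩ := memLp_rot2 (N := N) h'.memLp_C h'.memLp_D (by linarith)
        (mS.mul ((V t).phit.memLp_toFun.sub (V t).phi.memLp_dx).1) (rV.Q₂ t ht)
      have := l2norm_unframe_sub_le hlam hδ (bU t ht) (bV t ht) hLd mLU
        ((U t).phit.memLp_toFun.sub (U t).phi.memLp_dx) k1 k2 (c := c1 * r) (by
          refine (le_of_eq (l2norm_congr ?_)).trans q.2
          filter_upwards [rU.Q₂ t ht, rV.Q₂ t ht] with x k1 k2
          rw [← k1, ← k2]; rfl)
      rw [ec2] at this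
      refine (le_of_eq (congrArg l2norm (funext fun x => ?_))).trans this
      simp only [Pi.sub_apply, EnergySpace.sub_phit, EnergySpace.sub_phix]
      ring
    refine ⟨⟨l2norm_half_le mp1 mq1 hp1 hq1 (Or.inl fun x => ?_),
      l2norm_half_le mp1 mq1 hp1 hq1 (Or.inr fun x => ?_)⟩,
      l2norm_half_le mp2 mq2 hp2 hq2 (Or.inl fun x => ?_),
      l2norm_half_le mp2 mq2 hp2 hq2 (Or.inr fun x => ?_)⟩ <;>
    · simp only [Pi.add_apply, Pi.sub_apply]; ring
  -- A uniform bound on the difference of `Λ̃` gives no `L²` bound on the line. The functions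
  -- themselves are compared by integrating the velocity differences in time.
  obtain ⟨M₁, s1, -, s3, -, s5, s6⟩ := mU.l2Strip
  obtain ⟨M₂, s1', -, s3', -, s5', s6'⟩ := mV.l2Strip
  obtain ⟨⟨-, -, -, -, tL⟩, -, -, -, -, tφ⟩ := hU.transports hT mU
  obtain ⟨⟨-, -, -, -, tL'⟩, -, -, -, -, tφ'⟩ := hV.transports hT mV
  have sL : L2Strip T (fun t x => (U t).Lamt.toFun x - (V t).Lamt.toFun x) (c1 * r) :=
    ⟨(s5.sub s5').meas, (s5.sub s5').memLp, fun t ht => (hrot t ht).1.1⟩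
  have sφ : L2Strip T (fun t x => (U t).phit.toFun x - (V t).phit.toFun x) (c2 * r) :=
    ⟨(s6.sub s6').meas, (s6.sub s6').memLp, fun t ht => (hrot t ht).2.1⟩
  intro t ht
  have fL : l2norm (U t - V t).Lam.toFun ≤ r + T * (c1 * r) := by
    refine sL.abs_sub_primitive_le s5.locInt s5'.locInt tL tL' ((s1.sub s1').memLp 0 h0) ?_ ht
    refine (le_of_eq (l2norm_congr ?_)).trans hr.Lam
    exact hU.initial.1.sub hV.initial.1
  have fφ : l2norm (U t - V t).phi.toFun ≤ r + T * (c2 * r) := by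
    refine sφ.abs_sub_primitive_le s6.locInt s6'.locInt tφ tφ' ((s3.sub s3').memLp 0 h0) ?_ ht
    refine (le_of_eq (l2norm_congr ?_)).trans hr.phi
    exact hU.initial.2.1.sub hV.initial.2.1
  obtain ⟨⟨g1, g2⟩, g3, g4⟩ := hrot t ht
  have q1 : 0 ≤ c1 * r := by positivity
  have q2 : 0 ≤ c2 * r := by positivity
  have q3 : 0 ≤ T * (c1 * r) := by positivity
  have q4 : 0 ≤ T * (c2 * r) := by positivity
  have q5 : 0 ≤ T * r := by positivity
  have e : (1 + T) * (1 + c1 + c2) * r = r + c1 * r + c2 * r + T * r + T * (c1 * r) +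
    T * (c2 * r) := by ring
  rw [e]
  constructor <;> linarith

/-! ### Regularity from continuous derivatives along the two null directions -/

/-- `f` has the continuous derivatives `p` along `(1, 1)` and `q` along `(1, -1)` in the strip
`[0, T] × ℝ`. -/
structure HasNullDerivs (T : ℝ) (f p q : ℝ → ℝ → ℝ) : Prop where
  cont_p : ContinuousOn (fun z : ℝ × ℝ => p z.1 z.2) (Icc 0 T ×ˢ univ)
  cont_q : ContinuousOn (fun z : ℝ × ℝ => q z.1 z.2) (Icc 0 T ×ˢ univ)
  eq_p : ∀ t ∈ Icc 0 T, ∀ u, f t (u + t) = f 0 u + ∫ s in (0 : ℝ)..t, p s (u + s)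
  eq_q : ∀ t ∈ Icc 0 T, ∀ u, f t (u - t) = f 0 u + ∫ s in (0 : ℝ)..t, q s (u - s)

theorem continuousOn_along {T σ : ℝ} {p : ℝ → ℝ → ℝ}
    (hp : ContinuousOn (fun z : ℝ × ℝ => p z.1 z.2) (Icc 0 T ×ˢ univ)) (u : ℝ) :
    ContinuousOn (fun s => p s (u + σ * s)) (Icc 0 T) :=
  hp.comp (f := fun s => (s, u + σ * s)) (by fun_prop) fun _ hs => ⟨hs, mem_univ _⟩

theorem intervalIntegrable_along {T σ s t : ℝ} {p : ℝ → ℝ → ℝ}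
    (hp : ContinuousOn (fun z : ℝ × ℝ => p z.1 z.2) (Icc 0 T ×ˢ univ)) (u : ℝ)
    (hs : s ∈ Icc 0 T) (ht : t ∈ Icc 0 T) :
    IntervalIntegrable (fun s => p s (u + σ * s)) volume s t :=
  ((continuousOn_along hp u).mono (uIcc_subset_Icc hs ht)).intervalIntegrable

theorem abs_integral_sub_const_le {g : ℝ → ℝ} {s t c ε : ℝ}
    (hg : IntervalIntegrable g volume s t) (h : ∀ r ∈ uIcc s t, |g r - c| ≤ ε) :
    |(∫ r in s..t, g r) - (t - s) * c| ≤ ε * |t - s| := by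
  have e : (∫ r in s..t, g r) - (t - s) * c = ∫ r in s..t, (g r - c) := by
    rw [intervalIntegral.integral_sub hg intervalIntegrable_const,
      intervalIntegral.integral_const, smul_eq_mul]
  rw [e, ← Real.norm_eq_abs]
  exact intervalIntegral.norm_integral_le_of_norm_le_const fun r hr => h r (uIoc_subset_uIcc hr)

/-- The linear map with null derivatives `p` and `q`. -/
noncomputable def nullForm (p q : ℝ) : ℝ × ℝ →L[ℝ] ℝ :=
  (2⁻¹ * (p + q)) • ContinuousLinearMap.fst ℝ ℝ ℝ + (2⁻¹ * (p - q)) • ContinuousLinearMap.snd ℝ ℝ ℝ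

theorem nullForm_apply (p q : ℝ) (z : ℝ × ℝ) :
    nullForm p q z = 2⁻¹ * (p + q) * z.1 + 2⁻¹ * (p - q) * z.2 := by
  simp [nullForm]

/-- Two nearby points are joined by two null segments, on which the derivatives are nearly constant.
The order of the segments is chosen so that the path stays in the strip, which gives the derivative
up to its boundary. -/
theorem HasNullDerivs.hasFDerivWithinAt {T : ℝ} {f p q : ℝ → ℝ → ℝ} (h : HasNullDerivs T f p q)
    (hT : 0 < T) {z : ℝ × ℝ} (hz : z ∈ Icc (0 : ℝ) T ×ˢ (univ : Set ℝ)) :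
    HasFDerivWithinAt (fun z : ℝ × ℝ => f z.1 z.2) (nullForm (p z.1 z.2) (q z.1 z.2))
      (Icc 0 T ×ˢ univ) z := by
  have ep : ∀ s ∈ Icc 0 T, ∀ t ∈ Icc 0 T, ∀ u,
      f t (u + t) - f s (u + s) = ∫ r in s..t, p r (u + 1 * r) := by
    intro s hs t ht u
    have i : ∀ t ∈ Icc 0 T, IntervalIntegrable (fun r => p r (u + 1 * r)) volume 0 t :=
      fun t ht => intervalIntegrable_along h.cont_p u ⟨le_rfl, hT.le⟩ ht
    rw [← intervalIntegral.integral_interval_sub_left (i t ht) (i s hs), h.eq_p t ht, h.eq_p s hs]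
    simp only [one_mul]
    ring
  have eq : ∀ s ∈ Icc 0 T, ∀ t ∈ Icc 0 T, ∀ u,
      f t (u - t) - f s (u - s) = ∫ r in s..t, q r (u + -1 * r) := by
    intro s hs t ht u
    have i : ∀ t ∈ Icc 0 T, IntervalIntegrable (fun r => q r (u + -1 * r)) volume 0 t :=
      fun t ht => intervalIntegrable_along h.cont_q u ⟨le_rfl, hT.le⟩ ht
    rw [← intervalIntegral.integral_interval_sub_left (i t ht) (i s hs), h.eq_q t ht, h.eq_q s hs]
    simp only [neg_mul, one_mul, ← sub_eq_add_neg]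
    ring
  rw [hasFDerivWithinAt_iff_isLittleO, Asymptotics.isLittleO_iff]
  intro ε hε
  obtain ⟨δ₁, h1, hp⟩ := Metric.continuousWithinAt_iff.1 (h.cont_p z hz) (ε / 2) (by positivity)
  obtain ⟨δ₂, h2, hq⟩ := Metric.continuousWithinAt_iff.1 (h.cont_q z hz) (ε / 2) (by positivity)
  have hδ : 0 < min (min δ₁ δ₂) T / 2 := by positivity
  filter_upwards [self_mem_nhdsWithin, mem_nhdsWithin_of_mem_nhds (Metric.ball_mem_nhds z hδ)]
    with y hy hyz
  obtain ⟨t, x⟩ := z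
  obtain ⟨t', x'⟩ := y
  have ht : t ∈ Icc 0 T := hz.1
  have ht' : t' ∈ Icc 0 T := hy.1
  set α := ((t' - t) + (x' - x)) / 2 with hα
  set β := ((t' - t) - (x' - x)) / 2 with hβ
  have hyz : ‖((t', x') : ℝ × ℝ) - (t, x)‖ < min (min δ₁ δ₂) T / 2 := by
    rw [← dist_eq_norm]; exact hyz
  set n := ‖((t', x') : ℝ × ℝ) - (t, x)‖ with hn
  have n1 : |t' - t| ≤ n := norm_fst_le (((t', x') : ℝ × ℝ) - (t, x))
  have n2 : |x' - x| ≤ n := norm_snd_le (((t', x') : ℝ × ℝ) - (t, x))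
  have hαn : |α| ≤ n := by
    rw [hα, abs_div, abs_two]; linarith [abs_add_le (t' - t) (x' - x)]
  have hβn : |β| ≤ n := by
    rw [hβ, abs_div, abs_two]; linarith [abs_sub (t' - t) (x' - x)]
  have m1 : min (min δ₁ δ₂) T ≤ δ₁ := (min_le_left _ _).trans (min_le_left _ _)
  have m2 : min (min δ₁ δ₂) T ≤ δ₂ := (min_le_left _ _).trans (min_le_right _ _)
  have m3 : min (min δ₁ δ₂) T ≤ T := min_le_right _ _
  have hp' : ∀ r ∈ Icc 0 T, ∀ y, |r - t| ≤ 2 * n → |y - x| ≤ 2 * n → |p r y - p t x| ≤ ε / 2 :=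
    fun r hr y k1 k2 => by
      have := hp (x := (r, y)) ⟨hr, mem_univ _⟩ (by
        rw [Prod.dist_eq]; exact max_lt (by rw [Real.dist_eq]; linarith)
          (by rw [Real.dist_eq]; linarith))
      exact this.le
  have hq' : ∀ r ∈ Icc 0 T, ∀ y, |r - t| ≤ 2 * n → |y - x| ≤ 2 * n → |q r y - q t x| ≤ ε / 2 :=
    fun r hr y k1 k2 => by
      have := hq (x := (r, y)) ⟨hr, mem_univ _⟩ (by
        rw [Prod.dist_eq]; exact max_lt (by rw [Real.dist_eq]; linarith)
          (by rw [Real.dist_eq]; linarith))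
      exact this.le
  -- The intermediate times `t + α` and `t + β` have sum `t + t'`, which lies in `[0, 2T]`, and
  -- differ by less than `T`. So they cannot both miss `[0, T]`.
  have hmem : t + α ∈ Icc 0 T ∨ t + β ∈ Icc 0 T := by
    have hs : t + α + β = t' := by rw [hα, hβ]; ring
    by_contra hcon
    simp only [mem_Icc, not_or, not_and_or, not_le] at hcon
    have a1 := abs_le.1 hαn
    have a2 := abs_le.1 hβn
    obtain ⟨h1 | h1, h2 | h2⟩ := hcon
    · linarith [ht.1, ht'.1]
    · linarith
    · linarith
    · linarith [ht.2, ht'.2]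
  have hfin : ∀ {X Y : ℝ}, |X - α * p t x| ≤ ε / 2 * |α| → |Y - β * q t x| ≤ ε / 2 * |β| →
      f t' x' - f t x = X + Y → ‖f t' x' - f t x - nullForm (p t x) (q t x) ((t', x') - (t, x))‖ ≤
        ε * n := by
    intro X Y k1 k2 k3
    have e : f t' x' - f t x - nullForm (p t x) (q t x) ((t', x') - (t, x)) =
        (X - α * p t x) + (Y - β * q t x) := by
      rw [k3, nullForm_apply]
      simp only [Prod.mk_sub_mk, hα, hβ]
      ring
    rw [e, Real.norm_eq_abs]
    refine (abs_add_le _ _).trans ((add_le_add k1 k2).trans ?_)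
    have := mul_le_mul_of_nonneg_left hαn (half_pos hε).le
    have := mul_le_mul_of_nonneg_left hβn (half_pos hε).le
    linarith
  have hα2 := abs_le.1 hαn
  have hβ2 := abs_le.1 hβn
  have hbd : ∀ {r γ : ℝ}, r ∈ uIcc t (t + γ) → |γ| ≤ n → |r - t| ≤ n := fun hr hγ =>
    (abs_sub_left_of_mem_uIcc hr).trans (by rwa [add_sub_cancel_left])
  have hbd' : ∀ {r γ : ℝ}, r ∈ uIcc (t + γ) t' → |γ| ≤ n → |r - (t + γ)| ≤ |t' - (t + γ)| :=
    fun hr hγ => abs_sub_left_of_mem_uIcc hr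
  have eα : t' - (t + α) = β := by rw [hα, hβ]; ring
  have eβ : t' - (t + β) = α := by rw [hα, hβ]; ring
  rcases hmem with hm | hm
  · refine hfin (X := f (t + α) (x + α) - f t x) (Y := f t' x' - f (t + α) (x + α)) ?_ ?_ (by ring)
    · have e := ep t ht (t + α) hm (x - t)
      rw [show x - t + (t + α) = x + α by ring, show x - t + t = x by ring] at e
      rw [e]
      have := abs_integral_sub_const_le (intervalIntegrable_along (σ := 1) h.cont_p (x - t) ht hm)
        (c := p t x) (ε := ε / 2) fun r hr => by
          have hr' := hbd hr hαn
          refine hp' r (uIcc_subset_Icc ht hm hr) _ (by linarith [abs_nonneg (r - t)]) ?_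
          rw [show x - t + 1 * r - x = r - t by ring]
          linarith [abs_nonneg (r - t)]
      rwa [add_sub_cancel_left] at this
    · have e := eq (t + α) hm t' ht' (x + α + (t + α))
      rw [show x + α + (t + α) - t' = x' by rw [hα]; ring,
        show x + α + (t + α) - (t + α) = x + α by ring] at e
      rw [e]
      have := abs_integral_sub_const_le
        (intervalIntegrable_along (σ := -1) h.cont_q (x + α + (t + α)) hm ht')
        (c := q t x) (ε := ε / 2) fun r hr => by
          have hr' := hbd' hr hαn
          rw [eα] at hr'
          have hr2 := abs_le.1 (hr'.trans hβn)
          exact hq' r (uIcc_subset_Icc hm ht' hr) _ (abs_le.2 ⟨by linarith, by linarith⟩)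
            (abs_le.2 ⟨by linarith, by linarith⟩)
      rwa [eα] at this
  · refine hfin (X := f t' x' - f (t + β) (x - β)) (Y := f (t + β) (x - β) - f t x) ?_ ?_ (by ring)
    · have e := ep (t + β) hm t' ht' (x - β - (t + β))
      rw [show x - β - (t + β) + t' = x' by rw [hβ]; ring,
        show x - β - (t + β) + (t + β) = x - β by ring] at e
      rw [e]
      have := abs_integral_sub_const_le
        (intervalIntegrable_along (σ := 1) h.cont_p (x - β - (t + β)) hm ht')
        (c := p t x) (ε := ε / 2) fun r hr => by
          have hr' := hbd' hr hβn
          rw [eβ] at hr'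
          have hr2 := abs_le.1 (hr'.trans hαn)
          exact hp' r (uIcc_subset_Icc hm ht' hr) _ (abs_le.2 ⟨by linarith, by linarith⟩)
            (abs_le.2 ⟨by linarith, by linarith⟩)
      rwa [eβ] at this
    · have e := eq t ht (t + β) hm (x + t)
      rw [show x + t - (t + β) = x - β by ring, show x + t - t = x by ring] at e
      rw [e]
      have := abs_integral_sub_const_le (intervalIntegrable_along (σ := -1) h.cont_q (x + t) ht hm)
        (c := q t x) (ε := ε / 2) fun r hr => by
          have hr' := abs_le.1 (hbd hr hβn)
          exact hq' r (uIcc_subset_Icc ht hm hr) _ (abs_le.2 ⟨by linarith, by linarith⟩)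
            (abs_le.2 ⟨by linarith, by linarith⟩)
      rwa [add_sub_cancel_left] at this

theorem uniqueDiffOn_strip {T : ℝ} (hT : 0 < T) :
    UniqueDiffOn ℝ (Icc (0 : ℝ) T ×ˢ (univ : Set ℝ)) :=
  (uniqueDiffOn_Icc hT).prod uniqueDiffOn_univ

theorem HasNullDerivs.contDiffOn_succ {T : ℝ} {f p q : ℝ → ℝ → ℝ} (h : HasNullDerivs T f p q)
    (hT : 0 < T) {n : ℕ}
    (hp : ContDiffOn ℝ n (fun z : ℝ × ℝ => p z.1 z.2) (Icc 0 T ×ˢ univ))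
    (hq : ContDiffOn ℝ n (fun z : ℝ × ℝ => q z.1 z.2) (Icc 0 T ×ˢ univ)) :
    ContDiffOn ℝ (n + 1) (fun z : ℝ × ℝ => f z.1 z.2) (Icc 0 T ×ˢ univ) := by
  refine contDiffOn_succ_of_fderivWithin
    (fun z hz => (h.hasFDerivWithinAt hT hz).differentiableWithinAt) (by simp) ?_
  refine ContDiffOn.congr (f := fun z : ℝ × ℝ => nullForm (p z.1 z.2) (q z.1 z.2)) ?_
    fun z hz => (h.hasFDerivWithinAt hT hz).fderivWithin (uniqueDiffOn_strip hT z hz)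
  unfold nullForm
  exact ((contDiffOn_const.mul (hp.add hq)).smul contDiffOn_const).add
    ((contDiffOn_const.mul (hp.sub hq)).smul contDiffOn_const)

/-- Exchange of the order of integration over a triangle. -/
theorem integral_triangle_swap {F : ℝ → ℝ → ℝ} (hF : Continuous fun z : ℝ × ℝ => F z.1 z.2) {t : ℝ}
    (ht : 0 ≤ t) : ∫ s in (0 : ℝ)..t, ∫ r in (0 : ℝ)..s, F r s =
      ∫ r in (0 : ℝ)..t, ∫ s in r..t, F r s := by
  set G : ℝ × ℝ → ℝ := {z : ℝ × ℝ | z.1 ≤ z.2}.indicator fun z => F z.1 z.2 with hG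
  have hm : MeasurableSet {z : ℝ × ℝ | z.1 ≤ z.2} :=
    (isClosed_le continuous_fst continuous_snd).measurableSet
  have hGi : Integrable G ((volume.restrict (Ioc 0 t)).prod (volume.restrict (Ioc 0 t))) := by
    have : IntegrableOn (fun z : ℝ × ℝ => F z.1 z.2) (Icc 0 t ×ˢ Icc 0 t) :=
      hF.continuousOn.integrableOn_compact (isCompact_Icc.prod isCompact_Icc)
    have h2 := this.mono_set (prod_mono Ioc_subset_Icc_self Ioc_subset_Icc_self)
    rw [IntegrableOn, Measure.volume_eq_prod, ← Measure.prod_restrict] at h2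
    exact h2.indicator hm
  have hsl : ∀ r s a b : ℝ, IntervalIntegrable (fun s => F r s) volume a b := fun r s a b =>
    (hF.comp (f := fun s => (r, s)) (by fun_prop)).intervalIntegrable a b
  have hsl' : ∀ s a b : ℝ, IntervalIntegrable (fun r => F r s) volume a b := fun s a b =>
    (hF.comp (f := fun r => (r, s)) (by fun_prop)).intervalIntegrable a b
  have e1 : ∀ s ∈ Ioc 0 t, ∫ r in (0 : ℝ)..s, F r s = ∫ r in Ioc 0 t, G (r, s) := fun s hs => by
    rw [intervalIntegral.integral_of_le hs.1.le]
    have : ∀ r, G (r, s) = (Iic s).indicator (fun r => F r s) r := fun r => by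
      simp [hG, indicator]
    simp only [this]
    rw [setIntegral_indicator measurableSet_Iic]
    congr 2
    ext r
    simp only [mem_Ioc, mem_inter_iff, mem_Iic]
    exact ⟨fun h => ⟨⟨h.1, h.2.trans hs.2⟩, h.2⟩, fun h => ⟨h.1.1, h.2⟩⟩
  have e2 : ∀ r ∈ Ioc 0 t, ∫ s in r..t, F r s = ∫ s in Ioc 0 t, G (r, s) := fun r hr => by
    rw [intervalIntegral.integral_of_le hr.2, ← integral_Icc_eq_integral_Ioc]
    have : ∀ s, G (r, s) = (Ici r).indicator (fun s => F r s) s := fun s => by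
      simp [hG, indicator]
    simp only [this]
    rw [setIntegral_indicator measurableSet_Ici]
    congr 2
    ext s
    simp only [mem_Icc, mem_Ioc, mem_inter_iff, mem_Ici]
    exact ⟨fun h => ⟨⟨hr.1.trans_le h.1, h.2⟩, h.1⟩, fun h => ⟨h.2, h.1.2⟩⟩
  rw [intervalIntegral.integral_of_le ht, intervalIntegral.integral_of_le ht,
    setIntegral_congr_fun measurableSet_Ioc e1, setIntegral_congr_fun measurableSet_Ioc e2]
  exact integral_integral_swap (f := fun s r => G (r, s)) hGi.swap

/-- Differentiability across characteristics, from a differential equation for the integrand. -/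
theorem hasNullDerivs_of_integral {T : ℝ} {a m n : ℝ → ℝ → ℝ}
    (hm : Continuous fun z : ℝ × ℝ => m z.1 z.2) (hn : Continuous fun z : ℝ × ℝ => n z.1 z.2)
    (hmn : ∀ t ∈ Icc 0 T, ∀ w, m t (w + t) = m 0 w + ∫ s in (0 : ℝ)..t, n s (w + s))
    (ha : ∀ t ∈ Icc 0 T, ∀ u, a t (u - t) = ∫ s in (0 : ℝ)..t, m s (u - s)) :
    HasNullDerivs T a (fun t x => m 0 (x + t) + ∫ s in (0 : ℝ)..t, n s (x + t - s)) m := by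
  have a0 : ∀ t ∈ Icc 0 T, ∀ x, a 0 x = 0 := fun t ht x => by
    simpa using ha 0 ⟨le_rfl, ht.1.trans ht.2⟩ x
  have cI : Continuous fun z : ℝ × ℝ => ∫ s in (0 : ℝ)..z.1, n s (z.2 + z.1 - s) :=
    intervalIntegral.continuous_parametric_intervalIntegral_of_continuous
      (f := fun (z : ℝ × ℝ) s => n s (z.2 + z.1 - s))
      (hn.comp (f := fun y : (ℝ × ℝ) × ℝ => (y.2, y.1.2 + y.1.1 - y.2)) (by fun_prop)) continuous_fst
  have cm : Continuous fun z : ℝ × ℝ => m 0 (z.2 + z.1) :=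
    hm.comp (f := fun z : ℝ × ℝ => ((0 : ℝ), z.2 + z.1)) (by fun_prop)
  refine ⟨(cm.add cI).continuousOn, hm.continuousOn, fun t ht w => ?_, fun t ht u => ?_⟩
  -- Along `x - t = w` the integrand of `a` is expanded from time `0` on the transverse
  -- characteristics. Changing variables and exchanging the order of integration over the triangle
  -- exhibits the result as a primitive in `t`.
  · have hp : ∀ s ∈ uIcc 0 t, m s (w + 2 * t - s) =
        m 0 (w + 2 * (t - s)) + ∫ r in (0 : ℝ)..s, n r (w + 2 * (t - s) + r) := fun s hs => by
      rw [uIcc_of_le ht.1] at hs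
      rw [← hmn s ⟨hs.1, hs.2.trans ht.2⟩]
      ring_nf
    have c1 : Continuous fun s : ℝ => m 0 (w + 2 * (t - s)) :=
      hm.comp (f := fun s : ℝ => ((0 : ℝ), w + 2 * (t - s))) (by fun_prop)
    have c2 : Continuous fun s : ℝ => ∫ r in (0 : ℝ)..s, n r (w + 2 * (t - s) + r) :=
      intervalIntegral.continuous_parametric_intervalIntegral_of_continuous
        (f := fun s r => n r (w + 2 * (t - s) + r))
        (hn.comp (f := fun y : ℝ × ℝ => (y.2, w + 2 * (t - y.1) + y.2)) (by fun_prop)) continuous_id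
    have c3 : Continuous fun s : ℝ => m 0 (w + s + s) :=
      hm.comp (f := fun s : ℝ => ((0 : ℝ), w + s + s)) (by fun_prop)
    have c4 : Continuous fun s : ℝ => ∫ r in (0 : ℝ)..s, n r (w + s + s - r) :=
      intervalIntegral.continuous_parametric_intervalIntegral_of_continuous
        (f := fun s r => n r (w + s + s - r))
        (hn.comp (f := fun y : ℝ × ℝ => (y.2, w + y.1 + y.1 - y.2)) (by fun_prop)) continuous_id
    have e := ha t ht (w + 2 * t)
    rw [show w + 2 * t - t = w + t by ring, intervalIntegral.integral_congr hp,
      intervalIntegral.integral_add (c1.intervalIntegrable _ _) (c2.intervalIntegrable _ _)] at e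
    rw [e, a0 t ht, zero_add, intervalIntegral.integral_add (c3.intervalIntegrable _ _)
      (c4.intervalIntegrable _ _)]
    congr 1
    · have := intervalIntegral.integral_comp_sub_left (a := 0) (b := t)
        (fun s => m 0 (w + 2 * s)) t
      rw [this]
      simp only [sub_self, sub_zero]
      exact intervalIntegral.integral_congr fun s _ => by ring_nf
    · rw [integral_triangle_swap (F := fun r s => n r (w + 2 * (t - s) + r))
        (hn.comp (f := fun y : ℝ × ℝ => (y.1, w + 2 * (t - y.2) + y.1)) (by fun_prop)) ht.1,
        integral_triangle_swap (F := fun r s => n r (w + s + s - r))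
        (hn.comp (f := fun y : ℝ × ℝ => (y.1, w + y.2 + y.2 - y.1)) (by fun_prop)) ht.1]
      refine intervalIntegral.integral_congr fun r _ => ?_
      have := intervalIntegral.integral_comp_sub_left (a := r) (b := t)
        (fun s => n r (w + s + s - r)) (t + r)
      simp only [add_sub_cancel_right, add_sub_cancel_left] at this
      rw [← this]
      exact intervalIntegral.integral_congr fun s _ => by ring_nf
  · rw [a0 t ht, zero_add, ha t ht]

theorem continuous_integral_along {T σ : ℝ} {f : ℝ → ℝ → ℝ}
    (hf : ContinuousOn (fun z : ℝ × ℝ => f z.1 z.2) (Icc 0 T ×ˢ univ)) {t : ℝ} (ht : t ∈ Icc 0 T) :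
    Continuous fun u => ∫ s in (0 : ℝ)..t, f s (u - σ * s) := by
  have hT : 0 ≤ T := ht.1.trans ht.2
  have hcl : Continuous fun y : ℝ × ℝ => f (projIcc 0 T hT y.2) (y.1 - σ * y.2) :=
    hf.comp_continuous (f := fun y : ℝ × ℝ => ((projIcc 0 T hT y.2 : ℝ), y.1 - σ * y.2))
      (by fun_prop) fun y => ⟨(projIcc 0 T hT y.2).2, mem_univ _⟩
  refine (intervalIntegral.continuous_parametric_intervalIntegral_of_continuous'
    (f := fun u s => f (projIcc 0 T hT s) (u - σ * s)) hcl 0 t).congr fun u =>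
    intervalIntegral.integral_congr fun s hs => ?_
  rw [uIcc_of_le ht.1] at hs
  simp only [projIcc_of_mem hT (show s ∈ Icc 0 T from ⟨hs.1, hs.2.trans ht.2⟩)]

theorem MildTransport.forall_eq {T σ : ℝ} {w f : ℝ → ℝ → ℝ} (h : MildTransport T σ w f)
    (hw : ∀ t ∈ Icc 0 T, Continuous (w t))
    (hf : ContinuousOn (fun z : ℝ × ℝ => f z.1 z.2) (Icc 0 T ×ˢ univ)) :
    ∀ t ∈ Icc 0 T, ∀ u, w t (u - σ * t) = w 0 u + ∫ s in (0 : ℝ)..t, f s (u - σ * s) := by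
  intro t ht u
  have c1 : Continuous fun u => w t (u - σ * t) := (hw t ht).comp (by fun_prop)
  have c2 : Continuous fun u => w 0 u + ∫ s in (0 : ℝ)..t, f s (u - σ * s) :=
    (hw 0 ⟨le_rfl, ht.1.trans ht.2⟩).add (continuous_integral_along hf ht)
  exact congr_fun ((Continuous.ae_eq_iff_eq volume c1 c2).1 (h t ht)) u

/-- Reflection in space exchanges the two null directions, so only one of the angles has to be
treated directly. -/
theorem HasNullDerivs.reflect {T : ℝ} {f p q : ℝ → ℝ → ℝ} (h : HasNullDerivs T f p q) :
    HasNullDerivs T (fun t x => f t (-x)) (fun t x => q t (-x)) (fun t x => p t (-x)) := by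
  have hm : MapsTo (fun z : ℝ × ℝ => (z.1, -z.2)) (Icc (0 : ℝ) T ×ˢ univ) (Icc 0 T ×ˢ univ) :=
    fun z hz => ⟨hz.1, mem_univ _⟩
  refine ⟨h.cont_q.comp (by fun_prop) hm, h.cont_p.comp (by fun_prop) hm, fun t ht u => ?_,
    fun t ht u => ?_⟩
  · have := h.eq_q t ht (-u)
    simp only [neg_add', this]
  · have := h.eq_p t ht (-u)
    have e : ∀ s, -(u - s) = -u + s := fun s => by ring
    simp only [e, this]

theorem hasDerivAt_integral_of_continuousOn {T t : ℝ} {g : ℝ → ℝ} (hg : ContinuousOn g (Icc 0 T))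
    (ht : t ∈ Ioo 0 T) (c : ℝ) : HasDerivAt (fun s => c + ∫ r in (0 : ℝ)..s, g r) (g t) t := by
  refine (intervalIntegral.integral_hasDerivAt_right ?_ ?_ ?_).const_add c
  · exact (hg.mono (by rw [uIcc_of_le ht.1.le]; exact Icc_subset_Icc_right ht.2.le)).intervalIntegrable
  · exact (hg.mono Ioo_subset_Icc_self).stronglyMeasurableAtFilter isOpen_Ioo t ht
  · exact hg.continuousAt (Icc_mem_nhds ht.1 ht.2)

theorem strip_mem_nhds {T : ℝ} {t : ℝ} (ht : t ∈ Ioo 0 T) (x : ℝ) :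
    Icc (0 : ℝ) T ×ˢ (univ : Set ℝ) ∈ 𝓝 (t, x) :=
  prod_mem_nhds (Icc_mem_nhds ht.1 ht.2) univ_mem

/-- A function whose null derivatives satisfy transport equations solves the wave equation. -/
theorem HasNullDerivs.wave {T : ℝ} {f p q g : ℝ → ℝ → ℝ} (h : HasNullDerivs T f p q) (hT : 0 < T)
    (hp : ContDiffOn ℝ 1 (fun z : ℝ × ℝ => p z.1 z.2) (Icc 0 T ×ˢ univ))
    (hq : ContDiffOn ℝ 1 (fun z : ℝ × ℝ => q z.1 z.2) (Icc 0 T ×ˢ univ))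
    (hg : ContinuousOn (fun z : ℝ × ℝ => g z.1 z.2) (Icc 0 T ×ˢ univ))
    (ep : ∀ t ∈ Icc 0 T, ∀ u, p t (u - t) = p 0 u + ∫ s in (0 : ℝ)..t, g s (u - s))
    (eq : ∀ t ∈ Icc 0 T, ∀ u, q t (u + t) = q 0 u + ∫ s in (0 : ℝ)..t, g s (u + s)) :
    ContDiffOn ℝ 2 (fun z : ℝ × ℝ => f z.1 z.2) (Icc 0 T ×ˢ univ) ∧
    (∀ t ∈ Icc 0 T, ∀ x, derivWithin (fun s => f s x) (Icc 0 T) t = 2⁻¹ * (p t x + q t x)) ∧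
    ∀ t ∈ Ioo 0 T, ∀ x, deriv (fun s => f s x) t = 2⁻¹ * (p t x + q t x) ∧
      deriv (f t) x = 2⁻¹ * (p t x - q t x) ∧
      -iteratedDeriv 2 (fun s => f s x) t + iteratedDeriv 2 (f t) x = -g t x := by
  have hvert : ∀ (t x : ℝ), HasDerivAt (fun s : ℝ => (s, x)) ((1 : ℝ), (0 : ℝ)) t := fun t x =>
    (hasDerivAt_id t).prodMk (hasDerivAt_const t x)
  have hhor : ∀ (t x : ℝ), HasDerivAt (fun y : ℝ => (t, y)) ((0 : ℝ), (1 : ℝ)) x := fun t x =>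
    (hasDerivAt_const x t).prodMk (hasDerivAt_id x)
  have hft : ∀ t ∈ Ioo 0 T, ∀ x, HasDerivAt (fun s => f s x) (2⁻¹ * (p t x + q t x)) t := by
    intro t ht x
    have h1 := (h.hasFDerivWithinAt hT (z := (t, x)) ⟨Ioo_subset_Icc_self ht, mem_univ _⟩).hasFDerivAt
      (strip_mem_nhds ht x)
    have := h1.comp_hasDerivAt t (hvert t x)
    simpa [nullForm_apply, Function.comp_def] using this
  have hfx : ∀ t ∈ Ioo 0 T, ∀ x, HasDerivAt (f t) (2⁻¹ * (p t x - q t x)) x := by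
    intro t ht x
    have h1 := (h.hasFDerivWithinAt hT (z := (t, x)) ⟨Ioo_subset_Icc_self ht, mem_univ _⟩).hasFDerivAt
      (strip_mem_nhds ht x)
    have := h1.comp_hasDerivAt x (hhor t x)
    simpa [nullForm_apply, Function.comp_def] using this
  refine ⟨h.contDiffOn_succ hT (n := 1) (by exact_mod_cast hp) (by exact_mod_cast hq),
    fun t ht x => ?_, fun t ht x => ⟨(hft t ht x).deriv, (hfx t ht x).deriv, ?_⟩⟩
  · have h1 := h.hasFDerivWithinAt hT (z := (t, x)) ⟨ht, mem_univ _⟩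
    have := h1.comp_hasDerivWithinAt t (hvert t x).hasDerivWithinAt
      (show MapsTo (fun s : ℝ => (s, x)) (Icc 0 T) (Icc 0 T ×ˢ univ) from
        fun s hs => ⟨hs, mem_univ _⟩)
    have h2 := this.derivWithin (uniqueDiffOn_Icc hT t ht)
    simpa [nullForm_apply, Function.comp_def] using h2
  · have htI := Ioo_subset_Icc_self ht
    have dp := ((hp.differentiableOn one_ne_zero (t, x) ⟨htI, mem_univ _⟩).differentiableAt
      (strip_mem_nhds ht x)).hasFDerivAt
    have dq := ((hq.differentiableOn one_ne_zero (t, x) ⟨htI, mem_univ _⟩).differentiableAt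
      (strip_mem_nhds ht x)).hasFDerivAt
    set G := fderiv ℝ (fun z : ℝ × ℝ => p z.1 z.2) (t, x) with hG
    set H := fderiv ℝ (fun z : ℝ × ℝ => q z.1 z.2) (t, x) with hH
    have k1 : HasDerivAt (fun s => p s x) (G (1, 0)) t :=
      HasFDerivAt.comp_hasDerivAt (x := t) (f := fun s : ℝ => (s, x))
        (l := fun z : ℝ × ℝ => p z.1 z.2) dp (hvert t x)
    have k2 : HasDerivAt (fun s => q s x) (H (1, 0)) t :=
      HasFDerivAt.comp_hasDerivAt (x := t) (f := fun s : ℝ => (s, x))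
        (l := fun z : ℝ × ℝ => q z.1 z.2) dq (hvert t x)
    have k3 : HasDerivAt (fun y => p t y) (G (0, 1)) x := dp.comp_hasDerivAt x (hhor t x)
    have k4 : HasDerivAt (fun y => q t y) (H (0, 1)) x := dq.comp_hasDerivAt x (hhor t x)
    -- The transport equations give the derivative of `p` along `(1, -1)` and that of `q` along `(1,
    -- 1)`. Half their sum is `∂ₜ²f - ∂ₓ²f`, so equality of mixed derivatives is not needed.
    have e1 : G (1, -1) = g t x := by
      have c1 : HasDerivAt (fun s : ℝ => (s, x + t - s)) ((1 : ℝ), (-1 : ℝ)) t :=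
        (hasDerivAt_id t).prodMk ((hasDerivAt_id t).const_sub (x + t))
      have c2 : HasDerivAt (fun s => p s (x + t - s)) (G (1, -1)) t :=
        HasFDerivAt.comp_hasDerivAt (x := t) (f := fun s : ℝ => (s, x + t - s))
          (l := fun z : ℝ × ℝ => p z.1 z.2) (by rw [add_sub_cancel_right]; exact dp) c1
      have c3 := hasDerivAt_integral_of_continuousOn (continuousOn_along (σ := -1) hg (x + t)) ht
        (p 0 (x + t))
      have c4 : HasDerivAt (fun s => p s (x + t - s)) (g t (x + t + -1 * t)) t := by
        refine c3.congr_of_eventuallyEq ?_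
        filter_upwards [Icc_mem_nhds ht.1 ht.2] with s hs
        rw [ep s hs]
        simp only [neg_mul, one_mul, ← sub_eq_add_neg]
      rw [c2.unique c4]
      ring_nf
    have e2 : H (1, 1) = g t x := by
      have c1 : HasDerivAt (fun s : ℝ => (s, x - t + s)) ((1 : ℝ), (1 : ℝ)) t :=
        (hasDerivAt_id t).prodMk ((hasDerivAt_id t).const_add (x - t))
      have c2 : HasDerivAt (fun s => q s (x - t + s)) (H (1, 1)) t :=
        HasFDerivAt.comp_hasDerivAt (x := t) (f := fun s : ℝ => (s, x - t + s))
          (l := fun z : ℝ × ℝ => q z.1 z.2) (by rw [sub_add_cancel]; exact dq) c1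
      have c3 := hasDerivAt_integral_of_continuousOn (continuousOn_along (σ := 1) hg (x - t)) ht
        (q 0 (x - t))
      have c4 : HasDerivAt (fun s => q s (x - t + s)) (g t (x - t + 1 * t)) t := by
        refine c3.congr_of_eventuallyEq ?_
        filter_upwards [Icc_mem_nhds ht.1 ht.2] with s hs
        rw [eq s hs]
        simp only [one_mul]
      rw [c2.unique c4]
      ring_nf
    have e3 : G (1, -1) = G (1, 0) - G (0, 1) := by rw [← map_sub]; simp
    have e4 : H (1, 1) = H (1, 0) + H (0, 1) := by rw [← map_add]; simp
    have d1 : iteratedDeriv 2 (fun s => f s x) t = 2⁻¹ * (G (1, 0) + H (1, 0)) := by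
      rw [iteratedDeriv_succ, iteratedDeriv_one]
      have : deriv (fun s => f s x) =ᶠ[𝓝 t] fun s => 2⁻¹ * (p s x + q s x) := by
        filter_upwards [Ioo_mem_nhds ht.1 ht.2] with s hs using (hft s hs x).deriv
      rw [this.deriv_eq]
      exact ((k1.add k2).const_mul 2⁻¹).deriv
    have d2 : iteratedDeriv 2 (f t) x = 2⁻¹ * (G (0, 1) - H (0, 1)) := by
      rw [iteratedDeriv_succ, iteratedDeriv_one,
        show deriv (f t) = fun y => 2⁻¹ * (p t y - q t y) from funext fun y => (hfx t ht y).deriv]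
      exact ((k3.sub k4).const_mul 2⁻¹).deriv
    rw [d1, d2]
    linarith

theorem contDiffOn_rot {T σ : ℝ} {A B : ℝ → ℝ} {a : ℝ → ℝ → ℝ} (hA : ContDiff ℝ 1 A)
    (hB : ContDiff ℝ 1 B)
    (ha : ContDiffOn ℝ 1 (fun z : ℝ × ℝ => a z.1 z.2) (Icc 0 T ×ˢ univ)) :
    ContDiffOn ℝ 1 (fun z : ℝ × ℝ => rot1 σ A B a z.1 z.2) (Icc 0 T ×ˢ univ) ∧
      ContDiffOn ℝ 1 (fun z : ℝ × ℝ => rot2 σ A B a z.1 z.2) (Icc 0 T ×ˢ univ) := by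
  have h1 : ContDiff ℝ 1 fun z : ℝ × ℝ => z.2 + σ * z.1 :=
    contDiff_snd.add (contDiff_const.mul contDiff_fst)
  have h2 := (hA.comp h1).contDiffOn (s := Icc 0 T ×ˢ univ)
  have h3 := (hB.comp h1).contDiffOn (s := Icc 0 T ×ˢ univ)
  exact ⟨(h2.mul ha.cos).add (h3.mul ha.sin), (h3.mul ha.cos).sub (h2.mul ha.sin)⟩

theorem continuous_rot {σ : ℝ} {A B : ℝ → ℝ} {a : ℝ → ℝ → ℝ} (hA : Continuous A)
    (hB : Continuous B) (ha : Continuous fun z : ℝ × ℝ => a z.1 z.2) :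
    (Continuous fun z : ℝ × ℝ => rot1 σ A B a z.1 z.2) ∧
      Continuous fun z : ℝ × ℝ => rot2 σ A B a z.1 z.2 := by
  have := Real.continuous_cos.comp ha
  have := Real.continuous_sin.comp ha
  simp only [Function.comp_def] at *
  unfold rot1 rot2
  constructor <;> fun_prop

/-- The derivative is written as a polynomial in `coth`, so that it extends continuously to the
whole plane when `coth` is replaced by its truncation. -/
theorem IsPrim.coth {T lam : ℝ} {ℓ q : ℝ → ℝ} (hℓ : IsPrim T ℓ q) (hT : 0 ≤ T)
    (hpos : ∀ t ∈ Icc 0 T, 0 < lam + ℓ t) :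
    IsPrim T (fun t => Real.cosh (lam + ℓ t) / Real.sinh (lam + ℓ t))
      (fun t => (1 - (Real.cosh (lam + ℓ t) / Real.sinh (lam + ℓ t)) ^ 2) * q t) := by
  have hne : ∀ z ∈ Ioi (0 : ℝ), Real.sinh z ≠ 0 := fun z hz => (Real.sinh_pos_iff.2 hz).ne'
  have hc : ContinuousOn (fun z => Real.cosh z / Real.sinh z) (Ioi 0) :=
    Real.continuous_cosh.continuousOn.div Real.continuous_sinh.continuousOn hne
  refine (hℓ.const_add lam).comp (h := fun z => Real.cosh z / Real.sinh z)
    (h' := fun z => 1 - (Real.cosh z / Real.sinh z) ^ 2) hT (I := Ioi 0) hpos (fun z hz => ?_)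
    (continuousOn_const.sub (hc.pow 2))
  have := (Real.hasDerivAt_cosh z).div (Real.hasDerivAt_sinh z) (hne z hz)
  have e : (Real.sinh z * Real.sinh z - Real.cosh z * Real.cosh z) / Real.sinh z ^ 2 =
      1 - (Real.cosh z / Real.sinh z) ^ 2 := by
    have := hne z hz
    field_simp
  rw [e] at this
  exact this

section

variable {lam T : ℝ} {A B C D L₀ : ℝ → ℝ} {a b L : ℝ → ℝ → ℝ}

/-- By definition `a` is the integral of `coth Λ · Q₂` along one family. This integrand has a
continuous derivative along the other family, from the equation for `coth` and the rotation of `Q`.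
So `a` gains both null derivatives although the data need only be continuous. -/
theorem IsFrame.hasNullDerivs_a (h : IsFrame (cothTrunc lam) T A B C D L₀ a b L) (hlam : 0 < lam)
    (hT : 0 ≤ T) (cA : Continuous A) (cB : Continuous B) (cC : Continuous C) (cD : Continuous D)
    (mA : MemLp A 2 volume) (mB : MemLp B 2 volume)
    (hL : ∀ t ∈ Icc 0 T, ∀ x, |L t x| ≤ lam / 2)
    (hu : ∀ u, IsPrim T (fun t => L t (u + t)) (fun s => rot1 1 A B a s (u + s))) :
    ∃ r, HasNullDerivs T a r (fun t x => cothTrunc lam (L t x) * rot2 (-1) C D b t x) := by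
  have hK := continuous_cothTrunc hlam
  have cKL : Continuous fun z : ℝ × ℝ => cothTrunc lam (L z.1 z.2) := hK.comp h.cont_L
  obtain ⟨cP1, cP2⟩ := continuous_rot (σ := 1) cA cB h.cont_a
  obtain ⟨cQ1, cQ2⟩ := continuous_rot (σ := -1) cC cD h.cont_b
  refine ⟨_, hasNullDerivs_of_integral (n := fun t x =>
    (1 - cothTrunc lam (L t x) ^ 2) * rot1 1 A B a t x * rot2 (-1) C D b t x +
      cothTrunc lam (L t x) * -(cothTrunc lam (L t x) * rot2 1 A B a t x * rot1 (-1) C D b t x))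
    (cKL.mul cQ2) (by fun_prop) (fun t ht w => ?_) h.eq_a⟩
  have pos : ∀ t ∈ Icc 0 T, 0 < lam + L t (w + t) := fun t ht => by
    linarith [(abs_le.1 (hL t ht (w + t))).1]
  have e := (((hu w).coth hT pos).mul (h.isPrim_Q hT hK mA mB w).2 hT).eq t ht
  have h0 := cothTrunc_eq (hL 0 ⟨le_rfl, hT⟩ w)
  simp only [add_zero] at e
  rw [cothTrunc_eq (hL t ht _), h0, e]
  congr 1
  refine intervalIntegral.integral_congr fun s hs => ?_
  rw [uIcc_of_le ht.1] at hs
  simp only [cothTrunc_eq (hL s ⟨hs.1, hs.2.trans ht.2⟩ _)]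

/-- The argument for `a` after the reflection `x ↦ -x`. -/
theorem IsFrame.hasNullDerivs_b (h : IsFrame (cothTrunc lam) T A B C D L₀ a b L) (hlam : 0 < lam)
    (hT : 0 ≤ T) (cA : Continuous A) (cB : Continuous B) (cC : Continuous C) (cD : Continuous D)
    (mC : MemLp C 2 volume) (mD : MemLp D 2 volume)
    (hL : ∀ t ∈ Icc 0 T, ∀ x, |L t x| ≤ lam / 2)
    (hu : ∀ u, IsPrim T (fun t => L t (u - t)) (fun s => rot1 (-1) C D b s (u - s))) :
    ∃ r, HasNullDerivs T b (fun t x => cothTrunc lam (L t x) * rot2 1 A B a t x) r := by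
  have hK := continuous_cothTrunc hlam
  have cKL : Continuous fun z : ℝ × ℝ => cothTrunc lam (L z.1 z.2) := hK.comp h.cont_L
  obtain ⟨cP1, cP2⟩ := continuous_rot (σ := 1) cA cB h.cont_a
  obtain ⟨cQ1, cQ2⟩ := continuous_rot (σ := -1) cC cD h.cont_b
  have cm : Continuous fun z : ℝ × ℝ => (z.1, -z.2) := by fun_prop
  have cn : Continuous fun z : ℝ × ℝ =>
      (1 - cothTrunc lam (L z.1 z.2) ^ 2) * rot1 (-1) C D b z.1 z.2 * rot2 1 A B a z.1 z.2 +
      cothTrunc lam (L z.1 z.2) *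
        -(cothTrunc lam (L z.1 z.2) * rot2 (-1) C D b z.1 z.2 * rot1 1 A B a z.1 z.2) := by
    fun_prop
  have key := (hasNullDerivs_of_integral (T := T) (a := fun t x => b t (-x))
    (m := fun t x => cothTrunc lam (L t (-x)) * rot2 1 A B a t (-x))
    (n := fun t x => (1 - cothTrunc lam (L t (-x)) ^ 2) * rot1 (-1) C D b t (-x) *
      rot2 1 A B a t (-x) + cothTrunc lam (L t (-x)) *
        -(cothTrunc lam (L t (-x)) * rot2 (-1) C D b t (-x) * rot1 1 A B a t (-x)))
    ((cKL.mul cP2).comp cm) (cn.comp cm) (fun t ht w => ?_) (fun t ht u => ?_)).reflect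
  · simp only [neg_neg] at key
    exact ⟨_, key⟩
  · have pos : ∀ t ∈ Icc 0 T, 0 < lam + L t (-w - t) := fun t ht => by
      linarith [(abs_le.1 (hL t ht (-w - t))).1]
    have e := (((hu (-w)).coth hT pos).mul (h.isPrim_P hT hK mC mD (-w)).2 hT).eq t ht
    have h0 := cothTrunc_eq (hL 0 ⟨le_rfl, hT⟩ (-w))
    simp only [sub_zero] at e
    simp only [neg_add']
    rw [cothTrunc_eq (hL t ht _), h0, e]
    congr 1
    refine intervalIntegral.integral_congr fun s hs => ?_
    rw [uIcc_of_le ht.1] at hs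
    simp only [cothTrunc_eq (hL s ⟨hs.1, hs.2.trans ht.2⟩ _)]
  · have e : ∀ s, -(u - s) = -u + s := fun s => by ring
    simp only [e, h.eq_b t ht]

/-- The regularity climbs in a chain: the angles are `C¹`, hence the frame components are `C¹`,
hence `L` is `C²`; then the null derivatives of `φ` are `C¹` and `φ` is `C²`. Continuity turns the
almost everywhere transport equations into pointwise ones. -/
theorem FrameData.isClassical {u : EnergySpace} (h : FrameData lam u A B C D L₀) (hlam : 0 < lam)
    (hT : 0 < T) (hA : ContDiff ℝ 1 A) (hB : ContDiff ℝ 1 B) (hC : ContDiff ℝ 1 C)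
    (hD : ContDiff ℝ 1 D) (hφ₀ : Continuous u.phi.toFun)
    (hfr : IsFrame (cothTrunc lam) T A B C D L₀ a b L)
    (hL : ∀ t ∈ Icc 0 T, ∀ x, |L t x| ≤ lam / 2) {φ p q : ℝ → ℝ → ℝ}
    (hp : p = unframe lam L (rot2 1 A B a)) (hq : q = unframe lam L (rot2 (-1) C D b))
    (hφ : φ = fun t x => u.phi.toFun x + ∫ s in (0 : ℝ)..t, 2⁻¹ * (p s x + q s x))
    {U : ℝ → EnergySpace}
    (hU : ∀ t ∈ Icc 0 T, (U t).Lam.toFun = L t ∧ (U t).phi.toFun = φ t ∧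
      (U t).Lamt.toFun = (fun x => 2⁻¹ * (rot1 1 A B a t x + rot1 (-1) C D b t x)) ∧
      (U t).phit.toFun = fun x => 2⁻¹ * (p t x + q t x))
    (hu1 : ∀ u, IsPrim T (fun t => L t (u - t)) (fun s => rot1 (-1) C D b s (u - s)))
    (hu2 : ∀ u, IsPrim T (fun t => L t (u + t)) (fun s => rot1 1 A B a s (u + s)))
    (t1 : MildTransport T 1 φ q) (t2 : MildTransport T (-1) φ p)
    (t3 : MildTransport T 1 p (fun t x => -(cothTrunc lam (L t x) *
      (rot1 1 A B a t x * q t x + p t x * rot1 (-1) C D b t x))))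
    (t4 : MildTransport T (-1) q (fun t x => -(cothTrunc lam (L t x) *
      (rot1 1 A B a t x * q t x + p t x * rot1 (-1) C D b t x)))) :
    IsClassical lam T U := by
  have hT0 := hT.le
  have hK := continuous_cothTrunc hlam
  have cKL : Continuous fun z : ℝ × ℝ => cothTrunc lam (L z.1 z.2) := hK.comp hfr.cont_L
  have pos : ∀ t ∈ Icc 0 T, ∀ x, 0 < lam + L t x := fun t ht x => by
    linarith [(abs_le.1 (hL t ht x)).1]
  have hs : ∀ t ∈ Icc 0 T, ∀ x, Real.sinh (lam + L t x) ≠ 0 := fun t ht x =>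
    (Real.sinh_pos_iff.2 (pos t ht x)).ne'
  obtain ⟨cP1, cP2⟩ := continuous_rot (σ := 1) hA.continuous hB.continuous hfr.cont_a
  obtain ⟨cQ1, cQ2⟩ := continuous_rot (σ := -1) hC.continuous hD.continuous hfr.cont_b
  obtain ⟨ra, na⟩ := hfr.hasNullDerivs_a hlam hT0 hA.continuous hB.continuous hC.continuous
    hD.continuous h.memLp_A h.memLp_B hL hu2
  obtain ⟨rb, nb⟩ := hfr.hasNullDerivs_b hlam hT0 hA.continuous hB.continuous hC.continuous
    hD.continuous h.memLp_C h.memLp_D hL hu1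
  have da : ContDiffOn ℝ 1 (fun z : ℝ × ℝ => a z.1 z.2) (Icc 0 T ×ˢ univ) := by
    have := na.contDiffOn_succ hT (n := 0) (by simpa using na.cont_p) (by simpa using na.cont_q)
    simpa using this
  have db : ContDiffOn ℝ 1 (fun z : ℝ × ℝ => b z.1 z.2) (Icc 0 T ×ˢ univ) := by
    have := nb.contDiffOn_succ hT (n := 0) (by simpa using nb.cont_p) (by simpa using nb.cont_q)
    simpa using this
  obtain ⟨dP1, dP2⟩ := contDiffOn_rot (σ := 1) hA hB da
  obtain ⟨dQ1, dQ2⟩ := contDiffOn_rot (σ := -1) hC hD db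
  have nL : HasNullDerivs T L (rot1 1 A B a) (rot1 (-1) C D b) :=
    ⟨cP1.continuousOn, cQ1.continuousOn, fun t ht u => by simpa using (hu2 u).eq t ht,
      fun t ht u => by simpa using (hu1 u).eq t ht⟩
  obtain ⟨dL, eLt, eL⟩ := nL.wave hT dP1 dQ1
    (g := fun t x => cothTrunc lam (L t x) * rot2 (-1) C D b t x * rot2 1 A B a t x)
    ((cKL.mul cQ2).mul cP2).continuousOn
    (fun t ht u => by simpa using (hfr.isPrim_P hT0 hK h.memLp_C h.memLp_D u).1.eq t ht)
    (fun t ht u => by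
      have := (hfr.isPrim_Q hT0 hK h.memLp_A h.memLp_B u).1.eq t ht
      simp only [add_zero] at this
      rw [this]
      congr 1
      exact intervalIntegral.integral_congr fun s _ => by ring)
  have dun : ∀ w : ℝ → ℝ → ℝ, ContDiffOn ℝ 1 (fun z : ℝ × ℝ => w z.1 z.2) (Icc 0 T ×ˢ univ) →
      ContDiffOn ℝ 1 (fun z : ℝ × ℝ => unframe lam L w z.1 z.2) (Icc 0 T ×ˢ univ) := fun w hw =>
    contDiffOn_const.mul ((((contDiffOn_const.add (dL.of_le one_le_two)).sinh).inv
      fun z hz => hs z.1 hz.1 z.2).mul hw)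
  have dp : ContDiffOn ℝ 1 (fun z : ℝ × ℝ => p z.1 z.2) (Icc 0 T ×ˢ univ) := hp ▸ dun _ dP2
  have dq : ContDiffOn ℝ 1 (fun z : ℝ × ℝ => q z.1 z.2) (Icc 0 T ×ˢ univ) := hq ▸ dun _ dQ2
  have cg : ContinuousOn (fun z : ℝ × ℝ => -(cothTrunc lam (L z.1 z.2) *
      (rot1 1 A B a z.1 z.2 * q z.1 z.2 + p z.1 z.2 * rot1 (-1) C D b z.1 z.2)))
      (Icc 0 T ×ˢ univ) :=
    (cKL.continuousOn.mul ((cP1.continuousOn.mul dq.continuousOn).add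
      (dp.continuousOn.mul cQ1.continuousOn))).neg
  have slice : ∀ {w : ℝ → ℝ → ℝ}, ContinuousOn (fun z : ℝ × ℝ => w z.1 z.2) (Icc 0 T ×ˢ univ) →
      ∀ t ∈ Icc 0 T, Continuous (w t) := fun {w} hw t ht =>
    hw.comp_continuous (f := fun x => (t, x)) (by fun_prop) fun x => ⟨ht, mem_univ _⟩
  have cφ : ∀ t ∈ Icc 0 T, Continuous (φ t) := fun t ht => by
    have := continuous_integral_along (σ := 0) (f := fun t x => 2⁻¹ * (p t x + q t x))
      (continuousOn_const.mul (dp.continuousOn.add dq.continuousOn)) ht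
    simp only [zero_mul, sub_zero] at this
    rw [hφ]
    exact hφ₀.add this
  have nφ : HasNullDerivs T φ p q :=
    ⟨dp.continuousOn, dq.continuousOn,
      fun t ht u => by simpa using t2.forall_eq cφ dp.continuousOn t ht u,
      fun t ht u => by simpa using t1.forall_eq cφ dq.continuousOn t ht u⟩
  obtain ⟨dφ, eφt, eφ⟩ := nφ.wave hT dp dq
    (g := fun t x => -(cothTrunc lam (L t x) *
      (rot1 1 A B a t x * q t x + p t x * rot1 (-1) C D b t x))) cg
    (fun t ht u => by simpa using t3.forall_eq (slice dp.continuousOn) cg t ht u)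
    (fun t ht u => by simpa using t4.forall_eq (slice dq.continuousOn) cg t ht u)
  refine ⟨L, φ, dL, dφ, fun t ht => ?_, fun t ht x => (pos t ht x).ne', fun t ht x => ?_⟩
  · obtain ⟨h1, h2, h3, h4⟩ := hU t ht
    simp only [eLt t ht, eφt t ht]
    rw [h1, h2, h3, h4]
    exact ⟨ae_eq_rfl, ae_eq_rfl, ae_eq_rfl, ae_eq_rfl⟩
  · obtain ⟨l1, l2, l3⟩ := eL t ht x
    obtain ⟨f1, f2, f3⟩ := eφ t ht x
    have ht' := Ioo_subset_Icc_self ht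
    have hne := hs t ht' x
    have hdbl : Real.sinh (2 * lam + 2 * L t x) =
        2 * Real.sinh (lam + L t x) * Real.cosh (lam + L t x) := by
      rw [← Real.sinh_two_mul]; ring_nf
    rw [l1, l2, l3, f1, f2, f3, F1, F2, hdbl, cothTrunc_eq (hL t ht' x)]
    constructor
    · simp only [hp, hq, unframe]
      field_simp
      ring
    · field_simp
      ring

end

/-! ### Choice of the time interval and conclusion -/

theorem l2norm_zero_fun : l2norm (fun _ => 0) = 0 := by
  have : (fun _ : ℝ => (0 : ℝ)) = 0 := rfl
  rw [l2norm, this, eLpNorm_zero, ENNReal.toReal_zero]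

theorem EnergySpace.compLe_sub_self (u : EnergySpace) : (u - u).CompLe 0 := by
  have e : ∀ f : ℝ → ℝ, l2norm (fun x => f x - f x) ≤ 0 := fun f => by
    simp only [sub_self, l2norm_zero_fun, le_refl]
  exact ⟨e _, e _, e _, e _, e _, e _⟩

theorem ae_eq_of_l2norm_sub_le_zero {f g : ℝ → ℝ} (hf : MemLp f 2 volume) (hg : MemLp g 2 volume)
    (h : l2norm (fun x => f x - g x) ≤ 0) : f =ᵐ[volume] g := by
  have hm : MemLp (fun x => f x - g x) 2 volume := hf.sub hg
  have h0 : eLpNorm (fun x => f x - g x) 2 volume = 0 :=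
    ((ENNReal.toReal_eq_zero_iff _).1 (h.antisymm (l2norm_nonneg _))).resolve_right hm.2.ne
  rw [eLpNorm_eq_zero_iff hm.1 two_ne_zero] at h0
  filter_upwards [h0] with x hx using sub_eq_zero.1 hx

theorem EnergySpace.aeEq_of_compLe_zero {u v : EnergySpace} (h : (u - v).CompLe 0) : u.AEEq v :=
  ⟨ae_eq_of_l2norm_sub_le_zero u.Lam.memLp_toFun v.Lam.memLp_toFun h.Lam,
    ae_eq_of_l2norm_sub_le_zero u.phi.memLp_toFun v.phi.memLp_toFun h.phi,
    ae_eq_of_l2norm_sub_le_zero u.Lamt.memLp_toFun v.Lamt.memLp_toFun h.Lamt,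
    ae_eq_of_l2norm_sub_le_zero u.phit.memLp_toFun v.phit.memLp_toFun h.phit⟩

/-- Times on which the Cauchy problem is solvable for all data of size `lam / 6`. -/
def IsAdmissibleTime (lam T : ℝ) : Prop :=
  ∃ κ, 1 ≤ κ ∧ (∀ z, |cothTrunc lam z| ≤ κ) ∧
    (∀ z z', |cothTrunc lam z - cothTrunc lam z'| ≤ κ * |z - z'|) ∧
    2 * κ * (√T * frameBound lam) ≤ 1 / 2 ∧ √T * frameBound lam ≤ lam / 6

theorem exists_isAdmissibleTime {lam : ℝ} (hlam : 0 < lam) : ∃ T, 0 < T ∧ IsAdmissibleTime lam T := by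
  obtain ⟨κ, hκ1, hκ, hκl⟩ := exists_cothTrunc_bound hlam
  have hN := frameBound_nonneg hlam
  set N := frameBound lam
  have hκ0 : 0 < κ := zero_lt_one.trans_le hκ1
  -- The number `δ` is the square root of the time; `N + 1` avoids division by zero.
  set δ := min (1 / (4 * κ)) (lam / 6) / (N + 1) with hδ
  have hm : 0 < min (1 / (4 * κ)) (lam / 6) := lt_min (by positivity) (by positivity)
  have hδ0 : 0 < δ := by positivity
  have hδN : δ * N ≤ min (1 / (4 * κ)) (lam / 6) := by
    rw [hδ, div_mul_eq_mul_div, div_le_iff₀ (by positivity)]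
    nlinarith
  refine ⟨δ ^ 2, by positivity, κ, hκ1, hκ, hκl, ?_, ?_⟩ <;> rw [Real.sqrt_sq hδ0.le]
  · have := hδN.trans (min_le_left _ _)
    rw [le_div_iff₀ (by positivity)] at this
    linarith
  · exact hδN.trans (min_le_right _ _)

theorem IsAdmissibleTime.exists_solution {lam T : ℝ} (h : IsAdmissibleTime lam T) (hlam : 0 < lam)
    (hT : 0 < T) {u : EnergySpace} (hu : u.CompLe (lam / 6)) :
    ∃ U : ℝ → EnergySpace, IsSolution lam T u U ∧ MemLinf T U ∧
      (∃ c : ℝ, 0 < c ∧ ∀ t ∈ Icc (0 : ℝ) T, ∀ᵐ x, c ≤ lam + (U t).Lam.toFun x) ∧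
      (IsC2Data u → IsClassical lam T U) := by
  obtain ⟨κ, hκ1, hκ, hκl, hs1, hs2⟩ := h
  have hκ0 : 0 ≤ κ := zero_le_one.trans hκ1
  -- For regular data the `C¹` representatives have to be chosen before the frame is constructed, so
  -- that the same solution is weak and classical.
  obtain ⟨A, B, C, D, L₀, hF, hreg⟩ : ∃ A B C D L₀ : ℝ → ℝ, FrameData lam u A B C D L₀ ∧
      (IsC2Data u → ContDiff ℝ 1 A ∧ ContDiff ℝ 1 B ∧ ContDiff ℝ 1 C ∧ ContDiff ℝ 1 D) := by
    by_cases hc : IsC2Data u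
    · obtain ⟨A, B, C, D, L₀, hF, h1, h2, h3, h4, -⟩ := hc.exists_frameData lam
      exact ⟨A, B, C, D, L₀, hF, fun _ => ⟨h1, h2, h3, h4⟩⟩
    · obtain ⟨A, B, C, D, L₀, hF⟩ := exists_frameData lam u
      exact ⟨A, B, C, D, L₀, hF, fun h => absurd h hc⟩
  have hsum : √T * (l2norm A + l2norm B + l2norm C + l2norm D) ≤ √T * frameBound lam :=
    mul_le_mul_of_nonneg_left (hF.l2norm_sum_le hu) (Real.sqrt_nonneg T)
  obtain ⟨a, b, L, hfr⟩ := exists_isFrame hT.le hκ1 hκ hκl hF.memLp_A hF.memLp_B hF.memLp_C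
    hF.memLp_D hF.cont_L (hF.abs_L_le hu)
    ((mul_le_mul_of_nonneg_left hsum (by positivity)).trans hs1)
  have hL : ∀ t ∈ Icc 0 T, ∀ x, |L t x| ≤ lam / 2 := fun t ht x => by
    have := hfr.abs_L_le hF.memLp_A hF.memLp_B hF.memLp_C hF.memLp_D (hF.abs_L_le hu) ht x
    linarith
  obtain ⟨U, hU, mU, eU, hu1, hu2, t1, t2, t3, t4⟩ := hF.exists_solution hlam hT.le hfr hL rfl rfl rfl
  refine ⟨U, hU, mU, ⟨lam / 2, half_pos hlam, fun t ht => Eventually.of_forall fun x => ?_⟩,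
    fun hc => ?_⟩
  · rw [(eU t ht).1]
    linarith [(abs_le.1 (hL t ht x)).1]
  · obtain ⟨h1, h2, h3, h4⟩ := hreg hc
    exact hF.isClassical hlam hT h1 h2 h3 h4 hc.phi.continuous hfr hL rfl rfl rfl eU hu1 hu2
      t1 t2 t3 t4

theorem IsAdmissibleTime.exists_stability {lam T : ℝ} (h : IsAdmissibleTime lam T) (hlam : 0 < lam)
    (hT : 0 < T) : ∃ M, ∀ (u v : EnergySpace) (U V : ℝ → EnergySpace) (r : ℝ),
      u.CompLe (lam / 6) → v.CompLe (lam / 6) → (u - v).CompLe r → IsSolution lam T u U →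
      MemLinf T U → IsSolution lam T v V → MemLinf T V →
      ∀ t ∈ Icc 0 T, (U t - V t).CompLe (M * r) := by
  obtain ⟨κ, hκ1, hκ, hκl, hs1, hs2⟩ := h
  exact PCF.exists_stability hlam hT.le hκ1 hκ hκl hs1 hs2

theorem IsAdmissibleTime.tendsto_linfNorm {lam T : ℝ} (h : IsAdmissibleTime lam T) (hlam : 0 < lam)
    (hT : 0 < T) {u₀ : EnergySpace} (hu₀ : u₀.CompLe (lam / 6)) {u : ℕ → EnergySpace}
    (hu : ∀ᶠ i in atTop, (u i).CompLe (lam / 6))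
    (hlim : Tendsto (fun i => (u i - u₀).norm) atTop (𝓝 0)) {U : ℝ → EnergySpace}
    {V : ℕ → ℝ → EnergySpace} (hU : IsSolution lam T u₀ U) (mU : MemLinf T U)
    (hV : ∀ᶠ i in atTop, IsSolution lam T (u i) (V i) ∧ MemLinf T (V i)) :
    Tendsto (fun i => linfNorm T fun t => V i t - U t) atTop (𝓝 0) := by
  obtain ⟨M, hM⟩ := h.exists_stability hlam hT
  have h2 : Tendsto (fun i => ENNReal.ofReal (4 * (M * (u i - u₀).norm))) atTop (𝓝 0) := by
    have := ENNReal.tendsto_ofReal ((hlim.const_mul M).const_mul 4)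
    simpa using this
  refine tendsto_of_tendsto_of_tendsto_of_le_of_le' tendsto_const_nhds h2
    (Eventually.of_forall fun _ => zero_le) ?_
  filter_upwards [hu, hV] with i hi hVi
  exact iSup₂_le fun t ht => ENNReal.ofReal_le_ofReal
    (hM _ _ _ _ _ hi hu₀ (EnergySpace.compLe_norm _) hVi.1 hVi.2 hU mU t ht).norm_le

end PCF

theorem proposition1p1 :
    ∃ D : ℝ, 1 ≤ D ∧ ∃ T : ℝ → ℝ → ℝ → ℝ, (∀ a b lam : ℝ, 0 < T a b lam) ∧
      ∀ lam : ℝ, 0 < lam → ∀ u₀ : PCF.EnergySpace, u₀.norm ≤ lam / (2 * D) →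
        -- existence and uniqueness on `[0, T]`, `T` depending on the norms of the data and `lam`
        (∃ U : ℝ → PCF.EnergySpace,
          PCF.IsSolution lam (T u₀.posNorm u₀.velNorm lam) u₀ U ∧
          PCF.MemLinf (T u₀.posNorm u₀.velNorm lam) U ∧
          (∃ c : ℝ, 0 < c ∧ ∀ t ∈ Set.Icc (0 : ℝ) (T u₀.posNorm u₀.velNorm lam),
            ∀ᵐ x, c ≤ lam + (U t).Lam.toFun x) ∧
          (PCF.IsC2Data u₀ → PCF.IsClassical lam (T u₀.posNorm u₀.velNorm lam) U) ∧
          ∀ V : ℝ → PCF.EnergySpace,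
            PCF.IsSolution lam (T u₀.posNorm u₀.velNorm lam) u₀ V →
            PCF.MemLinf (T u₀.posNorm u₀.velNorm lam) V →
            ∀ t ∈ Set.Icc (0 : ℝ) (T u₀.posNorm u₀.velNorm lam), (V t).AEEq (U t)) ∧
        -- continuous dependence on the data
        (∀ u : ℕ → PCF.EnergySpace,
          Filter.Tendsto (fun i => (u i - u₀).posNorm) Filter.atTop (nhds 0) →
          Filter.Tendsto (fun i => (u i - u₀).velNorm) Filter.atTop (nhds 0) →
          (∀ᶠ i in Filter.atTop, ∃ V : ℝ → PCF.EnergySpace,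
            PCF.IsSolution lam (T u₀.posNorm u₀.velNorm lam) (u i) V ∧
            PCF.MemLinf (T u₀.posNorm u₀.velNorm lam) V) ∧
          ∀ (U : ℝ → PCF.EnergySpace) (V : ℕ → ℝ → PCF.EnergySpace),
            PCF.IsSolution lam (T u₀.posNorm u₀.velNorm lam) u₀ U →
            PCF.MemLinf (T u₀.posNorm u₀.velNorm lam) U →
            (∀ᶠ i in Filter.atTop,
              PCF.IsSolution lam (T u₀.posNorm u₀.velNorm lam) (u i) (V i) ∧
              PCF.MemLinf (T u₀.posNorm u₀.velNorm lam) (V i)) →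
            Filter.Tendsto
              (fun i => PCF.linfNorm (T u₀.posNorm u₀.velNorm lam) (fun t => V i t - U t))
              Filter.atTop (nhds 0)) := by

  choose! τ hτ0 hτ using fun (lam : ℝ) (hlam : 0 < lam) => PCF.exists_isAdmissibleTime hlam
  -- With `D = 4` the data have norm at most `lam / 8`, below the threshold `lam / 6`, so nearby
  -- data are admissible on the same interval. The time depends on `lam` alone; the value `1` for
  -- `lam ≤ 0` is a filler.
  refine ⟨4, by norm_num, fun _ _ lam => if 0 < lam then τ lam else 1, fun a b lam => ?_,
    fun lam hlam u₀ hu₀ => ?_⟩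
  · dsimp only
    split_ifs with h
    exacts [hτ0 lam h, one_pos]
  · simp only [if_pos hlam]
    have hT := hτ0 lam hlam
    have adm := hτ lam hlam
    have h8 : u₀.CompLe (lam / 8) := u₀.compLe_norm.mono (by linarith)
    have h6 : u₀.CompLe (lam / 6) := h8.mono (by linarith)
    refine ⟨?_, fun u hpos hvel => ?_⟩
    · obtain ⟨U, hU, mU, hlow, hcl⟩ := adm.exists_solution hlam hT h6
      obtain ⟨M, hM⟩ := adm.exists_stability hlam hT
      refine ⟨U, hU, mU, hlow, hcl, fun V hV mV t ht => PCF.EnergySpace.aeEq_of_compLe_zero ?_⟩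
      -- Uniqueness is the Lipschitz estimate for equal data, `r = 0`.
      simpa using hM u₀ u₀ V U 0 h6 h6 u₀.compLe_sub_self hV mV hU mU t ht
    · have hlim : Tendsto (fun i => (u i - u₀).norm) atTop (𝓝 0) := by
        have := hpos.add hvel
        rw [add_zero] at this
        exact this
      have hu : ∀ᶠ i in atTop, (u i).CompLe (lam / 6) := by
        -- The margin is `1 / 8 + 1 / 24 = 1 / 6`.
        filter_upwards [hlim.eventually_le_const (show (0 : ℝ) < lam / 24 by positivity)] with i hi
        exact (h8.of_sub ((PCF.EnergySpace.compLe_norm _).mono hi)).mono (by linarith)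
      refine ⟨hu.mono fun i hi => ?_, fun U V hU mU hV =>
        adm.tendsto_linfNorm hlam hT h6 hu hlim hU mU hV⟩
      obtain ⟨V, hV, mV, -⟩ := adm.exists_solution hlam hT hi
      exact ⟨V, hV, mV⟩
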